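/- For $\varepsilon>0$, $\gamma>0$ and $\Psi=(\psi_1,\psi_2)$ let $$G_\varepsilon(\Psi)=\frac12\int_{\mathbb R}\Big[\varepsilon^2(\psi_1')^2+\varepsilon^2(\psi_2')^2+(x^2-1)(\psi_1^2+\psi_2^2)+\tfrac12(\psi_1^2+\psi_2^2)^2+(\gamma-1)\psi_1^2\psi_2^2\Big]\,dx,$$ which is defined on $\mathcal E=H^1(\mathbb R;\mathbb R^2)\cap L^{2,1}(\mathbb R;\mathbb R^2)$, where $L^{2,1}(\mathbb R)=\{f\in L^2(\mathbb R): |x|f\in L^2(\mathbb R)\}$, and let $\mathcal E_s=\{\Psi\in\mathcal E:\ \psi_1(x)=\psi_2(-x)\text{ for all }x\in\mathbb R\}$ (elements of $H^1(\mathbb R)$ are identified with their continuous representatives). A global minimizer of $G_\varepsilon$ in $\mathcal E_s$ is a $\Psi\in\mathcal E_s$ with $G_\varepsilon(\Psi)\le G_\varepsilon(\Psi')$ for all $\Psi'\in\mathcal E_s$. A saddle point of $G_\varepsilon$ in $\mathcal E_s$ is a critical point $\Psi\in\mathcal E_s$ of $G_\varepsilon|_{\mathcal E_s}$ every neighbourhood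 of which in $\mathcal E_s$ (in the norm of $\mathcal E$) contains points of lower energy and points of higher energy than $\Psi$. A domain wall state is a $\Psi\in\mathcal E_s$ with $\psi_1\not\equiv\psi_2$ that solves $$-\varepsilon^2\psi_1''+x^2\psi_1+(\psi_1^2+\gamma\psi_2^2-1)\psi_1=0,\qquad -\varepsilon^2\psi_2''+x^2\psi_2+(\gamma\psi_1^2+\psi_2^2-1)\psi_2=0,\qquad x\in\mathbb R .$$ **Theorem.** There exist $\varepsilon_0>0$ and a function $\gamma_0:(0,\varepsilon_0)\to(1,\infty)$ with $\gamma_0(\varepsilon)\to1$ as $\varepsilon\to0$ such that the following holds for every $\varepsilon\in(0,\varepsilon_0)$. The equation $\varepsilon^2\eta''+(1-x^2-\eta^2)\eta=0$ on $\mathbb R$ has a unique positive solution $\eta_\varepsilon\in H^1(\mathbb R)\cap L^{2,1}(\mathbb R)$, and the symmetric state $$\psi_1=\psi_2=(1+\gamma)^{-1/2}\eta_\varepsilon$$ is a global minimizer of $G_\varepsilon$ in $\mathcal E_s$ if $\gamma\in(0,\gamma_0(\varepsilon)]$ and a saddle point of $G_\varepsilon$ in $\mathcal E_s$ if $\gamma\in(\gamma_0(\varepsilon),\infty)$.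 Moreover, if $\gamma\in(\gamma_0(\varepsilon),\infty)$, then there are two domain wall states that are global minimizers of $G_\varepsilon$ in $\mathcal E_s$: one satisfies $\psi_1(x)>\psi_2(x)>0$ for all $x>0$, and the other one is obtained from it by the exchange $\psi_1\leftrightarrow\psi_2$. -/

import Mathlib

open MeasureTheory Set Filter Topology
open scoped ContDiff

/-- `g` is a weak derivative of `f` on `ℝ`: `∫ f φ' = - ∫ g φ` for all test functions
`φ ∈ C_c^∞(ℝ)`. -/
def IsWeakDeriv (f g : ℝ → ℝ) : Prop :=
  ∀ φ : ℝ → ℝ, ContDiff ℝ ∞ φ → HasCompactSupport φ →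
    ∫ x, f x * deriv φ x = - ∫ x, g x * φ x

/-- `f ∈ H¹(ℝ)`: `f ∈ L²(ℝ)` has a weak derivative in `L²(ℝ)`. By the Sobolev embedding every class
in `H¹(ℝ)` has exactly one continuous representative, and `f` is taken to be that one, so that
pointwise conditions on `f` make sense. -/
def MemH1 (f : ℝ → ℝ) : Prop :=
  Continuous f ∧ MemLp f 2 volume ∧ ∃ g : ℝ → ℝ, MemLp g 2 volume ∧ IsWeakDeriv f g

/-- A continuous function with zero weak derivative is constant. -/
lemma IsWeakDeriv.eq_const_of_zero {h : ℝ → ℝ} (hc : Continuous h)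
    (hh : ∀ φ : ℝ → ℝ, ContDiff ℝ ∞ φ → HasCompactSupport φ → ∫ x, h x * deriv φ x = 0) :
    ∃ c : ℝ, ∀ x, h x = c := by
  let b : ContDiffBump (0 : ℝ) := default
  set ρ : ℝ → ℝ := b.normed volume with hρ
  have hρs : ContDiff ℝ ∞ ρ := b.contDiff_normed
  have hρc : HasCompactSupport ρ := b.hasCompactSupport_normed
  have hρi : ∫ x, ρ x = 1 := b.integral_normed
  have key : ∀ ψ : ℝ → ℝ, ContDiff ℝ ∞ ψ → HasCompactSupport ψ → ∫ x, ψ x = 0 →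
      ∫ x, h x * ψ x = 0 := by
    intro ψ hψ hψc hψ0
    have hder : ∀ x, HasDerivAt (fun x => ∫ t in Iic x, ψ t) (ψ x) x := by
      intro x
      have hint : Integrable ψ := hψ.continuous.integrable_of_hasCompactSupport hψc
      have h1 : (fun x => ∫ t in Iic x, ψ t) = fun x => (∫ t in Iic 0, ψ t) + ∫ t in (0)..x, ψ t := by
        funext y
        rw [← intervalIntegral.integral_Iic_sub_Iic hint.integrableOn hint.integrableOn]
        ring
      rw [h1]
      exact (hψ.continuous.integral_hasStrictDerivAt 0 x).hasDerivAt.const_add _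
    have hd : deriv (fun x => ∫ t in Iic x, ψ t) = ψ := funext fun x => (hder x).deriv
    have h2 : ContDiff ℝ ∞ (fun x => ∫ t in Iic x, ψ t) := by
      rw [contDiff_infty_iff_deriv, hd]
      exact ⟨fun x => (hder x).differentiableAt, hψ⟩
    have h3 : HasCompactSupport (fun x => ∫ t in Iic x, ψ t) := by
      obtain ⟨R, hR⟩ := hψc.isCompact.isBounded.subset_closedBall 0
      have hz : ∀ x, R < |x| → ψ x = 0 := by
        intro x hx
        by_contra hne
        have := hR (subset_tsupport _ hne)
        rw [mem_closedBall_zero_iff, Real.norm_eq_abs] at this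
        linarith
      refine HasCompactSupport.intro (isCompact_closedBall (0 : ℝ) |R|) fun x hx => ?_
      rw [mem_closedBall_zero_iff, Real.norm_eq_abs, not_le] at hx
      rcases lt_abs.1 hx with h | h
      · have : ∫ t in Iic x, ψ t = ∫ t, ψ t := by
          apply setIntegral_eq_integral_of_forall_compl_eq_zero
          intro t ht
          apply hz
          have : x < t := not_le.1 ht
          exact (le_abs_self R).trans_lt (h.trans (this.trans_le (le_abs_self t)))
        rw [this, hψ0]
      · apply setIntegral_eq_zero_of_forall_eq_zero
        intro t ht
        apply hz
        have ht' : t ≤ x := ht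
        have h5 := neg_le_abs t
        have h6 := le_abs_self R
        linarith
    have := hh _ h2 h3
    rwa [hd] at this
  refine ⟨∫ x, h x * ρ x, ?_⟩
  have hae : ∀ᵐ x, h x = ∫ x, h x * ρ x := by
    apply ae_eq_of_integral_contDiff_smul_eq hc.locallyIntegrable
      (locallyIntegrable_const _)
    intro g hg hgc
    have hgi : Integrable g := hg.continuous.integrable_of_hasCompactSupport hgc
    have hρint : Integrable ρ := hρs.continuous.integrable_of_hasCompactSupport hρc
    have i1 : Integrable (fun x => h x * g x) :=
      (hc.mul hg.continuous).integrable_of_hasCompactSupport hgc.mul_left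
    have i2 : Integrable (fun x => h x * ρ x) :=
      (hc.mul hρs.continuous).integrable_of_hasCompactSupport hρc.mul_left
    have h0 := key (fun x => g x - (∫ y, g y) * ρ x) (hg.sub (contDiff_const.mul hρs))
      (hgc.sub hρc.mul_left)
      (by rw [integral_sub hgi (hρint.const_mul _), integral_const_mul, hρi]; ring)
    have h1 : ∫ x, h x * (g x - (∫ y, g y) * ρ x) =
        (∫ x, h x * g x) - (∫ y, g y) * ∫ x, h x * ρ x := by
      rw [← integral_const_mul, ← integral_sub i1 (i2.const_mul _)]
      congr 1
      funext x
      ring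
    rw [h1] at h0
    simp only [smul_eq_mul]
    rw [integral_mul_const]
    simp only [mul_comm (g _)]
    linarith
  have := Continuous.ae_eq_iff_eq volume hc continuous_const |>.1 hae
  exact fun x => congrFun this x

/-- Integration by parts: the a.e. derivative of a locally absolutely continuous function is a weak
derivative. -/
lemma IsWeakDeriv.of_absolutelyContinuous {f : ℝ → ℝ}
    (hf : ∀ a b, AbsolutelyContinuousOnInterval f a b) : IsWeakDeriv f (deriv f) := by
  intro φ hφ hφc
  obtain ⟨R, hR⟩ := hφc.isCompact.isBounded.subset_closedBall 0
  have hz : ∀ x, R < |x| → φ x = 0 := by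
    intro x hx
    by_contra hne
    have := hR (subset_tsupport _ hne)
    rw [mem_closedBall_zero_iff, Real.norm_eq_abs] at this
    linarith
  have hz' : ∀ x, R < |x| → deriv φ x = 0 := by
    intro x hx
    by_contra hne
    have := hR (support_deriv_subset hne)
    rw [mem_closedBall_zero_iff, Real.norm_eq_abs] at this
    linarith
  set S := |R| + 1
  have hS : R < S := (le_abs_self R).trans_lt (lt_add_one _)
  have hS0 : 0 < S := by positivity
  have hout : ∀ x, x ∉ Ioc (-S) S → R < |x| ∨ x = -S := by
    intro x hx
    by_cases h : x = -S
    · exact Or.inr h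
    · left
      rw [mem_Ioc, not_and_or, not_lt, not_le] at hx
      rcases hx with hx | hx
      · exact hS.trans_le ((by linarith : S ≤ -x).trans (neg_le_abs x))
      · exact hS.trans (hx.trans_le (le_abs_self x))
  have hSm : R < |(-S)| := by rw [abs_neg, abs_of_pos hS0]; exact hS
  have hSp : R < |S| := by rw [abs_of_pos hS0]; exact hS
  have hout' : ∀ x, x ∉ Ioc (-S) S → R < |x| := fun x hx =>
    (hout x hx).elim id (fun h => by rw [h]; exact hSm)
  have hφac : AbsolutelyContinuousOnInterval φ (-S) S :=
    (hφ.of_le (by exact_mod_cast le_top)).contDiffOn.absolutelyContinuousOnInterval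
  have h := (hf (-S) S).integral_mul_deriv_eq_deriv_mul hφac
  rw [hz S hSp, hz (-S) hSm, intervalIntegral.integral_of_le (by linarith),
    intervalIntegral.integral_of_le (by linarith),
    setIntegral_eq_integral_of_forall_compl_eq_zero
      (fun x hx => by rw [hz' x (hout' x hx), mul_zero]),
    setIntegral_eq_integral_of_forall_compl_eq_zero
      (fun x hx => by rw [hz x (hout' x hx), mul_zero])] at h
  linarith

/-- A continuous function with a weak derivative in `L²(ℝ)` is locally absolutely continuous, and
its weak derivative is its a.e. classical derivative. -/
lemma IsWeakDeriv.absolutelyContinuous {f g : ℝ → ℝ} (hf : Continuous f)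
    (hg : MemLp g 2 volume) (hfg : IsWeakDeriv f g) :
    (∀ a b, AbsolutelyContinuousOnInterval f a b) ∧ deriv f =ᵐ[volume] g := by
  have hgl : LocallyIntegrable g := hg.locallyIntegrable (by norm_num)
  have hgi : ∀ a b, IntervalIntegrable g volume a b := fun a b =>
    (hgl.integrableOn_isCompact isCompact_uIcc).intervalIntegrable
  set G : ℝ → ℝ := fun x => ∫ t in (0)..x, g t with hG
  have hGac : ∀ a b, AbsolutelyContinuousOnInterval G a b := by
    intro a b
    have h := (hgi (min a 0 ⊓ b) (max a 0 ⊔ b)).absolutelyContinuousOnInterval_intervalIntegral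
      (c := 0) (by rw [mem_uIcc]; left; simp)
    refine h.mono ?_
    rw [uIcc_of_le (a := min a 0 ⊓ b) (by simp)]
    exact uIcc_subset_Icc (by simp) (by simp)
  have hGd : deriv G =ᵐ[volume] g := by
    filter_upwards [LocallyIntegrable.ae_hasDerivAt_integral hgl] with x hx
    exact (hx 0).deriv
  have hGc : Continuous G := intervalIntegral.continuous_primitive hgi 0
  have hGw := IsWeakDeriv.of_absolutelyContinuous hGac
  obtain ⟨c, hc⟩ := IsWeakDeriv.eq_const_of_zero (h := fun x => f x - G x) (hf.sub hGc) (by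
    intro φ hφ hφc
    have hφd : Continuous (deriv φ) := hφ.continuous_deriv (by simp)
    have hφdc : HasCompactSupport (deriv φ) := hφc.deriv
    have i1 : Integrable (fun x => f x * deriv φ x) :=
      (hf.mul hφd).integrable_of_hasCompactSupport hφdc.mul_left
    have i2 : Integrable (fun x => G x * deriv φ x) :=
      (hGc.mul hφd).integrable_of_hasCompactSupport hφdc.mul_left
    simp only [sub_mul]
    rw [integral_sub i1 i2, hfg φ hφ hφc, hGw φ hφ hφc]
    have : ∫ x, deriv G x * φ x = ∫ x, g x * φ x := by
      apply integral_congr_ae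
      filter_upwards [hGd] with x hx
      rw [hx]
    rw [this]
    ring)
  have hfG : f = fun x => G x + c := funext fun x => by linarith [hc x]
  constructor
  · intro a b
    rw [hfG]
    exact (hGac a b).add
      (contDiff_const (c := c) (n := 1)).contDiffOn.absolutelyContinuousOnInterval
  · rw [hfG]
    filter_upwards [hGd] with x hx
    rw [deriv_add_const, hx]

/-- The functions in `H¹(ℝ)` are the locally absolutely continuous `f ∈ L²(ℝ)` whose
a.e. derivative is in `L²(ℝ)`; the weak derivative is then `deriv f`. -/
lemma memH1_iff {f : ℝ → ℝ} : MemH1 f ↔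
    (∀ a b, AbsolutelyContinuousOnInterval f a b) ∧ MemLp f 2 volume ∧
      MemLp (deriv f) 2 volume := by
  constructor
  · rintro ⟨hf, hf2, g, hg, hfg⟩
    obtain ⟨h1, h2⟩ := hfg.absolutelyContinuous hf hg
    exact ⟨h1, hf2, (memLp_congr_ae h2).2 hg⟩
  · rintro ⟨h1, h2, h3⟩
    refine ⟨?_, h2, _, h3, IsWeakDeriv.of_absolutelyContinuous h1⟩
    rw [continuous_iff_continuousAt]
    intro x
    have := (h1 (x - 1) (x + 1)).continuousOn
    rw [uIcc_of_le (by linarith)] at this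
    exact this.continuousAt (Icc_mem_nhds (by linarith) (by linarith))

/-- The weighted space `L^{2,1}(ℝ) = {f ∈ L²(ℝ) : |x| f ∈ L²(ℝ)}`. -/
def MemL21 (f : ℝ → ℝ) : Prop :=
  MemLp f 2 volume ∧ MemLp (fun x => |x| * f x) 2 volume

/-- The energy space `𝓔 = H¹(ℝ; ℝ²) ∩ L^{2,1}(ℝ; ℝ²)` of pairs `Ψ = (ψ₁, ψ₂)`. -/
def energySpace : Set ((ℝ → ℝ) × (ℝ → ℝ)) :=
  {Ψ | (MemH1 Ψ.1 ∧ MemL21 Ψ.1) ∧ (MemH1 Ψ.2 ∧ MemL21 Ψ.2)}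

/-- The energy space with symmetry `𝓔_s = {Ψ ∈ 𝓔 : ψ₁(x) = ψ₂(-x)}`. -/
def symEnergySpace : Set ((ℝ → ℝ) × (ℝ → ℝ)) :=
  {Ψ | Ψ ∈ energySpace ∧ ∀ x, Ψ.1 x = Ψ.2 (-x)}

/-- The square of the norm of `𝓔`. -/
noncomputable def energyNormSq (Ψ : (ℝ → ℝ) × (ℝ → ℝ)) : ℝ :=
  ∫ x, (deriv Ψ.1 x ^ 2 + deriv Ψ.2 x ^ 2 + (1 + x ^ 2) * (Ψ.1 x ^ 2 + Ψ.2 x ^ 2))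

/-- The energy `G_ε(Ψ)` with coupling parameter `γ`. For `Ψ ∈ 𝓔` the functions `deriv Ψ.1`,
`deriv Ψ.2` are the weak derivatives and the integrand is integrable. -/
noncomputable def gpEnergy (ε γ : ℝ) (Ψ : (ℝ → ℝ) × (ℝ → ℝ)) : ℝ :=
  (1 / 2) * ∫ x, (ε ^ 2 * deriv Ψ.1 x ^ 2 + ε ^ 2 * deriv Ψ.2 x ^ 2
    + (x ^ 2 - 1) * (Ψ.1 x ^ 2 + Ψ.2 x ^ 2)
    + (1 / 2) * (Ψ.1 x ^ 2 + Ψ.2 x ^ 2) ^ 2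
    + (γ - 1) * Ψ.1 x ^ 2 * Ψ.2 x ^ 2)

/-- `η ∈ H¹(ℝ) ∩ L^{2,1}(ℝ)` is a positive solution of
`ε² η'' + (1 - x² - η²) η = 0` on `ℝ`. -/
def IsPositiveSolution (ε : ℝ) (η : ℝ → ℝ) : Prop :=
  MemH1 η ∧ MemL21 η ∧ ContDiff ℝ 2 η ∧ (∀ x, 0 < η x) ∧
    ∀ x, ε ^ 2 * deriv (deriv η) x + (1 - x ^ 2 - η x ^ 2) * η x = 0

/-- `Ψ` is a (classical) solution of the coupled Gross–Pitaevskii system. -/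
def IsSolution (ε γ : ℝ) (Ψ : (ℝ → ℝ) × (ℝ → ℝ)) : Prop :=
  ContDiff ℝ 2 Ψ.1 ∧ ContDiff ℝ 2 Ψ.2 ∧ ∀ x,
    -ε ^ 2 * deriv (deriv Ψ.1) x + x ^ 2 * Ψ.1 x
        + (Ψ.1 x ^ 2 + γ * Ψ.2 x ^ 2 - 1) * Ψ.1 x = 0 ∧
    -ε ^ 2 * deriv (deriv Ψ.2) x + x ^ 2 * Ψ.2 x
        + (γ * Ψ.1 x ^ 2 + Ψ.2 x ^ 2 - 1) * Ψ.2 x = 0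

/-- The symmetric state `ψ₁ = ψ₂ = (1 + γ)^{-1/2} η`. -/
noncomputable def symmetricState (γ : ℝ) (η : ℝ → ℝ) : (ℝ → ℝ) × (ℝ → ℝ) :=
  (fun x => (1 + γ) ^ (-(1 / 2) : ℝ) * η x, fun x => (1 + γ) ^ (-(1 / 2) : ℝ) * η x)

/-- A domain wall state: a solution in `𝓔_s` (so `ψ₁(x) = ψ₂(-x)`) with `ψ₁ ≢ ψ₂`. -/
def IsDomainWall (ε γ : ℝ) (Ψ : (ℝ → ℝ) × (ℝ → ℝ)) : Prop :=
  Ψ ∈ symEnergySpace ∧ IsSolution ε γ Ψ ∧ Ψ.1 ≠ Ψ.2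

/-- `Ψ` is a global minimizer of `G_ε` in the set `S`. -/
def IsGlobalMinimizer (ε γ : ℝ) (S : Set ((ℝ → ℝ) × (ℝ → ℝ))) (Ψ : (ℝ → ℝ) × (ℝ → ℝ)) : Prop :=
  Ψ ∈ S ∧ ∀ Ψ' ∈ S, gpEnergy ε γ Ψ ≤ gpEnergy ε γ Ψ'

/-- `Ψ` is a saddle point of `G_ε` in the linear subspace `S` of `𝓔`: it is a critical point (the
first variation vanishes in all directions in `S`), and every neighbourhood of `Ψ` in `S`, in the
norm of `𝓔`, has points of lower and points of higher energy. -/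
def IsSaddlePoint (ε γ : ℝ) (S : Set ((ℝ → ℝ) × (ℝ → ℝ))) (Ψ : (ℝ → ℝ) × (ℝ → ℝ)) : Prop :=
  Ψ ∈ S ∧
  (∀ Φ ∈ S, HasDerivAt (fun t : ℝ => gpEnergy ε γ (Ψ + t • Φ)) 0 0) ∧
  (∀ δ > 0, ∃ Ψ' ∈ S, energyNormSq (Ψ' - Ψ) < δ ∧ gpEnergy ε γ Ψ' < gpEnergy ε γ Ψ) ∧
  (∀ δ > 0, ∃ Ψ' ∈ S, energyNormSq (Ψ' - Ψ) < δ ∧ gpEnergy ε γ Ψ < gpEnergy ε γ Ψ')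

/-! On `symEnergySpace` write `u = (ψ₁ + ψ₂)/2` and `w = (ψ₁ - ψ₂)/2`; then `w` is odd, and the
energy density depends only on the squares of `u`, `w` and their derivatives (`gpEnergy_add_sub`).
Everything is compared with `groundForm ε η`, the quadratic form of the Schrödinger operator `-ε²
d²/dx² + x² - 1 + η²`. The positive function `η` lies in the kernel of this operator, so the form is
nonnegative (`IsPositiveSolution.groundForm_nonneg`, by Jacobi's criterion with `r = η'/η`).
Uniqueness of `η`, and with it evenness, follows by testing the forms of two solutions on each
other.

Completing squares (`quartic_lower_bound`) bounds the energy excess over the symmetric state from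
below by the form at `u` plus the form at `w` minus `κ ∫ η² w²`, where `κ = 2(γ - 1)/(γ + 1)` for `γ
≥ 1` and `κ = 0` for `γ ≤ 1`. For `γ ≥ 1` the expression in `w` is exactly half the second variation
in the direction `(w, -w)`. Stability against odd perturbations therefore already gives global
minimality, and both are lost at the largest `κ₀` with `κ₀ ∫ η² W² ≤ groundForm ε η W` for all odd
`W`. Solving `2(γ - 1)/(γ + 1) = κ₀` gives `γ₀ = (2 + κ₀)/(2 - κ₀)`. A Hardy-type inequality
(`exists_spectral_gap`) shows `κ₀ > 0`, hence `γ₀ > 1`. On `W = η v` the form is `ε² ∫ η² v'²`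
(`groundForm_mul`), so a fixed odd `v` gives `κ₀ = O(ε²)`, hence `γ₀ → 1`.

For every `γ ≥ 0` the direct method provides a minimizer. Taking absolute values, and then making
`w` nonnegative on the right half line, does not raise the energy; uniqueness for linear ODEs makes
the result positive and, unless it is even, strictly ordered. An even one is the symmetric state,
which is not minimal for `γ > γ₀`, so a domain wall remains. The decoupled case `γ = 0` of the same
construction produces `η`. -/

/-! ### The scalar energy space: bounds, decay, closure properties. -/

/-- The scalar energy space `H¹(ℝ) ∩ L^{2,1}(ℝ)`. -/
def MemEnergy (f : ℝ → ℝ) : Prop := MemH1 f ∧ MemL21 f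

lemma memEnergy_iff {f : ℝ → ℝ} : MemEnergy f ↔
    (∀ a b, AbsolutelyContinuousOnInterval f a b) ∧ MemLp f 2 volume ∧
      MemLp (deriv f) 2 volume ∧ MemLp (fun x => |x| * f x) 2 volume := by
  unfold MemEnergy MemL21
  rw [memH1_iff]
  tauto

/-- A locally absolutely continuous function on the line is differentiable almost everywhere. -/
lemma ae_differentiableAt_of_absolutelyContinuous {f : ℝ → ℝ}
    (hf : ∀ a b, AbsolutelyContinuousOnInterval f a b) : ∀ᵐ x, DifferentiableAt ℝ f x := by
  have h : ∀ᵐ x : ℝ, ∀ n : ℕ, x ∈ uIcc (-(n : ℝ)) n → DifferentiableAt ℝ f x :=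
    ae_all_iff.2 fun n => (hf (-(n : ℝ)) n).ae_differentiableAt
  filter_upwards [h] with x hx
  obtain ⟨n, hn⟩ := exists_nat_ge |x|
  refine hx n ?_
  rw [uIcc_of_le (by linarith [abs_nonneg x])]
  exact abs_le.1 hn

namespace MemEnergy

variable {f g h k : ℝ → ℝ}

lemma ac (hf : MemEnergy f) (a b : ℝ) : AbsolutelyContinuousOnInterval f a b :=
  (memEnergy_iff.1 hf).1 a b

lemma memLp (hf : MemEnergy f) : MemLp f 2 volume := (memEnergy_iff.1 hf).2.1

lemma memLp_deriv (hf : MemEnergy f) : MemLp (deriv f) 2 volume := (memEnergy_iff.1 hf).2.2.1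

lemma memLp_abs_mul (hf : MemEnergy f) : MemLp (fun x => |x| * f x) 2 volume :=
  (memEnergy_iff.1 hf).2.2.2

lemma continuous (hf : MemEnergy f) : Continuous f := hf.1.1

lemma ae_differentiableAt (hf : MemEnergy f) : ∀ᵐ x, DifferentiableAt ℝ f x :=
  ae_differentiableAt_of_absolutelyContinuous hf.ac

lemma integrable_mul (hf : MemEnergy f) (hg : MemEnergy g) : Integrable fun x => f x * g x :=
  hf.memLp.integrable_mul hg.memLp

lemma integrable_deriv_mul_deriv (hf : MemEnergy f) (hg : MemEnergy g) :
    Integrable fun x => deriv f x * deriv g x :=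
  hf.memLp_deriv.integrable_mul hg.memLp_deriv

lemma integrable_mul_deriv (hf : MemEnergy f) (hg : MemEnergy g) :
    Integrable fun x => f x * deriv g x :=
  hf.memLp.integrable_mul hg.memLp_deriv

lemma integrable_sq_mul_mul (hf : MemEnergy f) (hg : MemEnergy g) :
    Integrable fun x => x ^ 2 * (f x * g x) := by
  refine (hf.memLp_abs_mul.integrable_mul hg.memLp_abs_mul).congr (ae_of_all _ fun x => ?_)
  simp only [Pi.mul_apply]
  rw [← sq_abs x]
  ring

lemma integrable_sq (hf : MemEnergy f) : Integrable fun x => f x ^ 2 := by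
  simpa only [sq] using hf.integrable_mul hf

lemma integrable_deriv_sq (hf : MemEnergy f) : Integrable fun x => deriv f x ^ 2 := by
  simpa only [sq] using hf.integrable_deriv_mul_deriv hf

lemma integrable_sq_mul_sq (hf : MemEnergy f) : Integrable fun x => x ^ 2 * f x ^ 2 := by
  simpa only [← sq] using hf.integrable_sq_mul_mul hf

lemma sub_eq_integral (hf : MemEnergy f) (a b : ℝ) : f b - f a = ∫ x in a..b, deriv f x :=
  (hf.ac a b).integral_deriv_eq_sub.symm

lemma sq_eq_integral (hf : MemEnergy f) (x : ℝ) :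
    f x ^ 2 = f 0 ^ 2 + ∫ t in (0)..x, 2 * (f t * deriv f t) := by
  have h := AbsolutelyContinuousOnInterval.integral_deriv_mul_eq_sub (hf.ac 0 x) (hf.ac 0 x)
  have h2 : ∫ t in (0)..x, 2 * (f t * deriv f t) =
      ∫ t in (0)..x, deriv f t * f t + f t * deriv f t := by
    congr 1
    funext t
    ring
  rw [h2, h]
  ring

lemma integrable_two_mul_deriv (hf : MemEnergy f) :
    Integrable fun t => 2 * (f t * deriv f t) :=
  (hf.integrable_mul_deriv hf).const_mul 2

lemma exists_bound (hf : MemEnergy f) : ∃ C, 0 ≤ C ∧ ∀ x, |f x| ≤ C := by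
  refine ⟨√(f 0 ^ 2 + ∫ t, |2 * (f t * deriv f t)|), Real.sqrt_nonneg _, fun x => ?_⟩
  refine Real.abs_le_sqrt ?_
  rw [hf.sq_eq_integral x]
  have h1 : ∫ t in (0)..x, 2 * (f t * deriv f t) ≤ |∫ t in (0)..x, 2 * (f t * deriv f t)| :=
    le_abs_self _
  have h2 : |∫ t in (0)..x, 2 * (f t * deriv f t)| ≤
      ∫ t in uIoc 0 x, |2 * (f t * deriv f t)| := by
    simpa using intervalIntegral.norm_integral_le_integral_norm_uIoc
      (f := fun t => 2 * (f t * deriv f t)) (a := 0) (b := x)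
  have h3 : ∫ t in uIoc 0 x, |2 * (f t * deriv f t)| ≤ ∫ t, |2 * (f t * deriv f t)| :=
    setIntegral_le_integral hf.integrable_two_mul_deriv.abs (ae_of_all _ fun t => abs_nonneg _)
  linarith

/-- The square is a primitive of the integrable function `2 f f'`, so it has a limit; being
integrable itself, it can only tend to zero. -/
lemma tendsto_sq_atTop (hf : MemEnergy f) : Tendsto (fun x => f x ^ 2) atTop (𝓝 0) := by
  have h1 : Tendsto (fun x => f x ^ 2) atTop
      (𝓝 (f 0 ^ 2 + ∫ t in Ioi 0, 2 * (f t * deriv f t))) := by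
    have := intervalIntegral_tendsto_integral_Ioi (μ := volume) (l := atTop) (b := fun x : ℝ => x) 0
      hf.integrable_two_mul_deriv.integrableOn tendsto_id
    refine (this.const_add (f 0 ^ 2)).congr fun x => ?_
    rw [hf.sq_eq_integral x]
  have h2 := IntegrableAtFilter.eq_zero_of_tendsto (l := atTop) (μ := volume)
    ⟨univ, univ_mem, hf.integrable_sq.integrableOn⟩ (fun s hs => by
      obtain ⟨b, hb⟩ := mem_atTop_sets.1 hs
      rw [← top_le_iff, ← Real.volume_Ici (a := b)]
      exact measure_mono hb) h1
  rwa [h2] at h1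

lemma add (hf : MemEnergy f) (hg : MemEnergy g) : MemEnergy fun x => f x + g x := by
  refine memEnergy_iff.2 ⟨fun a b => (hf.ac a b).add (hg.ac a b), hf.memLp.add hg.memLp, ?_, ?_⟩
  · refine (memLp_congr_ae ?_).2 (hf.memLp_deriv.add hg.memLp_deriv)
    filter_upwards [hf.ae_differentiableAt, hg.ae_differentiableAt] with x h1 h2
    exact deriv_fun_add h1 h2
  · refine (memLp_congr_ae (ae_of_all _ fun x => ?_)).2 (hf.memLp_abs_mul.add hg.memLp_abs_mul)
    simp only [Pi.add_apply]
    ring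

lemma const_mul (hf : MemEnergy f) (c : ℝ) : MemEnergy fun x => c * f x := by
  refine memEnergy_iff.2 ⟨fun a b => (hf.ac a b).const_mul c, hf.memLp.const_mul c, ?_, ?_⟩
  · refine (memLp_congr_ae (ae_of_all _ fun x => ?_)).2 (hf.memLp_deriv.const_mul c)
    exact deriv_const_mul_field c
  · refine (memLp_congr_ae (ae_of_all _ fun x => ?_)).2 (hf.memLp_abs_mul.const_mul c)
    ring

lemma neg (hf : MemEnergy f) : MemEnergy fun x => - f x := by
  simpa using hf.const_mul (-1)

lemma sub (hf : MemEnergy f) (hg : MemEnergy g) : MemEnergy fun x => f x - g x := by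
  simpa [sub_eq_add_neg] using hf.add hg.neg

lemma comp_neg (hf : MemEnergy f) : MemEnergy fun x => f (-x) := by
  have hm : MeasurePreserving (fun x : ℝ => -x) volume volume := Measure.measurePreserving_neg _
  refine ⟨⟨hf.continuous.comp continuous_neg, hf.memLp.comp_measurePreserving hm,
    fun x => - deriv f (-x), (hf.memLp_deriv.comp_measurePreserving hm).neg, ?_⟩,
    hf.memLp.comp_measurePreserving hm, ?_⟩
  · intro φ hφ hφc
    have h1 := IsWeakDeriv.of_absolutelyContinuous hf.ac (fun x => φ (-x))
      (hφ.comp contDiff_neg) (hφc.comp_homeomorph (Homeomorph.neg ℝ))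
    have h2 : ∀ x, deriv (fun x => φ (-x)) x = - deriv φ (-x) := fun x => deriv_comp_neg φ x
    simp only [h2] at h1
    have h3 := integral_neg_eq_self (fun x => f (-x) * deriv φ x) volume
    have h4 := integral_neg_eq_self (fun x => deriv f (-x) * φ x) volume
    simp only [neg_neg] at h3 h4
    simp only [mul_neg, neg_mul, integral_neg] at h1 ⊢
    linarith
  · refine (memLp_congr_ae (ae_of_all _ fun x => ?_)).2
      (hf.memLp_abs_mul.comp_measurePreserving hm)
    simp

lemma tendsto_sq_atBot (hf : MemEnergy f) : Tendsto (fun x => f x ^ 2) atBot (𝓝 0) := by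
  have h := hf.comp_neg.tendsto_sq_atTop.comp tendsto_neg_atBot_atTop
  simpa [Function.comp_def] using h

/-- The product of an element of the energy space with a bounded `C¹` function with bounded
derivative. -/
lemma mul_of_bounded (hf : MemEnergy f) {v : ℝ → ℝ} (hv : ContDiff ℝ 1 v) {C : ℝ}
    (hC : ∀ x, |v x| ≤ C) (hC' : ∀ x, |deriv v x| ≤ C) : MemEnergy fun x => f x * v x := by
  have hvm : AEStronglyMeasurable v volume := hv.continuous.aestronglyMeasurable
  have hvm' : AEStronglyMeasurable (deriv v) volume :=
    (hv.continuous_deriv le_rfl).aestronglyMeasurable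
  have key : ∀ {u w : ℝ → ℝ}, MemLp u 2 volume → AEStronglyMeasurable w volume →
      (∀ x, |w x| ≤ C) → MemLp (fun x => u x * w x) 2 volume := by
    intro u w hu hw hwC
    refine (hu.const_mul C).mono (hu.1.mul hw) (ae_of_all _ fun x => ?_)
    rw [norm_mul, norm_mul, mul_comm, Real.norm_eq_abs (w x)]
    exact mul_le_mul_of_nonneg_right ((hwC x).trans (le_abs_self C)) (norm_nonneg _)
  refine memEnergy_iff.2 ⟨fun a b => (hf.ac a b).mul
    hv.contDiffOn.absolutelyContinuousOnInterval, key hf.memLp hvm hC, ?_, ?_⟩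
  · refine (memLp_congr_ae ?_).2 ((key hf.memLp_deriv hvm hC).add (key hf.memLp hvm' hC'))
    filter_upwards [hf.ae_differentiableAt] with x h1
    exact deriv_fun_mul h1 (hv.differentiable one_ne_zero x)
  · refine (memLp_congr_ae (ae_of_all _ fun x => ?_)).2 (key hf.memLp_abs_mul hvm hC)
    ring

lemma of_contDiff (hf : ContDiff ℝ 1 f) (h1 : MemLp f 2 volume) (h2 : MemLp (deriv f) 2 volume)
    (h3 : MemLp (fun x => |x| * f x) 2 volume) : MemEnergy f :=
  memEnergy_iff.2 ⟨fun _ _ => hf.contDiffOn.absolutelyContinuousOnInterval, h1, h2, h3⟩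

/-- Two factors are in `L²` and the other two are bounded. All quartic terms of the energy are
handled through this. -/
lemma integrable_mul_mul_mul (hf : MemEnergy f) (hg : MemEnergy g) (hh : MemEnergy h)
    (hk : MemEnergy k) : Integrable fun x => f x * g x * (h x * k x) := by
  obtain ⟨C, hC0, hC⟩ := hh.exists_bound
  obtain ⟨D, hD0, hD⟩ := hk.exists_bound
  refine (hf.integrable_mul hg).mul_bdd (c := C * D)
    (hh.continuous.mul hk.continuous).aestronglyMeasurable (ae_of_all _ fun x => ?_)
  rw [norm_mul]
  exact mul_le_mul (hC x) (hD x) (norm_nonneg _) hC0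

lemma integrable_sq_mul_sq' (hf : MemEnergy f) (hg : MemEnergy g) :
    Integrable fun x => f x ^ 2 * g x ^ 2 := by
  simpa only [sq] using hf.integrable_mul_mul_mul hf hg hg

lemma integrable_pow_four (hf : MemEnergy f) : Integrable fun x => f x ^ 4 :=
  (hf.integrable_sq_mul_sq' hf).congr (ae_of_all _ fun x => by ring)

end MemEnergy

/-! ### Lipschitz truncation and Jacobi's criterion. -/

lemma abs_deriv_comp_le_of_lipschitz {f T : ℝ → ℝ} (hT : ∀ x y, |T x - T y| ≤ |x - y|) {x : ℝ}
    (hf : DifferentiableAt ℝ f x) : |deriv (fun y => T (f y)) x| ≤ |deriv f x| := by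
  by_cases hd : DifferentiableAt ℝ (fun y => T (f y)) x
  · have h1 := hasDerivAt_iff_tendsto_slope.1 hd.hasDerivAt
    have h2 := hasDerivAt_iff_tendsto_slope.1 hf.hasDerivAt
    refine le_of_tendsto_of_tendsto h1.abs h2.abs (Eventually.of_forall fun y => ?_)
    simp only [slope_def_field, abs_div]
    exact div_le_div_of_nonneg_right (hT _ _) (abs_nonneg _)
  -- Where the composite is not differentiable its `deriv` is zero by convention, so no chain rule
  -- for Lipschitz functions is needed.
  · rw [deriv_zero_of_not_differentiableAt hd, abs_zero]
    exact abs_nonneg _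

lemma MemEnergy.comp_lipschitz {f T : ℝ → ℝ} (hf : MemEnergy f)
    (hT : ∀ x y, |T x - T y| ≤ |x - y|) (hT0 : T 0 = 0) : MemEnergy fun x => T (f x) := by
  have hTc : Continuous T := by
    refine LipschitzWith.continuous (K := 1) (LipschitzWith.of_dist_le_mul fun x y => ?_)
    simpa [Real.dist_eq] using hT x y
  have hle : ∀ y, |T y| ≤ |y| := fun y => by simpa [hT0] using hT y 0
  have hac : ∀ a b, AbsolutelyContinuousOnInterval (fun x => T (f x)) a b := by
    intro a b
    rw [absolutelyContinuousOnInterval_iff]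
    intro ε hε
    obtain ⟨δ, hδ, h⟩ := (absolutelyContinuousOnInterval_iff _ _ _).1 (hf.ac a b) ε hε
    refine ⟨δ, hδ, fun E hE hE' => lt_of_le_of_lt (Finset.sum_le_sum fun i _ => ?_) (h E hE hE')⟩
    exact hT _ _
  refine memEnergy_iff.2 ⟨hac, ?_, ?_, ?_⟩
  · exact hf.memLp.mono (hTc.comp hf.continuous).aestronglyMeasurable (ae_of_all _ fun x => hle _)
  · refine hf.memLp_deriv.mono (measurable_deriv _).aestronglyMeasurable ?_
    filter_upwards [hf.ae_differentiableAt] with x hx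
    exact abs_deriv_comp_le_of_lipschitz hT hx
  · refine hf.memLp_abs_mul.mono
      (continuous_abs.mul (hTc.comp hf.continuous)).aestronglyMeasurable (ae_of_all _ fun x => ?_)
    rw [norm_mul, norm_mul]
    exact mul_le_mul_of_nonneg_left (hle _) (norm_nonneg _)

/-- Jacobi's criterion: if `r` solves the Riccati inequality `ε² (r' + r²) ≤ V` on `[a, b]`, then
the quadratic form `∫ ε² W'² + V W²` is nonnegative on functions vanishing at `a` and `b`. -/
lemma integral_nonneg_of_riccati {a b ε : ℝ} (hab : a ≤ b) {r V W : ℝ → ℝ}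
    (hr : AbsolutelyContinuousOnInterval r a b) (hW : MemEnergy W)
    (hV : Continuous V) (ha : W a = 0) (hb : W b = 0)
    (hle : ∀ᵐ x, x ∈ Icc a b → ε ^ 2 * (deriv r x + r x ^ 2) ≤ V x) :
    0 ≤ ∫ x in a..b, (ε ^ 2 * deriv W x ^ 2 + V x * W x ^ 2) := by
  have hWW := (hW.ac a b).mul (hW.ac a b)
  have hH := hr.mul hWW
  -- The total derivative `ε² (r W²)'` integrates to zero. The form's integrand exceeds it by at
  -- least `ε² (W' - r W)²`.
  have h0 : ∫ x in a..b, ε ^ 2 * deriv (r * (W * W)) x = 0 := by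
    rw [intervalIntegral.integral_const_mul, hH.integral_deriv_eq_sub]
    simp [ha, hb]
  rw [← h0]
  refine intervalIntegral.integral_mono_ae_restrict hab
    (hH.intervalIntegrable_deriv.const_mul _) ?_ ?_
  · exact ((hW.integrable_deriv_sq.const_mul _).intervalIntegrable).add
      ((hV.mul (hW.continuous.pow 2)).intervalIntegrable _ _)
  · rw [EventuallyLE, ae_restrict_iff' measurableSet_Icc]
    filter_upwards [hle, hr.ae_differentiableAt, hW.ae_differentiableAt] with x h1 h2 h3 hx
    have h2' := (h2 (by rwa [uIcc_of_le hab])).hasDerivAt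
    have h4 := (h2'.mul (h3.hasDerivAt.mul h3.hasDerivAt)).deriv
    rw [h4]
    have h5 := mul_le_mul_of_nonneg_right (h1 hx) (sq_nonneg (W x))
    have h6 : 0 ≤ ε ^ 2 * (deriv W x - r x * W x) ^ 2 := by positivity
    simp only [Pi.mul_apply]
    nlinarith

/-- The soft thresholding function. -/
noncomputable def softThreshold (δ y : ℝ) : ℝ := y - max (-δ) (min δ y)

lemma softThreshold_lipschitz (δ x y : ℝ) :
    |softThreshold δ x - softThreshold δ y| ≤ |x - y| := by
  wlog h : y ≤ x generalizing x y
  · rw [abs_sub_comm, abs_sub_comm x y]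
    exact this y x (le_of_not_ge h)
  unfold softThreshold
  rw [abs_of_nonneg (sub_nonneg.2 h), abs_le]
  constructor <;>
  rcases max_cases (-δ) (min δ x) with ⟨h1, h2⟩ | ⟨h1, h2⟩ <;>
  rcases max_cases (-δ) (min δ y) with ⟨h3, h4⟩ | ⟨h3, h4⟩ <;>
  rcases min_cases δ x with ⟨h5, h6⟩ | ⟨h5, h6⟩ <;>
  rcases min_cases δ y with ⟨h7, h8⟩ | ⟨h7, h8⟩ <;> linarith

lemma softThreshold_eq_zero {δ y : ℝ} (h : |y| ≤ δ) : softThreshold δ y = 0 := by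
  obtain ⟨h1, h2⟩ := abs_le.1 h
  simp [softThreshold, min_eq_right h2, max_eq_right h1]

lemma softThreshold_zero {δ : ℝ} (h : 0 ≤ δ) : softThreshold δ 0 = 0 :=
  softThreshold_eq_zero (by simpa using h)

lemma abs_softThreshold_le {δ : ℝ} (h : 0 ≤ δ) (y : ℝ) : |softThreshold δ y| ≤ |y| := by
  simpa [softThreshold_zero h] using softThreshold_lipschitz δ y 0

lemma abs_softThreshold_sub_le {δ : ℝ} (h : 0 ≤ δ) (y : ℝ) : |softThreshold δ y - y| ≤ δ := by
  unfold softThreshold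
  rw [abs_le]
  constructor <;>
  rcases max_cases (-δ) (min δ y) with ⟨h1, h2⟩ | ⟨h1, h2⟩ <;>
  rcases min_cases δ y with ⟨h5, h6⟩ | ⟨h5, h6⟩ <;> linarith

/-- Nonnegativity of `∫ ε² W'² + V W²` on the energy space follows from nonnegativity on compactly
supported functions. -/
lemma integral_nonneg_of_compactSupport {ε : ℝ} {V W : ℝ → ℝ} (hW : MemEnergy W)
    (hV : Continuous V) (hVW : Integrable fun x => V x * W x ^ 2)
    (h : ∀ U, MemEnergy U → (∀ x, W x = 0 → U x = 0) → ∀ R, 0 ≤ R → (∀ x, R ≤ |x| → U x = 0) →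
      0 ≤ ∫ x in (-R)..R, (ε ^ 2 * deriv U x ^ 2 + V x * U x ^ 2)) :
    0 ≤ ∫ x, (ε ^ 2 * deriv W x ^ 2 + V x * W x ^ 2) := by
  set δ : ℕ → ℝ := fun n => 1 / ((n : ℝ) + 1) with hδ
  have hδ0 : ∀ n, 0 < δ n := fun n => Nat.one_div_pos_of_nat
  -- Since `W` decays, `U n` has compact support. Soft thresholding is 1-Lipschitz and fixes zero,
  -- so it increases neither `|W|` nor `|W'|` and keeps the zeros of `W`.
  set U : ℕ → ℝ → ℝ := fun n x => softThreshold (δ n) (W x) with hU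
  have hUE : ∀ n, MemEnergy (U n) := fun n =>
    hW.comp_lipschitz (softThreshold_lipschitz _) (softThreshold_zero (hδ0 n).le)
  have hle : ∀ n x, U n x ^ 2 ≤ W x ^ 2 := fun n x =>
    sq_le_sq.2 (abs_softThreshold_le (hδ0 n).le _)
  have hVU : ∀ n, Integrable fun x => V x * U n x ^ 2 := fun n => by
    refine hVW.mono (hV.mul ((hUE n).continuous.pow 2)).aestronglyMeasurable
      (ae_of_all _ fun x => ?_)
    rw [norm_mul, norm_mul]
    refine mul_le_mul_of_nonneg_left ?_ (norm_nonneg _)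
    rw [Real.norm_of_nonneg (sq_nonneg _), Real.norm_of_nonneg (sq_nonneg _)]
    exact hle n x
  -- The derivative term is replaced at once by its bound in terms of `W`, so that only the
  -- potential term has to converge.
  have hnn : ∀ n, 0 ≤ (∫ x, ε ^ 2 * deriv W x ^ 2) + ∫ x, V x * U n x ^ 2 := by
    intro n
    have e1 : ∀ᶠ x in atTop, W x ^ 2 < δ n ^ 2 :=
      hW.tendsto_sq_atTop.eventually_lt_const (pow_pos (hδ0 n) 2)
    have e2 : ∀ᶠ x in atBot, W x ^ 2 < δ n ^ 2 :=
      hW.tendsto_sq_atBot.eventually_lt_const (pow_pos (hδ0 n) 2)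
    obtain ⟨a, ha⟩ := eventually_atTop.1 e1
    obtain ⟨b, hb⟩ := eventually_atBot.1 e2
    set R := max (max a (-b)) 0
    have hz : ∀ x, R ≤ |x| → U n x = 0 := by
      intro x hx
      apply softThreshold_eq_zero
      have : W x ^ 2 < δ n ^ 2 := by
        rcases abs_cases x with ⟨h1, h2⟩ | ⟨h1, h2⟩
        · exact ha x (by rw [← h1]; exact (le_max_left _ _).trans ((le_max_left _ _).trans hx))
        · refine hb x ?_
          have : -b ≤ |x| := (le_max_right _ _).trans ((le_max_left _ _).trans hx)
          linarith
      exact (abs_lt_of_sq_lt_sq this (hδ0 n).le).le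
    have hz' : ∀ x, R < |x| → deriv (U n) x = 0 := by
      intro x hx
      have : U n =ᶠ[𝓝 x] fun _ => 0 := by
        filter_upwards [(continuous_abs.tendsto x).eventually_const_lt hx] with y hy
        exact hz y hy.le
      rw [this.deriv_eq, deriv_const]
    have hR0 : 0 ≤ R := le_max_right _ _
    have h1 := h (U n) (hUE n) (fun x hx => by
      simp only [hU, hx]
      exact softThreshold_zero (hδ0 n).le) R hR0 hz
    have h2 : ∫ x in (-R)..R, (ε ^ 2 * deriv (U n) x ^ 2 + V x * U n x ^ 2) =
        ∫ x, (ε ^ 2 * deriv (U n) x ^ 2 + V x * U n x ^ 2) := by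
      rw [intervalIntegral.integral_of_le (by linarith), ← integral_Icc_eq_integral_Ioc]
      refine setIntegral_eq_integral_of_forall_compl_eq_zero fun x hx => ?_
      have : R < |x| := by
        by_contra hcon
        exact hx (abs_le.1 (not_lt.1 hcon))
      rw [hz' x this, hz x this.le]
      ring
    rw [h2, integral_add ((hUE n).integrable_deriv_sq.const_mul _) (hVU n)] at h1
    have h3 : ∫ x, ε ^ 2 * deriv (U n) x ^ 2 ≤ ∫ x, ε ^ 2 * deriv W x ^ 2 := by
      refine integral_mono_ae ((hUE n).integrable_deriv_sq.const_mul _)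
        (hW.integrable_deriv_sq.const_mul _) ?_
      filter_upwards [hW.ae_differentiableAt] with x hx
      exact mul_le_mul_of_nonneg_left
        (sq_le_sq.2 (abs_deriv_comp_le_of_lipschitz (softThreshold_lipschitz _) hx)) (sq_nonneg _)
    linarith
  have hlim : Tendsto (fun n => ∫ x, V x * U n x ^ 2) atTop (𝓝 (∫ x, V x * W x ^ 2)) := by
    refine tendsto_integral_of_dominated_convergence (fun x => ‖V x * W x ^ 2‖)
      (fun n => (hVU n).1) hVW.norm (fun n => ae_of_all _ fun x => ?_) (ae_of_all _ fun x => ?_)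
    · rw [norm_mul, norm_mul]
      refine mul_le_mul_of_nonneg_left ?_ (norm_nonneg _)
      rw [Real.norm_of_nonneg (sq_nonneg _), Real.norm_of_nonneg (sq_nonneg _)]
      exact hle n x
    · refine Tendsto.const_mul _ (Tendsto.pow ?_ 2)
      rw [tendsto_iff_dist_tendsto_zero]
      refine squeeze_zero (fun _ => dist_nonneg) (fun n => ?_)
        (tendsto_one_div_add_atTop_nhds_zero_nat (𝕜 := ℝ))
      rw [Real.dist_eq]
      exact abs_softThreshold_sub_le (hδ0 n).le _
  rw [integral_add (hW.integrable_deriv_sq.const_mul _) hVW]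
  exact ge_of_tendsto' (hlim.const_add _) hnn

/-! ### Positive solutions and the nonnegativity of their form. -/

namespace IsPositiveSolution

variable {ε : ℝ} {η : ℝ → ℝ}

lemma memEnergy (h : IsPositiveSolution ε η) : MemEnergy η := ⟨h.1, h.2.1⟩

lemma contDiff (h : IsPositiveSolution ε η) : ContDiff ℝ 2 η := h.2.2.1

lemma pos (h : IsPositiveSolution ε η) (x : ℝ) : 0 < η x := h.2.2.2.1 x

lemma eqn (h : IsPositiveSolution ε η) (x : ℝ) :
    ε ^ 2 * deriv (deriv η) x = (x ^ 2 - 1 + η x ^ 2) * η x := by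
  linarith [h.2.2.2.2 x]

lemma contDiff_deriv (h : IsPositiveSolution ε η) : ContDiff ℝ 1 (deriv η) :=
  ((contDiff_succ_iff_deriv (n := 1)).1 h.contDiff).2.2

lemma hasDerivAt (h : IsPositiveSolution ε η) (x : ℝ) : HasDerivAt η (deriv η x) x :=
  (h.contDiff.differentiable two_ne_zero x).hasDerivAt

lemma hasDerivAt_deriv (h : IsPositiveSolution ε η) (x : ℝ) :
    HasDerivAt (deriv η) (deriv (deriv η) x) x :=
  (h.contDiff_deriv.differentiable one_ne_zero x).hasDerivAt

lemma comp_neg (h : IsPositiveSolution ε η) : IsPositiveSolution ε fun x => η (-x) := by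
  have hE := h.memEnergy.comp_neg
  refine ⟨hE.1, hE.2, h.contDiff.comp contDiff_neg, fun x => h.pos _, fun x => ?_⟩
  have h1 : deriv (fun x => η (-x)) = fun x => - deriv η (-x) :=
    funext fun x => deriv_comp_neg η x
  have h2 : deriv (fun x => - deriv η (-x)) x = deriv (deriv η) (-x) := by
    rw [deriv.fun_neg, deriv_comp_neg]
    ring
  rw [h1, h2]
  have := h.eqn (-x)
  linarith

lemma continuous (h : IsPositiveSolution ε η) : Continuous η := h.contDiff.continuous

lemma contDiff_logDeriv (h : IsPositiveSolution ε η) :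
    ContDiff ℝ 1 fun x => deriv η x / η x :=
  h.contDiff_deriv.div (h.contDiff.of_le one_le_two) fun x => (h.pos x).ne'

lemma hasDerivAt_logDeriv (h : IsPositiveSolution ε η) (x : ℝ) :
    HasDerivAt (fun x => deriv η x / η x)
      (deriv (deriv η) x / η x - (deriv η x / η x) ^ 2) x := by
  have := (h.hasDerivAt_deriv x).div (h.hasDerivAt x) (h.pos x).ne'
  refine this.congr_deriv ?_
  have := (h.pos x).ne'
  field_simp

lemma riccati (h : IsPositiveSolution ε η) (x : ℝ) :
    ε ^ 2 * (deriv (deriv η) x / η x) = x ^ 2 - 1 + η x ^ 2 := by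
  have := (h.pos x).ne'
  field_simp
  rw [h.eqn x, mul_comm]

end IsPositiveSolution

/-- The quadratic form `∫ ε² W'² + (x² - 1 + η²) W²`. -/
noncomputable def groundForm (ε : ℝ) (η W : ℝ → ℝ) : ℝ :=
  ∫ x, (ε ^ 2 * deriv W x ^ 2 + (x ^ 2 - 1 + η x ^ 2) * W x ^ 2)

lemma MemEnergy.integrable_potential {η W : ℝ → ℝ} (hη : MemEnergy η) (hW : MemEnergy W) :
    Integrable fun x => (x ^ 2 - 1 + η x ^ 2) * W x ^ 2 :=
  ((hW.integrable_sq_mul_sq.sub hW.integrable_sq).add (hη.integrable_sq_mul_sq' hW)).congr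
    (ae_of_all _ fun x => by simp only [Pi.add_apply, Pi.sub_apply]; ring)

lemma MemEnergy.integrable_groundForm {η W : ℝ → ℝ} (ε : ℝ) (hη : MemEnergy η)
    (hW : MemEnergy W) :
    Integrable fun x => ε ^ 2 * deriv W x ^ 2 + (x ^ 2 - 1 + η x ^ 2) * W x ^ 2 :=
  (hW.integrable_deriv_sq.const_mul _).add (hη.integrable_potential hW)

/-- A positive solution is a ground state: the linearised form is nonnegative. -/
lemma IsPositiveSolution.groundForm_nonneg {ε : ℝ} {η W : ℝ → ℝ} (h : IsPositiveSolution ε η)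
    (hW : MemEnergy W) : 0 ≤ groundForm ε η W := by
  have hV : Continuous fun x => x ^ 2 - 1 + η x ^ 2 := by
    have := h.continuous
    fun_prop
  refine integral_nonneg_of_compactSupport hW hV (h.memEnergy.integrable_potential hW) ?_
  intro U hU _ R hR hz
  refine integral_nonneg_of_riccati (r := fun x => deriv η x / η x) (by linarith)
    h.contDiff_logDeriv.contDiffOn.absolutelyContinuousOnInterval hU hV
    (hz _ (by rw [abs_neg, abs_of_nonneg hR])) (hz _ (by rw [abs_of_nonneg hR]))
    (ae_of_all _ fun x _ => ?_)
  rw [(h.hasDerivAt_logDeriv x).deriv, sub_add_cancel, h.riccati]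

/-! ### The spectral gap for functions vanishing at the origin. -/

lemma hasDerivAt_max_sq {x : ℝ} (hx3 : x ≠ 3) :
    HasDerivAt (fun x : ℝ => max (3 - x) 0 * max (3 - x) 0) (-2 * max (3 - x) 0) x := by
  rcases lt_or_gt_of_ne hx3 with hlt | hgt
  · have h1 : HasDerivAt (fun x : ℝ => (3 - x) * (3 - x)) (-2 * (3 - x)) x := by
      have h2 := (hasDerivAt_id x).const_sub 3
      refine (h2.mul h2).congr_deriv ?_
      simp only [id]
      ring
    rw [max_eq_left (by linarith)]
    refine h1.congr_of_eventuallyEq ?_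
    filter_upwards [eventually_lt_nhds hlt] with y hy
    rw [max_eq_left (by linarith)]
  · rw [max_eq_right (by linarith), mul_zero]
    refine (hasDerivAt_const x (0 : ℝ)).congr_of_eventuallyEq ?_
    filter_upwards [eventually_gt_nhds hgt] with y hy
    rw [max_eq_right (by linarith), mul_zero]

/-- With `y = max (3 - x) 0` and `e = η²`, the left side is the change in `r' + r²` when `y² δ/η²`
is added to `r = η'/η`. The factor 27 is `3³`: it makes `s y³ ≤ 1`, so the quadratic term absorbs
only half of `-2 y s`. The bound on `δ` is required only where `y > 0`, because `η²` is bounded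
below only on a compact interval. -/
lemma riccati_perturbation_le {y δ e B : ℝ} (hy0 : 0 ≤ y) (hy3 : y ≤ 3) (hδ : 0 < δ) (he : 0 < e)
    (hB : e ≤ B) (h27 : 0 < y → 27 * δ ≤ e) :
    -2 * y * (δ / e) + (y * y * (δ / e)) ^ 2 ≤ -((δ / B) * y) := by
  set s := δ / e with hs
  have hs0 : 0 < s := by positivity
  have hsB : δ / B ≤ s := div_le_div_of_nonneg_left hδ.le he hB
  rcases eq_or_lt_of_le hy0 with hy00 | hypos
  · rw [← hy00]
    simp
  · have hs27 : s * 27 ≤ 1 := by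
      rw [hs, div_mul_eq_mul_div, div_le_one he]
      linarith [h27 hypos]
    have hy33 : y ^ 3 ≤ 27 := by
      have := pow_le_pow_left₀ hy0 hy3 3
      linarith
    have h1 : s * y ^ 3 ≤ 1 := (mul_le_mul_of_nonneg_left hy33 hs0.le).trans hs27
    have h2 : s * y * (s * y ^ 3) ≤ s * y * 1 := mul_le_mul_of_nonneg_left h1 (by positivity)
    have h3 : δ / B * y ≤ s * y := mul_le_mul_of_nonneg_right hsB hy0
    linarith [show (y * y * s) ^ 2 = s * y * (s * y ^ 3) by ring]

/-- Improved Jacobi inequality on a half line, for functions vanishing at the origin. -/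
lemma IsPositiveSolution.integral_half_nonneg {ε δ B R : ℝ} {η U : ℝ → ℝ}
    (h : IsPositiveSolution ε η) (hU : MemEnergy U) (hδ : 0 < δ)
    (hδη : ∀ x ∈ Icc 0 3, 27 * δ ≤ η x ^ 2) (hB : ∀ x, η x ^ 2 ≤ B) (hR : 0 ≤ R)
    (h0 : U 0 = 0) (hUR : U R = 0) :
    0 ≤ ∫ x in (0)..R, (ε ^ 2 * deriv U x ^ 2 +
      (x ^ 2 - 1 + η x ^ 2 - ε ^ 2 * (δ / B) * max (3 - |x|) 0) * U x ^ 2) := by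
  have hηc := h.continuous
  have hV : Continuous fun x => x ^ 2 - 1 + η x ^ 2 - ε ^ 2 * (δ / B) * max (3 - |x|) 0 := by
    fun_prop
  have hy : AbsolutelyContinuousOnInterval (fun x : ℝ => max (3 - x) 0) 0 R := by
    refine LipschitzOnWith.absolutelyContinuousOnInterval (K := 1) (LipschitzWith.lipschitzOnWith ?_)
    refine LipschitzWith.of_dist_le_mul fun x y => ?_
    rw [NNReal.coe_one, one_mul, Real.dist_eq, Real.dist_eq]
    refine (abs_max_sub_max_le_abs _ _ _).trans ?_
    rw [show 3 - x - (3 - y) = y - x by ring, abs_sub_comm]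
  have hi : AbsolutelyContinuousOnInterval (fun x : ℝ => δ / η x ^ 2) 0 R := by
    refine ContDiffOn.absolutelyContinuousOnInterval (ContDiff.contDiffOn ?_)
    exact contDiff_const.div ((h.contDiff.of_le one_le_two).pow 2)
      fun x => (pow_pos (h.pos x) 2).ne'
  have hr0 : AbsolutelyContinuousOnInterval (fun x : ℝ => deriv η x / η x) 0 R :=
    h.contDiff_logDeriv.contDiffOn.absolutelyContinuousOnInterval
  -- The factor `1/η²` solves the linearised Riccati equation `ρ' + 2 (η'/η) ρ = 0`, so the cross
  -- terms cancel; the gain comes from the decreasing cutoff `y²`.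
  refine integral_nonneg_of_riccati
    (r := fun x => deriv η x / η x + max (3 - x) 0 * max (3 - x) 0 * (δ / η x ^ 2)) hR
    (hr0.fun_add ((hy.fun_mul hy).fun_mul hi)) hU hV h0 hUR ?_
  filter_upwards [compl_mem_ae_iff.2 (measure_singleton (3 : ℝ))] with x hx3 hx
  have hηx := h.pos x
  have hid : HasDerivAt (fun x => δ / η x ^ 2) (-(2 * δ * deriv η x / η x ^ 3)) x := by
    have := (hasDerivAt_const x δ).fun_div ((h.hasDerivAt x).fun_pow 2) (pow_pos hηx 2).ne'
    refine this.congr_deriv ?_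
    field_simp
    ring
  have hyd := hasDerivAt_max_sq hx3
  rw [((h.hasDerivAt_logDeriv x).fun_add (hyd.fun_mul hid)).deriv]
  have hric := h.riccati x
  rw [abs_of_nonneg hx.1]
  set y := max (3 - x) 0 with hydef
  have hy0 : 0 ≤ y := le_max_right _ _
  have hy3 : y ≤ 3 := max_le (by linarith [hx.1]) (by norm_num)
  have key : -2 * y * (δ / η x ^ 2) + (y * y * (δ / η x ^ 2)) ^ 2 ≤ -((δ / B) * y) := by
    refine riccati_perturbation_le hy0 hy3 hδ (pow_pos hηx 2) (hB x) fun hpos => ?_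
    refine hδη x ⟨hx.1, ?_⟩
    by_contra hcon
    rw [hydef, max_eq_right (by linarith)] at hpos
    exact lt_irrefl _ hpos
  have hexp : deriv (deriv η) x / η x - (deriv η x / η x) ^ 2 +
      (-2 * y * (δ / η x ^ 2) + y * y * (-(2 * δ * deriv η x / η x ^ 3))) +
      (deriv η x / η x + y * y * (δ / η x ^ 2)) ^ 2 =
      deriv (deriv η) x / η x +
        (-2 * y * (δ / η x ^ 2) + (y * y * (δ / η x ^ 2)) ^ 2) := by
    field_simp
    ring
  rw [hexp, mul_add, hric]
  have := mul_le_mul_of_nonneg_left key (sq_nonneg ε)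
  linarith

/-- A Hardy-type spectral gap for functions vanishing at the origin. -/
lemma IsPositiveSolution.exists_spectral_gap {ε : ℝ} (hε : 0 < ε) {η : ℝ → ℝ}
    (h : IsPositiveSolution ε η) :
    ∃ κ > 0, ∀ W, MemEnergy W → W 0 = 0 → κ * ∫ x, η x ^ 2 * W x ^ 2 ≤ groundForm ε η W := by
  obtain ⟨C, hC0, hC⟩ := h.memEnergy.exists_bound
  set B := C ^ 2 + 1 with hBdef
  have hB0 : 0 < B := by positivity
  have hB : ∀ x, η x ^ 2 ≤ B := fun x => by
    have := sq_le_sq' (neg_le_of_abs_le (hC x)) (le_of_abs_le (hC x))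
    linarith
  obtain ⟨x₀, -, hx₀⟩ := (isCompact_Icc (a := (-3 : ℝ)) (b := 3)).exists_isMinOn
    (nonempty_Icc.2 (by norm_num)) (h.continuous.pow 2).continuousOn
  set δ := η x₀ ^ 2 / 27 with hδdef
  have hδ : 0 < δ := div_pos (pow_pos (h.pos x₀) 2) (by norm_num)
  have hδη : ∀ x ∈ Icc (-3 : ℝ) 3, 27 * δ ≤ η x ^ 2 := fun x hx => by
    have : η x₀ ^ 2 ≤ η x ^ 2 := isMinOn_iff.1 hx₀ x hx
    rw [hδdef]
    linarith
  set σ := ε ^ 2 * (δ / B) with hσ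
  have hσ0 : 0 < σ := by positivity
  have hηc := h.continuous
  have key : ∀ W, MemEnergy W → W 0 = 0 →
      σ * ∫ x, max (3 - |x|) 0 * W x ^ 2 ≤ groundForm ε η W := by
    intro W hW hW0
    have hwI : ∀ U, MemEnergy U → Integrable fun x => max (3 - |x|) 0 * U x ^ 2 := fun U hU => by
      refine hU.integrable_sq.bdd_mul (c := 3) (by fun_prop) (ae_of_all _ fun x => ?_)
      rw [Real.norm_of_nonneg (le_max_right _ _)]
      exact max_le (by linarith [abs_nonneg x]) (by norm_num)
    have hV : Continuous fun x => x ^ 2 - 1 + η x ^ 2 - σ * max (3 - |x|) 0 := by fun_prop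
    have hVW : Integrable fun x => (x ^ 2 - 1 + η x ^ 2 - σ * max (3 - |x|) 0) * W x ^ 2 :=
      ((h.memEnergy.integrable_potential hW).sub ((hwI W hW).const_mul σ)).congr
        (ae_of_all _ fun x => by simp only [Pi.sub_apply]; ring)
    have hnn := integral_nonneg_of_compactSupport (ε := ε) hW hV hVW (by
      intro U hU hUW R hR hz
      have hUI : ∀ a b, IntervalIntegrable (fun x => ε ^ 2 * deriv U x ^ 2 +
          (x ^ 2 - 1 + η x ^ 2 - σ * max (3 - |x|) 0) * U x ^ 2) volume a b := fun a b =>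
        ((hU.integrable_deriv_sq.const_mul _).intervalIntegrable).add
          ((hV.mul (hU.continuous.pow 2)).intervalIntegrable _ _)
      -- The perturbed Riccati functions of the two half lines do not match at 0, and `U 0 = 0`
      -- removes the boundary term. The left half is treated by reflecting both `U` and `η`, so
      -- evenness of `η` is not needed.
      rw [← intervalIntegral.integral_add_adjacent_intervals (hUI (-R) 0) (hUI 0 R)]
      refine add_nonneg ?_ ?_
      · have h1 := h.comp_neg.integral_half_nonneg (U := fun x => U (-x)) (R := R) hU.comp_neg hδ
          (fun x hx => hδη (-x) ⟨by linarith [hx.2], by linarith [hx.1]⟩) (fun x => hB (-x)) hR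
          (by simpa using hUW 0 hW0) (hz _ (by rw [abs_neg, abs_of_nonneg hR]))
        have h2 : ∀ x, deriv (fun x => U (-x)) x = - deriv U (-x) := fun x => deriv_comp_neg U x
        simp only [h2] at h1
        have h3 := intervalIntegral.integral_comp_neg (a := 0) (b := R)
          (fun x => ε ^ 2 * deriv U x ^ 2 +
          (x ^ 2 - 1 + η x ^ 2 - σ * max (3 - |x|) 0) * U x ^ 2)
        rw [neg_zero] at h3
        rw [← h3]
        simpa using h1
      · exact h.integral_half_nonneg hU hδ
          (fun x hx => hδη x ⟨by linarith [hx.1], hx.2⟩) hB hR (hUW 0 hW0)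
          (hz _ (by rw [abs_of_nonneg hR])))
    have hsplit : ∫ x, (ε ^ 2 * deriv W x ^ 2 +
        (x ^ 2 - 1 + η x ^ 2 - σ * max (3 - |x|) 0) * W x ^ 2) =
        groundForm ε η W - σ * ∫ x, max (3 - |x|) 0 * W x ^ 2 := by
      rw [groundForm, ← integral_const_mul, ← integral_sub
        (h.memEnergy.integrable_groundForm ε hW)
        ((hwI W hW).const_mul σ)]
      congr 1
      funext x
      ring
    rw [hsplit] at hnn
    linarith
  -- From `1 ≤ 2 max (3 - |x|) 0 + (x² - 1)` and `η² ≤ B`, `∫ η² W²` is at most `2 B` times the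
  -- weighted integral plus `B` times the form; `key` bounds the weighted integral by the form over
  -- `σ`.
  refine ⟨1 / (B * (2 / σ + 1)), by positivity, fun W hW hW0 => ?_⟩
  have hwI : Integrable fun x => max (3 - |x|) 0 * W x ^ 2 := by
    refine hW.integrable_sq.bdd_mul (c := 3) (by fun_prop) (ae_of_all _ fun x => ?_)
    rw [Real.norm_of_nonneg (le_max_right _ _)]
    exact max_le (by linarith [abs_nonneg x]) (by norm_num)
  have h1 := key W hW hW0
  have hgI := h.memEnergy.integrable_groundForm ε hW
  have h2 : ∫ x, η x ^ 2 * W x ^ 2 ≤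
      B * (2 * ∫ x, max (3 - |x|) 0 * W x ^ 2) + B * groundForm ε η W := by
    rw [groundForm, ← integral_const_mul, ← integral_const_mul, ← integral_const_mul,
      ← integral_add ((hwI.const_mul _).const_mul _) (hgI.const_mul _)]
    refine integral_mono (h.memEnergy.integrable_sq_mul_sq' hW)
      (((hwI.const_mul _).const_mul _).add (hgI.const_mul _)) fun x => ?_
    simp only
    have h3 : 1 ≤ 2 * max (3 - |x|) 0 + (x ^ 2 - 1) := by
      rcases le_or_gt |x| 2 with h4 | h4
      · have : 1 ≤ max (3 - |x|) 0 := le_max_of_le_left (by linarith)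
        nlinarith [sq_nonneg x]
      · have : 0 ≤ max (3 - |x|) 0 := le_max_right _ _
        have : x ^ 2 = |x| ^ 2 := (sq_abs x).symm
        nlinarith
    have h4 : η x ^ 2 * W x ^ 2 ≤ B * W x ^ 2 := mul_le_mul_of_nonneg_right (hB x) (sq_nonneg _)
    have h5 : B * W x ^ 2 * 1 ≤ B * W x ^ 2 * (2 * max (3 - |x|) 0 + (x ^ 2 - 1)) :=
      mul_le_mul_of_nonneg_left h3 (by positivity)
    have h6 : 0 ≤ B * (ε ^ 2 * deriv W x ^ 2 + η x ^ 2 * W x ^ 2) := by positivity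
    nlinarith
  have h3 : ∫ x, max (3 - |x|) 0 * W x ^ 2 ≤ groundForm ε η W / σ := by
    rw [le_div_iff₀ hσ0]
    linarith
  rw [one_div, inv_mul_le_iff₀ (by positivity)]
  refine h2.trans ?_
  have := mul_le_mul_of_nonneg_left h3 (by positivity : 0 ≤ 2 * B)
  have e : B * (2 / σ + 1) * groundForm ε η W =
      2 * B * (groundForm ε η W / σ) + B * groundForm ε η W := by ring
  linarith

/-! ### Uniqueness, the weak equation and the ground state substitution. -/

namespace IsPositiveSolution

variable {ε : ℝ} {η ζ φ : ℝ → ℝ}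

/-- By the equation, the integrand is the derivative of the integrable function `ε² η η'`. -/
lemma groundForm_self (h : IsPositiveSolution ε η) : groundForm ε η η = 0 := by
  have hE := h.memEnergy
  have hI := hE.integrable_groundForm ε hE
  have key : ∀ x, ε ^ 2 * deriv η x ^ 2 + (x ^ 2 - 1 + η x ^ 2) * η x ^ 2 =
      ε ^ 2 * (deriv η x * deriv η x + η x * deriv (deriv η) x) := fun x => by
    have := h.eqn x
    linear_combination (-η x) * this
  refine integral_eq_zero_of_hasDerivAt_of_integrable (f := fun x => ε ^ 2 * (η x * deriv η x))
    (fun x => ?_) hI ((hE.integrable_mul_deriv hE).const_mul _)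
  rw [key x]
  exact ((h.hasDerivAt x).fun_mul (h.hasDerivAt_deriv x)).const_mul _

lemma groundForm_eq_add (hη : IsPositiveSolution ε η) (hζ : IsPositiveSolution ε ζ) :
    groundForm ε η ζ = ∫ x, (η x ^ 2 - ζ x ^ 2) * ζ x ^ 2 := by
  have h1 := hζ.groundForm_self
  have hE := hη.memEnergy
  have hF := hζ.memEnergy
  have hI : Integrable fun x => (η x ^ 2 - ζ x ^ 2) * ζ x ^ 2 :=
    ((hE.integrable_sq_mul_sq' hF).sub (hF.integrable_sq_mul_sq' hF)).congr
      (ae_of_all _ fun x => by simp only [Pi.sub_apply]; ring)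
  have h2 : groundForm ε η ζ =
      groundForm ε ζ ζ + ∫ x, (η x ^ 2 - ζ x ^ 2) * ζ x ^ 2 := by
    rw [groundForm, groundForm, ← integral_add (hF.integrable_groundForm ε hF) hI]
    congr 1
    funext x
    ring
  rw [h2, h1, zero_add]

/-- Positive solutions in the energy space are unique. -/
lemma unique (hη : IsPositiveSolution ε η) (hζ : IsPositiveSolution ε ζ) : ζ = η := by
  have h1 := hη.groundForm_nonneg hζ.memEnergy
  have h2 := hζ.groundForm_nonneg hη.memEnergy
  rw [hη.groundForm_eq_add hζ] at h1
  rw [hζ.groundForm_eq_add hη] at h2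
  have hE := hη.memEnergy
  have hF := hζ.memEnergy
  have i1 : Integrable fun x => (η x ^ 2 - ζ x ^ 2) * ζ x ^ 2 :=
    ((hE.integrable_sq_mul_sq' hF).sub (hF.integrable_sq_mul_sq' hF)).congr
      (ae_of_all _ fun x => by simp only [Pi.sub_apply]; ring)
  have i2 : Integrable fun x => (ζ x ^ 2 - η x ^ 2) * η x ^ 2 :=
    ((hF.integrable_sq_mul_sq' hE).sub (hE.integrable_sq_mul_sq' hE)).congr
      (ae_of_all _ fun x => by simp only [Pi.sub_apply]; ring)
  -- The two nonnegative forms add up to minus this integral.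
  have h3 : ∫ x, (η x ^ 2 - ζ x ^ 2) ^ 2 = 0 := by
    refine le_antisymm ?_ (integral_nonneg fun x => sq_nonneg _)
    have : ∫ x, (η x ^ 2 - ζ x ^ 2) ^ 2 = -((∫ x, (η x ^ 2 - ζ x ^ 2) * ζ x ^ 2) +
        ∫ x, (ζ x ^ 2 - η x ^ 2) * η x ^ 2) := by
      rw [← integral_add i1 i2, ← integral_neg]
      congr 1
      funext x
      ring
    rw [this]
    linarith
  have i3 : Integrable fun x => (η x ^ 2 - ζ x ^ 2) ^ 2 :=
    (i1.add i2).neg.congr (ae_of_all _ fun x => by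
      simp only [Pi.neg_apply, Pi.add_apply]; ring)
  have h4 := (integral_eq_zero_iff_of_nonneg (fun x => sq_nonneg _) i3).1 h3
  have hc := hη.continuous
  have hd := hζ.continuous
  have h5 := (Continuous.ae_eq_iff_eq volume
    (((hc.pow 2).sub (hd.pow 2)).pow 2) continuous_zero).1 h4
  funext x
  have h6 : (η x ^ 2 - ζ x ^ 2) ^ 2 = 0 := congrFun h5 x
  have h7 : η x ^ 2 - ζ x ^ 2 = 0 := by simpa using h6
  exact (pow_left_inj₀ (hζ.pos x).le (hη.pos x).le two_ne_zero).1 (by linarith)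

lemma even (h : IsPositiveSolution ε η) (x : ℝ) : η (-x) = η x :=
  congrFun (h.unique h.comp_neg) x

lemma integrable_weak (h : IsPositiveSolution ε η) (hφ : MemEnergy φ) :
    Integrable fun x => ε ^ 2 * (deriv η x * deriv φ x) +
      (x ^ 2 - 1 + η x ^ 2) * (η x * φ x) := by
  have hE := h.memEnergy
  refine ((hE.integrable_deriv_mul_deriv hφ).const_mul (ε ^ 2)).add ?_
  refine (((hE.integrable_sq_mul_mul hφ).sub (hE.integrable_mul hφ)).add
    (hE.integrable_mul_mul_mul hE hE hφ)).congr (ae_of_all _ fun x => ?_)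
  simp only [Pi.add_apply, Pi.sub_apply]
  ring

/-- The weak form of the equation, tested against the energy space. -/
lemma weak (h : IsPositiveSolution ε η) (hφ : MemEnergy φ) :
    ∫ x, (ε ^ 2 * (deriv η x * deriv φ x) + (x ^ 2 - 1 + η x ^ 2) * (η x * φ x)) = 0 := by
  have hE := h.memEnergy
  set b := ∫ x, (ε ^ 2 * (deriv η x * deriv φ x) + (x ^ 2 - 1 + η x ^ 2) * (η x * φ x)) with hb
  -- A nonnegative quadratic form that vanishes at `η` has `η` in the kernel of its bilinear form:
  -- expand at `η + t φ`, where the linear coefficient must be zero.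
  have key : ∀ t : ℝ, 0 ≤ t * (2 * b) + t ^ 2 * groundForm ε η φ := by
    intro t
    have h1 := h.groundForm_nonneg (hE.add (hφ.const_mul t))
    have h2 : groundForm ε η (fun x => η x + t * φ x) =
        groundForm ε η η + (t * (2 * b) + t ^ 2 * groundForm ε η φ) := by
      have i1 := (h.integrable_weak hφ).const_mul (t * 2)
      have i2 := (hE.integrable_groundForm ε hφ).const_mul (t ^ 2)
      have e1 : t * (2 * b) = ∫ x, (t * 2) * (ε ^ 2 * (deriv η x * deriv φ x) +
          (x ^ 2 - 1 + η x ^ 2) * (η x * φ x)) := by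
        rw [integral_const_mul]
        ring
      rw [e1, groundForm, groundForm, groundForm, ← integral_const_mul, ← integral_add i1 i2,
        ← integral_add (hE.integrable_groundForm ε hE)
          (g := fun x => (t * 2) * (ε ^ 2 * (deriv η x * deriv φ x) +
          (x ^ 2 - 1 + η x ^ 2) * (η x * φ x)) + t ^ 2 * (ε ^ 2 * deriv φ x ^ 2 +
          (x ^ 2 - 1 + η x ^ 2) * φ x ^ 2)) (i1.add i2)]
      refine integral_congr_ae ?_
      filter_upwards [hφ.ae_differentiableAt] with x hx
      rw [deriv_fun_add (h.hasDerivAt x).differentiableAt (hx.const_mul t),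
        deriv_const_mul_field]
      ring
    rw [h2, h.groundForm_self, zero_add] at h1
    exact h1
  by_contra hne
  set c := groundForm ε η φ with hc
  have hc0 : 0 ≤ c := h.groundForm_nonneg hφ
  -- The near-optimal `t`; the added 1 covers the case `c = 0`.
  have h1 := key (-(b / (c + 1)))
  have hc1 : 0 < c + 1 := by linarith
  have h2 : -(b / (c + 1)) * (2 * b) + (-(b / (c + 1))) ^ 2 * c =
      -(b ^ 2 * (c + 2)) / (c + 1) ^ 2 := by
    field_simp
    ring
  rw [h2] at h1
  have h3 : 0 < b ^ 2 * (c + 2) / (c + 1) ^ 2 := by positivity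
  rw [neg_div] at h1
  linarith

/-- A bound uniform in `ε`: the form vanishes at `η`, while its density is at least `η⁴/2`, minus
`1/2` on `[-1, 1]`. -/
lemma integral_pow_four_le (h : IsPositiveSolution ε η) : ∫ x, η x ^ 4 ≤ 2 := by
  have hE := h.memEnergy
  have h1 := h.groundForm_self
  have hi : Integrable fun x => (Icc (-1 : ℝ) 1).indicator (fun _ => (1 : ℝ)) x :=
    (integrable_indicator_iff measurableSet_Icc).2 (by simp)
  have h2 : ∫ x, ((1 / 2) * η x ^ 4 - (1 / 2) * (Icc (-1 : ℝ) 1).indicator (fun _ => (1 : ℝ)) x) ≤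
      groundForm ε η η := by
    refine integral_mono ((hE.integrable_pow_four.const_mul _).sub (hi.const_mul _))
      (hE.integrable_groundForm ε hE) fun x => ?_
    have h3 : 0 ≤ ε ^ 2 * deriv η x ^ 2 := by positivity
    simp only
    by_cases hx : x ∈ Icc (-1 : ℝ) 1
    · rw [indicator_of_mem hx]
      have h4 : x ^ 2 ≤ 1 := by nlinarith [hx.1, hx.2]
      nlinarith [sq_nonneg (η x ^ 2 - (1 - x ^ 2)), sq_nonneg x, sq_nonneg (η x)]
    · rw [indicator_of_notMem hx]
      have h4 : 1 ≤ x ^ 2 := by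
        by_contra hcon
        exact hx (abs_le.1 ((sq_le_one_iff_abs_le_one x).1 (by linarith)))
      nlinarith [mul_nonneg (sub_nonneg.2 h4) (sq_nonneg (η x)), sq_nonneg (η x ^ 2)]
  rw [h1, integral_sub (hE.integrable_pow_four.const_mul _) (hi.const_mul _), integral_const_mul,
    integral_const_mul, integral_indicator measurableSet_Icc] at h2
  simp at h2
  linarith

/-- The ground state substitution `W = η v`. -/
lemma groundForm_mul (h : IsPositiveSolution ε η) {v : ℝ → ℝ} (hv : ContDiff ℝ 1 v)
    {C : ℝ} (hC : ∀ x, |v x| ≤ C) (hC' : ∀ x, |deriv v x| ≤ C) :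
    groundForm ε η (fun x => η x * v x) = ε ^ 2 * ∫ x, η x ^ 2 * deriv v x ^ 2 := by
  have hE := h.memEnergy
  have hW := hE.mul_of_bounded hv hC hC'
  have hvd : ∀ x, HasDerivAt v (deriv v x) x := fun x =>
    (hv.differentiable one_ne_zero x).hasDerivAt
  have hbd : ∀ {u w : ℝ → ℝ}, Integrable u → Continuous w → (∀ x, |w x| ≤ C) →
      Integrable fun x => u x * w x ^ 2 := by
    intro u w hu hw hwC
    refine hu.mul_bdd (c := C ^ 2) (hw.pow 2).aestronglyMeasurable (ae_of_all _ fun x => ?_)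
    rw [norm_pow]
    exact pow_le_pow_left₀ (norm_nonneg _) (hwC x) 2
  have i1 : Integrable fun x => η x ^ 2 * deriv v x ^ 2 :=
    hbd hE.integrable_sq (hv.continuous_deriv le_rfl) hC'
  have i2 : Integrable fun x => η x * deriv η x * v x ^ 2 :=
    hbd (hE.integrable_mul_deriv hE) hv.continuous hC
  have i3 := hE.integrable_groundForm ε hW
  have hd : ∀ x, deriv (fun x => η x * v x) x = deriv η x * v x + η x * deriv v x := fun x =>
    ((h.hasDerivAt x).fun_mul (hvd x)).deriv
  -- The two densities differ by the derivative of `ε² η η' v²`.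
  have hzero : ∫ x, ((ε ^ 2 * deriv (fun x => η x * v x) x ^ 2 +
      (x ^ 2 - 1 + η x ^ 2) * (η x * v x) ^ 2) - ε ^ 2 * (η x ^ 2 * deriv v x ^ 2)) = 0 := by
    refine integral_eq_zero_of_hasDerivAt_of_integrable
      (f := fun x => ε ^ 2 * (η x * deriv η x * v x ^ 2)) (fun x => ?_)
      (i3.sub (i1.const_mul _)) (i2.const_mul _)
    have h1 := ((((h.hasDerivAt x).fun_mul (h.hasDerivAt_deriv x)).fun_mul
      ((hvd x).fun_pow 2)).const_mul (ε ^ 2))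
    refine h1.congr_deriv ?_
    rw [hd]
    have h2 := h.eqn x
    push_cast
    linear_combination (η x * v x ^ 2) * h2
  rw [integral_sub i3 (i1.const_mul _), integral_const_mul] at hzero
  rw [groundForm]
  linarith

end IsPositiveSolution

/-! ### The odd trial function and the upper bound for the threshold. -/

/-- The trial function `x e^{-3x²/2}`. -/
noncomputable def oddTrial (x : ℝ) : ℝ := x * Real.exp (-(3 / 2) * x ^ 2)

lemma oddTrial_neg (x : ℝ) : oddTrial (-x) = - oddTrial x := by
  simp [oddTrial]

lemma contDiff_oddTrial : ContDiff ℝ 1 oddTrial := by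
  unfold oddTrial
  fun_prop

lemma hasDerivAt_oddTrial (x : ℝ) :
    HasDerivAt oddTrial ((1 - 3 * x ^ 2) * Real.exp (-(3 / 2) * x ^ 2)) x := by
  have h1 : HasDerivAt (fun x : ℝ => -(3 / 2) * x ^ 2) (-(3 * x)) x := by
    have := ((hasDerivAt_id x).fun_pow 2).const_mul (-(3 / 2) : ℝ)
    refine this.congr_deriv ?_
    simp only [id]
    push_cast
    ring
  refine ((hasDerivAt_id x).fun_mul h1.exp).congr_deriv ?_
  simp only [id]
  ring

lemma deriv_oddTrial (x : ℝ) :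
    deriv oddTrial x = (1 - 3 * x ^ 2) * Real.exp (-(3 / 2) * x ^ 2) :=
  (hasDerivAt_oddTrial x).deriv

lemma exp_mul_le_one (x : ℝ) : Real.exp (-(3 / 2) * x ^ 2) * (1 + (3 / 2) * x ^ 2) ≤ 1 := by
  have h1 := Real.add_one_le_exp ((3 / 2) * x ^ 2)
  have h2 : Real.exp (-(3 / 2) * x ^ 2) * Real.exp ((3 / 2) * x ^ 2) = 1 := by
    rw [← Real.exp_add]
    simp
  rw [← h2]
  exact mul_le_mul_of_nonneg_left (by linarith) (Real.exp_pos _).le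

lemma abs_oddTrial_le (x : ℝ) : |oddTrial x| ≤ 2 := by
  have h1 := exp_mul_le_one x
  have h2 := Real.exp_pos (-(3 / 2) * x ^ 2)
  rw [oddTrial, abs_mul, abs_of_pos h2]
  have h3 : |x| ≤ 1 + (3 / 2) * x ^ 2 := by
    rw [← sq_abs x]
    nlinarith [sq_nonneg (|x| - 1)]
  nlinarith

lemma abs_deriv_oddTrial_le (x : ℝ) : |deriv oddTrial x| ≤ 2 := by
  have h1 := exp_mul_le_one x
  have h2 := Real.exp_pos (-(3 / 2) * x ^ 2)
  rw [deriv_oddTrial, abs_mul, abs_of_pos h2]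
  have h3 : |1 - 3 * x ^ 2| ≤ 2 * (1 + (3 / 2) * x ^ 2) := by
    rw [abs_le]
    constructor <;> nlinarith [sq_nonneg x]
  nlinarith

lemma integrable_pow_mul_exp (n : ℕ) : Integrable fun x : ℝ => x ^ n * Real.exp (-3 * x ^ 2) := by
  have h := integrable_rpow_mul_exp_neg_mul_sq (b := 3) (by norm_num) (s := n)
    (by have : (0 : ℝ) ≤ n := Nat.cast_nonneg n
        linarith)
  simpa only [Real.rpow_natCast] using h

lemma exp_sq_eq (x : ℝ) : Real.exp (-(3 / 2) * x ^ 2) ^ 2 = Real.exp (-3 * x ^ 2) := by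
  rw [← Real.exp_nat_mul]
  congr 1
  push_cast
  ring

lemma memEnergy_oddTrial : MemEnergy oddTrial := by
  have hc : Continuous oddTrial := contDiff_oddTrial.continuous
  have hd : Continuous (deriv oddTrial) := contDiff_oddTrial.continuous_deriv le_rfl
  refine MemEnergy.of_contDiff contDiff_oddTrial ?_ ?_ ?_
  · rw [memLp_two_iff_integrable_sq hc.aestronglyMeasurable]
    refine (integrable_pow_mul_exp 2).congr (ae_of_all _ fun x => ?_)
    simp only [oddTrial, mul_pow, exp_sq_eq]
  · rw [memLp_two_iff_integrable_sq hd.aestronglyMeasurable]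
    refine (((integrable_pow_mul_exp 0).sub ((integrable_pow_mul_exp 2).const_mul 6)).add
      ((integrable_pow_mul_exp 4).const_mul 9)).congr (ae_of_all _ fun x => ?_)
    simp only [deriv_oddTrial, mul_pow, exp_sq_eq, Pi.add_apply, Pi.sub_apply]
    ring
  · rw [memLp_two_iff_integrable_sq (f := fun x => |x| * oddTrial x)
      (continuous_abs.mul hc).aestronglyMeasurable]
    refine (integrable_pow_mul_exp 4).congr (ae_of_all _ fun x => ?_)
    simp only [oddTrial, mul_pow, exp_sq_eq, sq_abs]
    ring

/-- Integrate `(x³ e^{-3x²})'`. The exponent of the trial function makes the ratio `1/2`, so that `∫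
(x² - 1) v² = -(1/2) ∫ v²` is negative. -/
lemma integral_sq_mul_oddTrial_sq :
    ∫ x, x ^ 2 * oddTrial x ^ 2 = (1 / 2) * ∫ x, oddTrial x ^ 2 := by
  have h : ∫ x : ℝ, (3 * (x ^ 2 * Real.exp (-3 * x ^ 2)) -
      6 * (x ^ 4 * Real.exp (-3 * x ^ 2))) = 0 := by
    refine integral_eq_zero_of_hasDerivAt_of_integrable
      (f := fun x => x ^ 3 * Real.exp (-3 * x ^ 2)) (fun x => ?_)
      (((integrable_pow_mul_exp 2).const_mul 3).sub ((integrable_pow_mul_exp 4).const_mul 6))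
      (integrable_pow_mul_exp 3)
    have h1 : HasDerivAt (fun x : ℝ => -3 * x ^ 2) (-(6 * x)) x := by
      have := ((hasDerivAt_id x).fun_pow 2).const_mul (-3 : ℝ)
      refine this.congr_deriv ?_
      simp only [id]
      push_cast
      ring
    refine (((hasDerivAt_id x).fun_pow 3).fun_mul h1.exp).congr_deriv ?_
    simp only [id]
    push_cast
    ring
  rw [integral_sub ((integrable_pow_mul_exp 2).const_mul 3)
    ((integrable_pow_mul_exp 4).const_mul 6), integral_const_mul, integral_const_mul] at h
  have e2 : ∀ x : ℝ, oddTrial x ^ 2 = x ^ 2 * Real.exp (-3 * x ^ 2) := fun x => by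
    simp only [oddTrial, mul_pow, exp_sq_eq]
  have e1 : ∀ x : ℝ, x ^ 2 * (x ^ 2 * Real.exp (-3 * x ^ 2)) =
      x ^ 4 * Real.exp (-3 * x ^ 2) := fun x => by ring
  simp only [e2, e1]
  linarith

lemma integral_oddTrial_sq_pos : 0 < ∫ x, oddTrial x ^ 2 := by
  rw [integral_pos_iff_support_of_nonneg (fun x => sq_nonneg _) memEnergy_oddTrial.integrable_sq]
  have hc : Continuous oddTrial := contDiff_oddTrial.continuous
  have ho : IsOpen (Function.support fun x => oddTrial x ^ 2) := (hc.pow 2).isOpen_support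
  refine ho.measure_pos volume ⟨1, ?_⟩
  simp [oddTrial]

/-- The spectral gap on odd functions is `O(ε²)`, and the trivial state is not a minimizer. -/
lemma exists_oddTrial_bounds : ∃ ε₁ > 0, ∃ C > 0, ∀ ε, 0 < ε → ε < ε₁ →
    (∫ x, (ε ^ 2 * deriv oddTrial x ^ 2 + (x ^ 2 - 1) * oddTrial x ^ 2) < 0) ∧
    ∀ η, IsPositiveSolution ε η → ∀ κ, 0 ≤ κ →
      (∀ W, MemEnergy W → (∀ x, W (-x) = - W x) →
        κ * ∫ x, η x ^ 2 * W x ^ 2 ≤ groundForm ε η W) → κ ≤ C * ε ^ 2 := by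
  set M := ∫ x, oddTrial x ^ 2 with hM
  have hM0 : 0 < M := integral_oddTrial_sq_pos
  set K := ∫ x, deriv oddTrial x ^ 2 with hK
  have hK0 : 0 ≤ K := integral_nonneg fun x => sq_nonneg _
  set L := ∫ x, deriv oddTrial x ^ 4 with hL
  have hL0 : 0 ≤ L := integral_nonneg fun x => by positivity
  have hv := memEnergy_oddTrial
  have hquad : ∀ ε : ℝ, ∫ x, (ε ^ 2 * deriv oddTrial x ^ 2 + (x ^ 2 - 1) * oddTrial x ^ 2) =
      ε ^ 2 * K - M / 2 := by
    intro ε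
    have : ∫ x, (ε ^ 2 * deriv oddTrial x ^ 2 + (x ^ 2 - 1) * oddTrial x ^ 2) =
        ∫ x, (ε ^ 2 * deriv oddTrial x ^ 2 + (x ^ 2 * oddTrial x ^ 2 - oddTrial x ^ 2)) := by
      congr 1
      funext x
      ring
    have hs : Integrable fun x => x ^ 2 * oddTrial x ^ 2 - oddTrial x ^ 2 :=
      hv.integrable_sq_mul_sq.sub hv.integrable_sq
    rw [this, integral_add (hv.integrable_deriv_sq.const_mul _) hs,
      integral_sub hv.integrable_sq_mul_sq hv.integrable_sq, integral_sq_mul_oddTrial_sq,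
      integral_const_mul]
    ring
  -- This bound on `ε²` gives `ε² K ≤ M/8`, so the quadratic form of the trivial state is at most
  -- `-3M/8`.
  have hε₁ : 0 < M / (8 * (K + 1)) := by positivity
  refine ⟨√(M / (8 * (K + 1))), Real.sqrt_pos.2 hε₁, (2 + L / 4) * 8 / M, by positivity,
    fun ε hε hlt => ?_⟩
  have hεK : ε ^ 2 * K ≤ M / 8 := by
    have h1 : ε ^ 2 < M / (8 * (K + 1)) := (Real.lt_sqrt hε.le).1 hlt
    rw [lt_div_iff₀ (by positivity)] at h1
    nlinarith [sq_nonneg ε]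
  refine ⟨by rw [hquad]; linarith, fun η hη κ hκ0 hκ => ?_⟩
  have hE := hη.memEnergy
  have hW := hE.mul_of_bounded contDiff_oddTrial abs_oddTrial_le abs_deriv_oddTrial_le
  have h1 := hκ _ hW (fun x => by rw [hη.even, oddTrial_neg]; ring)
  rw [hη.groundForm_mul contDiff_oddTrial abs_oddTrial_le abs_deriv_oddTrial_le] at h1
  have hd4 : Integrable fun x => deriv oddTrial x ^ 4 := by
    have : Integrable fun x => deriv oddTrial x ^ 2 * deriv oddTrial x ^ 2 := by
      refine hv.integrable_deriv_sq.mul_bdd (c := 2 ^ 2) hv.integrable_deriv_sq.1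
        (ae_of_all _ fun x => ?_)
      rw [norm_pow]
      exact pow_le_pow_left₀ (norm_nonneg _) (abs_deriv_oddTrial_le x) 2
    exact this.congr (ae_of_all _ fun x => by ring)
  -- The trial function is `W = η v`, whose form is `ε²` times this integral; `integral_pow_four_le`
  -- bounds it uniformly in `ε`.
  have h2 : ∫ x, η x ^ 2 * deriv oddTrial x ^ 2 ≤ 2 + L / 4 := by
    have : ∫ x, η x ^ 2 * deriv oddTrial x ^ 2 ≤
        ∫ x, (η x ^ 4 + (1 / 4) * deriv oddTrial x ^ 4) := by
      refine integral_mono_of_nonneg (ae_of_all _ fun x => by positivity)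
        (hE.integrable_pow_four.add (hd4.const_mul _)) (ae_of_all _ fun x => ?_)
      simp only
      nlinarith [sq_nonneg (η x ^ 2 - (1 / 2) * deriv oddTrial x ^ 2)]
    rw [integral_add hE.integrable_pow_four (hd4.const_mul _), integral_const_mul] at this
    have := hη.integral_pow_four_le
    linarith
  have hηW := hE.integrable_sq_mul_sq' hW
  -- Nonnegativity of the form at `v` gives `∫ η² v² ≥ M/2 - ε² K ≥ 3M/8`, and `η² v² ≤ η⁴ v² +
  -- v²/4` costs another `M/4`.
  have h3 : M / 8 ≤ ∫ x, η x ^ 2 * (η x * oddTrial x) ^ 2 := by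
    have h4 := hη.groundForm_nonneg hv
    have i1 := hE.integrable_sq_mul_sq' hv
    have i2 : Integrable fun x => ε ^ 2 * deriv oddTrial x ^ 2 + (x ^ 2 - 1) * oddTrial x ^ 2 :=
      ((hv.integrable_deriv_sq.const_mul (ε ^ 2)).add
        (hv.integrable_sq_mul_sq.sub hv.integrable_sq)).congr (ae_of_all _ fun x => by
          simp only [Pi.add_apply, Pi.sub_apply]; ring)
    have h5 : groundForm ε η oddTrial = ε ^ 2 * K - M / 2 + ∫ x, η x ^ 2 * oddTrial x ^ 2 := by
      rw [← hquad, ← integral_add i2 i1, groundForm]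
      congr 1
      funext x
      ring
    have h6 : ∫ x, η x ^ 2 * oddTrial x ^ 2 ≤
        ∫ x, (η x ^ 2 * (η x * oddTrial x) ^ 2 + (1 / 4) * oddTrial x ^ 2) := by
      refine integral_mono i1 (hηW.add (hv.integrable_sq.const_mul _)) fun x => ?_
      simp only
      have := mul_nonneg (sq_nonneg (oddTrial x)) (sq_nonneg (η x ^ 2 - 1 / 2))
      linarith [show oddTrial x ^ 2 * (η x ^ 2 - 1 / 2) ^ 2 = η x ^ 2 * (η x * oddTrial x) ^ 2 +
        (1 / 4) * oddTrial x ^ 2 - η x ^ 2 * oddTrial x ^ 2 by ring]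
    rw [integral_add hηW (hv.integrable_sq.const_mul _), integral_const_mul] at h6
    linarith
  have h7 : κ * (M / 8) ≤ ε ^ 2 * (2 + L / 4) :=
    (mul_le_mul_of_nonneg_left h3 hκ0).trans
      (h1.trans (mul_le_mul_of_nonneg_left h2 (sq_nonneg ε)))
  rw [show (2 + L / 4) * 8 / M * ε ^ 2 = ε ^ 2 * (2 + L / 4) / (M / 8) by field_simp,
    le_div_iff₀ (by positivity)]
  exact h7

/-! ### The energy along lines: first and second variation. -/

lemma integrable_gpIntegrand {a b : ℝ → ℝ} (ε γ : ℝ) (ha : MemEnergy a) (hb : MemEnergy b) :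
    Integrable fun x => ε ^ 2 * deriv a x ^ 2 + ε ^ 2 * deriv b x ^ 2
      + (x ^ 2 - 1) * (a x ^ 2 + b x ^ 2) + (1 / 2) * (a x ^ 2 + b x ^ 2) ^ 2
      + (γ - 1) * a x ^ 2 * b x ^ 2 := by
  refine ((((ha.integrable_deriv_sq.const_mul (ε ^ 2)).add
    (hb.integrable_deriv_sq.const_mul (ε ^ 2))).add
    ((ha.integrable_sq_mul_sq.add hb.integrable_sq_mul_sq).sub
      (ha.integrable_sq.add hb.integrable_sq))).add
    (((ha.integrable_pow_four.const_mul (1 / 2)).add (hb.integrable_pow_four.const_mul (1 / 2))).add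
      ((ha.integrable_sq_mul_sq' hb).const_mul γ))).congr (ae_of_all _ fun x => ?_)
  simp only [Pi.add_apply, Pi.sub_apply]
  ring

/-- The first variation of the energy at `Ψ` in the direction `Φ`. -/
noncomputable def firstVariation (ε γ : ℝ) (Ψ Φ : (ℝ → ℝ) × (ℝ → ℝ)) : ℝ :=
  ∫ x, (ε ^ 2 * (deriv Ψ.1 x * deriv Φ.1 x) + ε ^ 2 * (deriv Ψ.2 x * deriv Φ.2 x)
    + (x ^ 2 - 1) * (Ψ.1 x * Φ.1 x + Ψ.2 x * Φ.2 x)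
    + (Ψ.1 x ^ 2 + Ψ.2 x ^ 2) * (Ψ.1 x * Φ.1 x + Ψ.2 x * Φ.2 x)
    + (γ - 1) * (Ψ.1 x * Ψ.2 x ^ 2 * Φ.1 x + Ψ.1 x ^ 2 * Ψ.2 x * Φ.2 x))

/-- Half of the second variation of the energy at `Ψ` in the direction `Φ`. -/
noncomputable def halfSecondVariation (ε γ : ℝ) (Ψ Φ : (ℝ → ℝ) × (ℝ → ℝ)) : ℝ :=
  (1 / 2) * ∫ x, (ε ^ 2 * deriv Φ.1 x ^ 2 + ε ^ 2 * deriv Φ.2 x ^ 2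
    + (x ^ 2 - 1) * (Φ.1 x ^ 2 + Φ.2 x ^ 2)
    + (Ψ.1 x ^ 2 + Ψ.2 x ^ 2) * (Φ.1 x ^ 2 + Φ.2 x ^ 2)
    + 2 * (Ψ.1 x * Φ.1 x + Ψ.2 x * Φ.2 x) ^ 2
    + (γ - 1) * (Ψ.1 x ^ 2 * Φ.2 x ^ 2 + Ψ.2 x ^ 2 * Φ.1 x ^ 2
      + 4 * (Ψ.1 x * Ψ.2 x * (Φ.1 x * Φ.2 x))))

section

variable {a b p q : ℝ → ℝ}

lemma integrable_firstVariation (ε γ : ℝ) (ha : MemEnergy a) (hb : MemEnergy b)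
    (hp : MemEnergy p) (hq : MemEnergy q) :
    Integrable fun x => ε ^ 2 * (deriv a x * deriv p x) + ε ^ 2 * (deriv b x * deriv q x)
    + (x ^ 2 - 1) * (a x * p x + b x * q x)
    + (a x ^ 2 + b x ^ 2) * (a x * p x + b x * q x)
    + (γ - 1) * (a x * b x ^ 2 * p x + a x ^ 2 * b x * q x) := by
  refine ((((ha.integrable_deriv_mul_deriv hp).const_mul (ε ^ 2)).add
    ((hb.integrable_deriv_mul_deriv hq).const_mul (ε ^ 2))).add
    ((((ha.integrable_sq_mul_mul hp).add (hb.integrable_sq_mul_mul hq)).sub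
      ((ha.integrable_mul hp).add (hb.integrable_mul hq))).add
    (((ha.integrable_mul_mul_mul ha ha hp).add (hb.integrable_mul_mul_mul hb hb hq)).add
    (((hb.integrable_mul_mul_mul hb ha hp).add
      (ha.integrable_mul_mul_mul ha hb hq)).const_mul γ)))).congr (ae_of_all _ fun x => ?_)
  simp only [Pi.add_apply, Pi.sub_apply]
  ring

lemma integrable_halfSecondVariation (ε γ : ℝ) (ha : MemEnergy a) (hb : MemEnergy b)
    (hp : MemEnergy p) (hq : MemEnergy q) :
    Integrable fun x => ε ^ 2 * deriv p x ^ 2 + ε ^ 2 * deriv q x ^ 2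
    + (x ^ 2 - 1) * (p x ^ 2 + q x ^ 2)
    + (a x ^ 2 + b x ^ 2) * (p x ^ 2 + q x ^ 2)
    + 2 * (a x * p x + b x * q x) ^ 2
    + (γ - 1) * (a x ^ 2 * q x ^ 2 + b x ^ 2 * p x ^ 2
      + 4 * (a x * b x * (p x * q x))) := by
  refine ((((hp.integrable_deriv_sq.const_mul (ε ^ 2)).add
    (hq.integrable_deriv_sq.const_mul (ε ^ 2))).add
    ((hp.integrable_sq_mul_sq.add hq.integrable_sq_mul_sq).sub
      (hp.integrable_sq.add hq.integrable_sq))).add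
    ((((ha.integrable_sq_mul_sq' hp).const_mul 3).add
      ((hb.integrable_sq_mul_sq' hq).const_mul 3)).add
    ((((ha.integrable_sq_mul_sq' hq).add (hb.integrable_sq_mul_sq' hp)).const_mul γ).add
      ((ha.integrable_mul_mul_mul hb hp hq).const_mul (4 * γ))))).congr
    (ae_of_all _ fun x => ?_)
  simp only [Pi.add_apply, Pi.sub_apply]
  ring

end

/-- The energy is a quartic polynomial along lines. -/
lemma exists_gpEnergy_add_smul {Ψ Φ : (ℝ → ℝ) × (ℝ → ℝ)} (ε γ : ℝ) (hΨ : Ψ ∈ energySpace)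
    (hΦ : Φ ∈ energySpace) : ∃ c d : ℝ, ∀ t : ℝ, gpEnergy ε γ (Ψ + t • Φ) =
      gpEnergy ε γ Ψ + t * firstVariation ε γ Ψ Φ + t ^ 2 * halfSecondVariation ε γ Ψ Φ
        + t ^ 3 * c + t ^ 4 * d := by
  obtain ⟨a, b⟩ := Ψ
  obtain ⟨p, q⟩ := Φ
  have ha : MemEnergy a := hΨ.1
  have hb : MemEnergy b := hΨ.2
  have hp : MemEnergy p := hΦ.1
  have hq : MemEnergy q := hΦ.2
  set F3 : ℝ → ℝ := fun x => 2 * (a x * p x + b x * q x) * (p x ^ 2 + q x ^ 2)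
    + 2 * (γ - 1) * (a x * p x * q x ^ 2 + b x * q x * p x ^ 2) with hF3
  set F4 : ℝ → ℝ := fun x => (1 / 2) * (p x ^ 2 + q x ^ 2) ^ 2
    + (γ - 1) * (p x ^ 2 * q x ^ 2) with hF4
  have i3 : Integrable F3 := by
    refine ((((ha.integrable_mul_mul_mul hp hp hp).add
      (hb.integrable_mul_mul_mul hq hq hq)).const_mul 2).add
      (((ha.integrable_mul_mul_mul hp hq hq).add
      (hb.integrable_mul_mul_mul hq hp hp)).const_mul (2 * γ))).congr (ae_of_all _ fun x => ?_)
    simp only [Pi.add_apply, hF3]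
    ring
  have i4 : Integrable F4 := by
    refine (((hp.integrable_pow_four.add hq.integrable_pow_four).const_mul (1 / 2)).add
      ((hp.integrable_sq_mul_sq' hq).const_mul γ)).congr (ae_of_all _ fun x => ?_)
    simp only [Pi.add_apply, hF4]
    ring
  refine ⟨(1 / 2) * ∫ x, F3 x, (1 / 2) * ∫ x, F4 x, fun t => ?_⟩
  have j0 := integrable_gpIntegrand ε γ ha hb
  have j1 := (integrable_firstVariation ε γ ha hb hp hq).const_mul (2 * t)
  have j2 := (integrable_halfSecondVariation ε γ ha hb hp hq).const_mul (t ^ 2)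
  have j3 := i3.const_mul (t ^ 3)
  have j4 := i4.const_mul (t ^ 4)
  have key : ∫ x, (ε ^ 2 * deriv (a + t • p) x ^ 2 + ε ^ 2 * deriv (b + t • q) x ^ 2
      + (x ^ 2 - 1) * ((a + t • p) x ^ 2 + (b + t • q) x ^ 2)
      + (1 / 2) * ((a + t • p) x ^ 2 + (b + t • q) x ^ 2) ^ 2
      + (γ - 1) * (a + t • p) x ^ 2 * (b + t • q) x ^ 2) = _ :=
    (integral_congr_ae ?_).trans (((((integral_add (((j0.add j1).add j2).add j3) j4)).trans
      (congrArg (· + _) (integral_add ((j0.add j1).add j2) j3))).trans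
      (congrArg (· + _ + _) (integral_add (j0.add j1) j2))).trans
      (congrArg (· + _ + _ + _) (integral_add j0 j1)))
  · rw [integral_const_mul, integral_const_mul, integral_const_mul, integral_const_mul] at key
    simp only [gpEnergy, firstVariation, halfSecondVariation, Prod.fst_add, Prod.snd_add,
      Prod.smul_fst, Prod.smul_snd]
    rw [key]
    ring
  · filter_upwards [ha.ae_differentiableAt, hb.ae_differentiableAt, hp.ae_differentiableAt,
      hq.ae_differentiableAt] with x h1 h2 h3 h4
    rw [deriv_add h1 (h3.const_smul t), deriv_add h2 (h4.const_smul t), deriv_const_smul_field,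
      deriv_const_smul_field]
    simp only [Pi.add_apply, Pi.smul_apply, smul_eq_mul, hF3, hF4]
    ring

/-- For small `t` the quadratic term dominates, so the sign of the second variation decides at a
critical point. -/
lemma exists_quartic_neg {A c d : ℝ} (hA : A < 0) :
    ∃ τ > 0, ∀ t, 0 < t → t < τ → t ^ 2 * A + t ^ 3 * c + t ^ 4 * d < 0 := by
  have h0 : 0 < |c| + |d| + 1 := by positivity
  refine ⟨min 1 (-A / (|c| + |d| + 1)), lt_min one_pos (div_pos (by linarith) h0),
    fun t ht htτ => ?_⟩
  have h1 : t < 1 := htτ.trans_le (min_le_left _ _)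
  have h2 : t * (|c| + |d| + 1) < -A := (lt_div_iff₀ h0).1 (htτ.trans_le (min_le_right _ _))
  have h3 : t * c ≤ t * |c| := mul_le_mul_of_nonneg_left (le_abs_self c) ht.le
  have h4 : t ^ 2 * d ≤ t * |d| := by
    have h5 : t ^ 2 * d ≤ t ^ 2 * |d| := mul_le_mul_of_nonneg_left (le_abs_self d) (sq_nonneg t)
    have h6 : t ^ 2 * |d| ≤ t * |d| :=
      mul_le_mul_of_nonneg_right (by nlinarith) (abs_nonneg d)
    linarith
  have h5 : t ^ 2 * (A + t * c + t ^ 2 * d) < 0 :=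
    mul_neg_of_pos_of_neg (by positivity) (by nlinarith)
  linarith [show t ^ 2 * (A + t * c + t ^ 2 * d) = t ^ 2 * A + t ^ 3 * c + t ^ 4 * d by ring]

lemma energyNormSq_smul (Φ : (ℝ → ℝ) × (ℝ → ℝ)) (t : ℝ) :
    energyNormSq (t • Φ) = t ^ 2 * energyNormSq Φ := by
  rw [energyNormSq, energyNormSq, ← integral_const_mul]
  congr 1
  funext x
  simp only [Prod.smul_fst, Prod.smul_snd, Pi.smul_apply, smul_eq_mul, deriv_const_smul_field]
  ring

lemma exists_pos_lt_sq_mul_lt {N δ τ : ℝ} (hδ : 0 < δ) (hτ : 0 < τ) :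
    ∃ t, 0 < t ∧ t < τ ∧ t ^ 2 * N < δ := by
  have h : Tendsto (fun t : ℝ => t ^ 2 * N) (𝓝[>] 0) (𝓝 0) := by
    have : Continuous fun t : ℝ => t ^ 2 * N := by fun_prop
    simpa using (this.tendsto 0).mono_left nhdsWithin_le_nhds
  obtain ⟨t, h1, h2⟩ := ((h.eventually_lt_const hδ).and (Ioo_mem_nhdsGT hτ)).exists
  exact ⟨t, h2.1, h2.2, h1⟩

section Variation

variable {ε γ : ℝ} {Ψ Φ : (ℝ → ℝ) × (ℝ → ℝ)}

lemma hasDerivAt_gpEnergy (hΨ : Ψ ∈ energySpace) (hΦ : Φ ∈ energySpace) :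
    HasDerivAt (fun t : ℝ => gpEnergy ε γ (Ψ + t • Φ)) (firstVariation ε γ Ψ Φ) 0 := by
  obtain ⟨c, d, h⟩ := exists_gpEnergy_add_smul ε γ hΨ hΦ
  simp only [h]
  have h1 := hasDerivAt_id (0 : ℝ)
  have := ((((h1.mul_const (firstVariation ε γ Ψ Φ)).const_add (gpEnergy ε γ Ψ)).fun_add
    ((h1.fun_pow 2).mul_const (halfSecondVariation ε γ Ψ Φ))).fun_add
    ((h1.fun_pow 3).mul_const c)).fun_add ((h1.fun_pow 4).mul_const d)
  refine this.congr_deriv ?_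
  simp

lemma exists_lower_energy (hΨ : Ψ ∈ energySpace) (hΦ : Φ ∈ energySpace)
    (h1 : firstVariation ε γ Ψ Φ = 0) (h2 : halfSecondVariation ε γ Ψ Φ < 0) {δ : ℝ}
    (hδ : 0 < δ) :
    ∃ t : ℝ, energyNormSq (Ψ + t • Φ - Ψ) < δ ∧ gpEnergy ε γ (Ψ + t • Φ) < gpEnergy ε γ Ψ := by
  obtain ⟨c, d, h⟩ := exists_gpEnergy_add_smul ε γ hΨ hΦ
  obtain ⟨τ, hτ, h3⟩ := exists_quartic_neg (c := c) (d := d) h2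
  obtain ⟨t, ht, htτ, htδ⟩ := exists_pos_lt_sq_mul_lt (N := energyNormSq Φ) hδ hτ
  refine ⟨t, by rwa [add_sub_cancel_left, energyNormSq_smul], ?_⟩
  have := h3 t ht htτ
  rw [h, h1]
  linarith

lemma exists_higher_energy (hΨ : Ψ ∈ energySpace) (hΦ : Φ ∈ energySpace)
    (h1 : firstVariation ε γ Ψ Φ = 0) (h2 : 0 < halfSecondVariation ε γ Ψ Φ) {δ : ℝ}
    (hδ : 0 < δ) :
    ∃ t : ℝ, energyNormSq (Ψ + t • Φ - Ψ) < δ ∧ gpEnergy ε γ Ψ < gpEnergy ε γ (Ψ + t • Φ) := by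
  obtain ⟨c, d, h⟩ := exists_gpEnergy_add_smul ε γ hΨ hΦ
  obtain ⟨τ, hτ, h3⟩ := exists_quartic_neg (c := -c) (d := -d) (neg_lt_zero.2 h2)
  obtain ⟨t, ht, htτ, htδ⟩ := exists_pos_lt_sq_mul_lt (N := energyNormSq Φ) hδ hτ
  refine ⟨t, by rwa [add_sub_cancel_left, energyNormSq_smul], ?_⟩
  have := h3 t ht htτ
  rw [h, h1]
  linarith

end Variation

lemma add_smul_mem_symEnergySpace {Ψ Φ : (ℝ → ℝ) × (ℝ → ℝ)} (hΨ : Ψ ∈ symEnergySpace)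
    (hΦ : Φ ∈ symEnergySpace) (t : ℝ) : Ψ + t • Φ ∈ symEnergySpace := by
  refine ⟨⟨MemEnergy.add hΨ.1.1 (MemEnergy.const_mul hΦ.1.1 t),
    MemEnergy.add hΨ.1.2 (MemEnergy.const_mul hΦ.1.2 t)⟩, fun x => ?_⟩
  simp [hΨ.2 x, hΦ.2 x]

/-- The first variation vanishes at a minimizer. -/
lemma IsGlobalMinimizer.firstVariation_eq_zero {ε γ : ℝ} {Ψ Φ : (ℝ → ℝ) × (ℝ → ℝ)}
    (hΨ : IsGlobalMinimizer ε γ symEnergySpace Ψ) (hΦ : Φ ∈ symEnergySpace) :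
    firstVariation ε γ Ψ Φ = 0 := by
  have h := hasDerivAt_gpEnergy (ε := ε) (γ := γ) hΨ.1.1 hΦ.1
  refine IsLocalMin.hasDerivAt_eq_zero (Eventually.of_forall fun t => ?_) h
  simpa using hΨ.2 _ (add_smul_mem_symEnergySpace hΨ.1 hΦ t)

/-! ### Existence of minimizers by weak compactness. -/

/-- An element of the energy space and its reflection. -/
def reflectPair (f : ℝ → ℝ) : (ℝ → ℝ) × (ℝ → ℝ) := (f, fun x => f (-x))

lemma MemEnergy.reflectPair_mem {f : ℝ → ℝ} (hf : MemEnergy f) :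
    reflectPair f ∈ symEnergySpace :=
  ⟨⟨hf, hf.comp_neg⟩, fun x => by simp [reflectPair]⟩

lemma eq_reflectPair {Ψ : (ℝ → ℝ) × (ℝ → ℝ)} (h : Ψ ∈ symEnergySpace) :
    Ψ = reflectPair Ψ.1 := by
  refine Prod.ext rfl (funext fun x => ?_)
  simp [reflectPair, h.2 (-x)]

/-- Primitives of `L²` functions are locally absolutely continuous. -/
lemma absolutelyContinuous_primitive {f g : ℝ → ℝ} (hg : MemLp g 2 volume)
    (hf : ∀ x, f x = f 0 + ∫ t in (0)..x, g t) :
    (∀ a b, AbsolutelyContinuousOnInterval f a b) ∧ deriv f =ᵐ[volume] g := by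
  have hgl : LocallyIntegrable g := hg.locallyIntegrable (by norm_num)
  have hgi : ∀ a b, IntervalIntegrable g volume a b := fun a b =>
    (hgl.integrableOn_isCompact isCompact_uIcc).intervalIntegrable
  have hG : f = fun x => (∫ t in (0)..x, g t) + f 0 := funext fun x => by rw [hf x, add_comm]
  constructor
  · intro a b
    have h := (hgi (min a 0 ⊓ b) (max a 0 ⊔ b)).absolutelyContinuousOnInterval_intervalIntegral
      (c := 0) (by rw [mem_uIcc]; left; simp)
    rw [hG]
    refine (h.mono ?_).add
      (contDiff_const (c := f 0) (n := 1)).contDiffOn.absolutelyContinuousOnInterval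
    rw [uIcc_of_le (a := min a 0 ⊓ b) (by simp)]
    exact uIcc_subset_Icc (by simp) (by simp)
  · rw [hG]
    filter_upwards [LocallyIntegrable.ae_hasDerivAt_integral hgl] with x hx
    rw [deriv_add_const, (hx 0).deriv]

/-- Fatou's lemma for nonnegative continuous functions with bounded integrals. -/
lemma integrable_of_tendsto_of_integral_le {u : ℕ → ℝ → ℝ} {w : ℝ → ℝ} {A : ℝ}
    (hu : ∀ n, Integrable (u n)) (hu0 : ∀ n x, 0 ≤ u n x) (hw : AEStronglyMeasurable w volume)
    (hlim : ∀ x, Tendsto (fun n => u n x) atTop (𝓝 (w x)))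
    (hA : ∀ᶠ n in atTop, ∫ x, u n x ≤ A) : Integrable w ∧ ∫ x, w x ≤ A := by
  have hw0 : ∀ x, 0 ≤ w x := fun x => ge_of_tendsto' (hlim x) fun n => hu0 n x
  have h1 : ∫⁻ x, ENNReal.ofReal (w x) ≤ ENNReal.ofReal A := by
    calc ∫⁻ x, ENNReal.ofReal (w x)
        = ∫⁻ x, liminf (fun n => ENNReal.ofReal (u n x)) atTop := by
          refine lintegral_congr fun x => ?_
          exact ((ENNReal.continuous_ofReal.tendsto _).comp (hlim x)).liminf_eq.symm
      _ ≤ liminf (fun n => ∫⁻ x, ENNReal.ofReal (u n x)) atTop :=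
          lintegral_liminf_le' fun n => (hu n).1.aemeasurable.ennreal_ofReal
      _ ≤ ENNReal.ofReal A := by
          refine liminf_le_of_frequently_le' (Eventually.frequently ?_)
          filter_upwards [hA] with n hn
          rw [← ofReal_integral_eq_lintegral_ofReal (hu n) (ae_of_all _ (hu0 n))]
          exact ENNReal.ofReal_le_ofReal hn
  have hi : Integrable w := by
    refine ⟨hw, ?_⟩
    rw [hasFiniteIntegral_iff_ofReal (ae_of_all _ hw0)]
    exact h1.trans_lt ENNReal.ofReal_lt_top
  refine ⟨hi, ?_⟩
  have hA0 : 0 ≤ A := by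
    obtain ⟨n, hn⟩ := hA.exists
    exact (integral_nonneg (hu0 n)).trans hn
  rw [← ofReal_integral_eq_lintegral_ofReal hi (ae_of_all _ hw0)] at h1
  exact (ENNReal.ofReal_le_ofReal_iff hA0).1 h1

/-- Sequential weak compactness of bounded sets in `L²(ℝ)`. -/
lemma exists_subseq_tendsto_inner (G : ℕ → Lp ℝ 2 (volume : Measure ℝ)) {r : ℝ}
    (hG : ∀ n, ‖G n‖ ≤ r) : ∃ (g : Lp ℝ 2 (volume : Measure ℝ)) (φ : ℕ → ℕ), StrictMono φ ∧
      ∀ h, Tendsto (fun n => inner ℝ (G (φ n)) h) atTop (𝓝 (inner ℝ g h)) := by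
  set Λ : ℕ → WeakDual ℝ (Lp ℝ 2 (volume : Measure ℝ)) := fun n =>
    StrongDual.toWeakDual (InnerProductSpace.toDual ℝ _ (G n)) with hΛ
  have : Fact ((2 : ENNReal) ≠ ⊤) := ⟨by norm_num⟩
  obtain ⟨L, -, φ, hφ, hL⟩ := WeakDual.isSeqCompact_closedBall ℝ (Lp ℝ 2 (volume : Measure ℝ)) 0 r
    (x := Λ) (fun n => by
      simp only [hΛ, mem_preimage, Metric.mem_closedBall, dist_zero_right]
      exact ((InnerProductSpace.toDual ℝ _).norm_map (G n)).trans_le (hG n))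
  refine ⟨(InnerProductSpace.toDual ℝ _).symm (WeakDual.toStrongDual L), φ, hφ, fun h => ?_⟩
  rw [InnerProductSpace.toDual_symm_apply]
  have h1 := ((WeakDual.eval_continuous h).tendsto L).comp hL
  refine h1.congr fun n => ?_
  simp [hΛ]

/-- For each `x`, `f(0)²` exceeds `f(x)²` by at most `∫ (f² + f'²) ≤ 2A`; averaging over `[0, 1]`
adds one more `A`. -/
lemma MemEnergy.sq_zero_le {f : ℝ → ℝ} (hf : MemEnergy f) {A : ℝ}
    (h1 : ∫ x, deriv f x ^ 2 ≤ A) (h2 : ∫ x, f x ^ 2 ≤ A) : f 0 ^ 2 ≤ 3 * A := by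
  have h3 : ∀ x, f 0 ^ 2 ≤ f x ^ 2 + 2 * A := by
    intro x
    have h4 := hf.sq_eq_integral x
    have h5 : -(∫ t in (0)..x, 2 * (f t * deriv f t)) ≤ ∫ t, (f t ^ 2 + deriv f t ^ 2) := by
      have h6 : |∫ t in (0)..x, 2 * (f t * deriv f t)| ≤
          ∫ t in uIoc 0 x, |2 * (f t * deriv f t)| := by
        simpa using intervalIntegral.norm_integral_le_integral_norm_uIoc
          (f := fun t => 2 * (f t * deriv f t)) (a := 0) (b := x)
      have h7 : ∫ t in uIoc 0 x, |2 * (f t * deriv f t)| ≤ ∫ t, |2 * (f t * deriv f t)| :=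
        setIntegral_le_integral hf.integrable_two_mul_deriv.abs (ae_of_all _ fun t => abs_nonneg _)
      have h8 : ∫ t, |2 * (f t * deriv f t)| ≤ ∫ t, (f t ^ 2 + deriv f t ^ 2) := by
        refine integral_mono hf.integrable_two_mul_deriv.abs
          (hf.integrable_sq.add hf.integrable_deriv_sq) fun t => ?_
        refine abs_le.2 ⟨?_, ?_⟩
        · nlinarith [sq_nonneg (f t + deriv f t)]
        · nlinarith [sq_nonneg (f t - deriv f t)]
      linarith [neg_abs_le (∫ t in (0)..x, 2 * (f t * deriv f t))]
    rw [integral_add hf.integrable_sq hf.integrable_deriv_sq] at h5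
    linarith
  have hc : ∀ c : ℝ, IntegrableOn (fun _ : ℝ => c) (Icc 0 1) := fun c =>
    integrableOn_const (by simp)
  have h4 : ∫ _ in Icc (0 : ℝ) 1, f 0 ^ 2 ≤ ∫ x in Icc (0 : ℝ) 1, (f x ^ 2 + 2 * A) :=
    setIntegral_mono (hc _) (hf.integrable_sq.integrableOn.add (hc _)) h3
  rw [integral_add hf.integrable_sq.integrableOn (hc _)] at h4
  have h5 : ∫ x in Icc (0 : ℝ) 1, f x ^ 2 ≤ ∫ x, f x ^ 2 :=
    setIntegral_le_integral hf.integrable_sq (ae_of_all _ fun t => sq_nonneg _)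
  simp at h4
  linarith

/-- Bounded sequences in the energy space have subsequences that converge pointwise, with
derivatives converging weakly in `L²`. -/
lemma exists_subseq_tendsto_of_bounded {f : ℕ → ℝ → ℝ} (hf : ∀ n, MemEnergy (f n)) {A : ℝ}
    (h1 : ∀ n, ∫ x, deriv (f n) x ^ 2 ≤ A) (h2 : ∀ n, ∫ x, (f n x ^ 2 + x ^ 2 * f n x ^ 2) ≤ A) :
    ∃ (g : ℝ → ℝ) (φ : ℕ → ℕ), StrictMono φ ∧ MemEnergy g ∧
      (∀ x, Tendsto (fun n => f (φ n) x) atTop (𝓝 (g x))) ∧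
      Tendsto (fun n => ∫ x, deriv (f (φ n)) x * deriv g x) atTop (𝓝 (∫ x, deriv g x ^ 2)) := by
  set G : ℕ → Lp ℝ 2 (volume : Measure ℝ) := fun n => (hf n).memLp_deriv.toLp _ with hG
  have hGc : ∀ n, G n =ᵐ[volume] deriv (f n) := fun n => MemLp.coeFn_toLp _
  have hGn : ∀ n, ‖G n‖ ≤ √A := by
    intro n
    refine Real.le_sqrt_of_sq_le ?_
    have : ‖G n‖ ^ 2 = ∫ x, deriv (f n) x ^ 2 := by
      rw [← real_inner_self_eq_norm_sq, L2.inner_def]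
      refine integral_congr_ae ?_
      filter_upwards [hGc n] with x hx
      rw [hx]
      simp [sq]
    rw [this]
    exact h1 n
  have h2' : ∀ n, ∫ x, f n x ^ 2 ≤ A := fun n => by
    refine le_trans ?_ (h2 n)
    refine integral_mono (hf n).integrable_sq
      ((hf n).integrable_sq.add (hf n).integrable_sq_mul_sq) fun x => ?_
    have : 0 ≤ x ^ 2 * f n x ^ 2 := by positivity
    simp only
    linarith
  obtain ⟨γ, φ₁, hφ₁, hγ⟩ := exists_subseq_tendsto_inner G hGn
  have hb : ∀ n, f (φ₁ n) 0 ∈ Icc (-√(3 * A)) (√(3 * A)) := fun n =>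
    abs_le.1 (Real.abs_le_sqrt ((hf (φ₁ n)).sq_zero_le (h1 _) (h2' _)))
  obtain ⟨c, -, φ₂, hφ₂, hc⟩ := isCompact_Icc.tendsto_subseq hb
  have hφ : StrictMono (φ₁ ∘ φ₂) := hφ₁.comp hφ₂
  have hγ' : ∀ h, Tendsto (fun n => inner ℝ (G ((φ₁ ∘ φ₂) n)) h) atTop (𝓝 (inner ℝ γ h)) :=
    fun h => (hγ h).comp hφ₂.tendsto_atTop
  have hγm : MemLp γ 2 volume := Lp.memLp γ
  -- The limit is the primitive of the weak limit of the derivatives, started at the limit of the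
  -- values at 0. Pairing the weak convergence with indicators of intervals ending at 0 then yields
  -- pointwise convergence.
  set g : ℝ → ℝ := fun x => c + ∫ t in (0)..x, γ t with hg
  have hg0 : g 0 = c := by simp [hg]
  obtain ⟨hgac, hgd⟩ := absolutelyContinuous_primitive (f := g) hγm (fun x => by rw [hg0])
  have hset : ∀ s : Set ℝ, MeasurableSet s → volume s ≠ ⊤ →
      Tendsto (fun n => ∫ t in s, deriv (f ((φ₁ ∘ φ₂) n)) t) atTop (𝓝 (∫ t in s, γ t)) := by
    intro s hs hs'
    have h3 := hγ' (indicatorConstLp 2 hs hs' (1 : ℝ))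
    rw [real_inner_comm, L2.inner_indicatorConstLp_one] at h3
    simp only [real_inner_comm (indicatorConstLp 2 hs hs' (1 : ℝ)),
      L2.inner_indicatorConstLp_one] at h3
    refine h3.congr fun n => ?_
    exact integral_congr_ae (ae_restrict_of_ae (hGc _))
  have hpt : ∀ x, Tendsto (fun n => f ((φ₁ ∘ φ₂) n) x) atTop (𝓝 (g x)) := by
    intro x
    have h3 := (hset (Ioc 0 x) measurableSet_Ioc (by simp)).sub
      (hset (Ioc x 0) measurableSet_Ioc (by simp))
    refine (hc.add h3).congr fun n => ?_
    have := (hf ((φ₁ ∘ φ₂) n)).sub_eq_integral 0 x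
    rw [intervalIntegral] at this
    rw [← this]
    simp
  have hgcont : Continuous g := by
    rw [continuous_iff_continuousAt]
    intro x
    have := (hgac (x - 1) (x + 1)).continuousOn
    rw [uIcc_of_le (by linarith)] at this
    exact this.continuousAt (Icc_mem_nhds (by linarith) (by linarith))
  have hgsq : Continuous fun x => g x ^ 2 + x ^ 2 * g x ^ 2 := by fun_prop
  obtain ⟨hI, -⟩ := integrable_of_tendsto_of_integral_le
    (u := fun n x => f ((φ₁ ∘ φ₂) n) x ^ 2 + x ^ 2 * f ((φ₁ ∘ φ₂) n) x ^ 2)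
    (fun n => (hf _).integrable_sq.add (hf _).integrable_sq_mul_sq)
    (fun n x => by positivity) hgsq.aestronglyMeasurable
    (fun x => ((hpt x).pow 2).add (((hpt x).pow 2).const_mul _))
    (Eventually.of_forall fun n => h2 _)
  have hgE : MemEnergy g := by
    refine memEnergy_iff.2 ⟨hgac, ?_, (memLp_congr_ae hgd).2 hγm, ?_⟩
    · rw [memLp_two_iff_integrable_sq hgcont.aestronglyMeasurable]
      refine hI.mono (hgcont.pow 2).aestronglyMeasurable (ae_of_all _ fun x => ?_)
      rw [Real.norm_of_nonneg (sq_nonneg _), Real.norm_of_nonneg (by positivity)]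
      have : 0 ≤ x ^ 2 * g x ^ 2 := by positivity
      linarith
    · rw [memLp_two_iff_integrable_sq (f := fun x => |x| * g x)
        (continuous_abs.mul hgcont).aestronglyMeasurable]
      refine hI.mono ((continuous_abs.mul hgcont).pow 2).aestronglyMeasurable
        (ae_of_all _ fun x => ?_)
      rw [Real.norm_of_nonneg (sq_nonneg _), Real.norm_of_nonneg (by positivity), mul_pow, sq_abs]
      have : 0 ≤ g x ^ 2 := by positivity
      linarith
  refine ⟨g, φ₁ ∘ φ₂, hφ, hgE, hpt, ?_⟩
  have h3 := hγ' γ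
  simp only [L2.inner_def] at h3
  have e1 : ∫ x, inner ℝ (γ x) (γ x) = ∫ x, deriv g x ^ 2 := by
    refine integral_congr_ae ?_
    filter_upwards [hgd] with x hx
    rw [hx]
    simp [sq]
  rw [e1] at h3
  refine h3.congr fun n => ?_
  refine integral_congr_ae ?_
  filter_upwards [hgd, hGc ((φ₁ ∘ φ₂) n)] with x hx hy
  rw [hx, hy]
  simp [mul_comm]

/-- The potential part of the energy of a reflected pair. -/
noncomputable def potentialDensity (γ : ℝ) (f : ℝ → ℝ) (x : ℝ) : ℝ :=
  (x ^ 2 - 1) * f x ^ 2 + (1 / 2) * f x ^ 4 + (γ / 2) * (f x ^ 2 * f (-x) ^ 2)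

lemma MemEnergy.integrable_potentialDensity {f : ℝ → ℝ} (hf : MemEnergy f) (γ : ℝ) :
    Integrable (potentialDensity γ f) := by
  refine (((hf.integrable_sq_mul_sq.sub hf.integrable_sq).add
    (hf.integrable_pow_four.const_mul (1 / 2))).add
    ((hf.integrable_sq_mul_sq' hf.comp_neg).const_mul (γ / 2))).congr (ae_of_all _ fun x => ?_)
  simp only [Pi.add_apply, Pi.sub_apply, potentialDensity]
  ring

/-- The two components contribute equally after reflection, which absorbs the factor `1/2`; the even
coupling term is shared between them. -/
lemma gpEnergy_reflectPair {f : ℝ → ℝ} (hf : MemEnergy f) (ε γ : ℝ) :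
    gpEnergy ε γ (reflectPair f) =
      ε ^ 2 * (∫ x, deriv f x ^ 2) + ∫ x, potentialDensity γ f x := by
  set A : ℝ → ℝ := fun x => ε ^ 2 * deriv f x ^ 2 + potentialDensity γ f x with hA
  have i1 := hf.integrable_deriv_sq.const_mul (ε ^ 2)
  have i2 := hf.integrable_potentialDensity γ
  have hAI : Integrable A := i1.add i2
  have h1 : gpEnergy ε γ (reflectPair f) = (1 / 2) * ∫ x, (A x + A (-x)) := by
    rw [gpEnergy]
    congr 2
    funext x
    have h2 : deriv (fun x => f (-x)) x = - deriv f (-x) := deriv_comp_neg f x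
    simp only [reflectPair, h2, hA, potentialDensity, neg_neg]
    ring
  rw [h1, integral_add hAI hAI.comp_neg, integral_neg_eq_self A, hA, integral_add i1 i2,
    integral_const_mul]
  ring

lemma integral_indicator_Icc_one {a b : ℝ} (h : a ≤ b) :
    Integrable ((Icc a b).indicator fun _ => (1 : ℝ)) ∧
      ∫ x, (Icc a b).indicator (fun _ => (1 : ℝ)) x = b - a := by
  refine ⟨(integrable_indicator_iff measurableSet_Icc).2 (by simp), ?_⟩
  rw [integral_indicator measurableSet_Icc]
  simp [h]

/-- Adding a fixed integrable function makes the density nonnegative, as Fatou's lemma requires. -/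
lemma potentialDensity_add_nonneg {γ : ℝ} (hγ : 0 ≤ γ) (f : ℝ → ℝ) (x : ℝ) :
    0 ≤ potentialDensity γ f x + (1 / 2) * (Icc (-1 : ℝ) 1).indicator (fun _ => (1 : ℝ)) x := by
  have h0 : 0 ≤ (γ / 2) * (f x ^ 2 * f (-x) ^ 2) := by positivity
  rw [potentialDensity]
  by_cases hx : x ∈ Icc (-1 : ℝ) 1
  · rw [indicator_of_mem hx]
    nlinarith [sq_nonneg (f x ^ 2 - 1), mul_nonneg (sq_nonneg x) (sq_nonneg (f x))]
  · rw [indicator_of_notMem hx]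
    have h4 : 1 ≤ x ^ 2 := by
      by_contra hcon
      exact hx (abs_le.1 ((sq_le_one_iff_abs_le_one x).1 (by linarith)))
    nlinarith [mul_nonneg (sub_nonneg.2 h4) (sq_nonneg (f x)), sq_nonneg (f x ^ 2)]

/-- On `[-2, 2]`, completing the square in `f²/2 · (f² - 3)` costs `9/8`; outside, `x²/2 ≥ 2`
already beats `3/2`. -/
lemma potentialDensity_coercive {γ : ℝ} (hγ : 0 ≤ γ) (f : ℝ → ℝ) (x : ℝ) :
    (1 / 2) * (f x ^ 2 + x ^ 2 * f x ^ 2) ≤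
      potentialDensity γ f x + (9 / 8) * (Icc (-2 : ℝ) 2).indicator (fun _ => (1 : ℝ)) x := by
  have h0 : 0 ≤ (γ / 2) * (f x ^ 2 * f (-x) ^ 2) := by positivity
  rw [potentialDensity]
  by_cases hx : x ∈ Icc (-2 : ℝ) 2
  · rw [indicator_of_mem hx]
    nlinarith [sq_nonneg (f x ^ 2 - 3 / 2), mul_nonneg (sq_nonneg x) (sq_nonneg (f x))]
  · rw [indicator_of_notMem hx]
    have h4 : 4 ≤ x ^ 2 := by
      by_contra hcon
      exact hx (abs_le_of_sq_le_sq' (by linarith) (by norm_num))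
    nlinarith [mul_nonneg (sub_nonneg.2 h4) (sq_nonneg (f x)), sq_nonneg (f x ^ 2)]

lemma gpEnergy_coercive {ε γ : ℝ} (hγ : 0 ≤ γ) {f : ℝ → ℝ} (hf : MemEnergy f) :
    ε ^ 2 * (∫ x, deriv f x ^ 2) + (1 / 2) * (∫ x, (f x ^ 2 + x ^ 2 * f x ^ 2)) ≤
      gpEnergy ε γ (reflectPair f) + 9 / 2 := by
  obtain ⟨hi, hi'⟩ := integral_indicator_Icc_one (a := -2) (b := 2) (by norm_num)
  rw [gpEnergy_reflectPair hf]
  have h1 : ∫ x, (1 / 2) * (f x ^ 2 + x ^ 2 * f x ^ 2) ≤ ∫ x, (potentialDensity γ f x +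
      (9 / 8) * (Icc (-2 : ℝ) 2).indicator (fun _ => (1 : ℝ)) x) :=
    integral_mono ((hf.integrable_sq.add hf.integrable_sq_mul_sq).const_mul _)
      ((hf.integrable_potentialDensity γ).add (hi.const_mul _)) (potentialDensity_coercive hγ f)
  rw [integral_add (hf.integrable_potentialDensity γ) (hi.const_mul _), integral_const_mul,
    integral_const_mul, hi'] at h1
  linarith

/-- Existence of minimizers by the direct method. -/
theorem exists_minimizer {ε γ : ℝ} (hε : 0 < ε) (hγ : 0 ≤ γ) :
    ∃ f, MemEnergy f ∧ IsGlobalMinimizer ε γ symEnergySpace (reflectPair f) := by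
  set S : Set ℝ := (fun f => gpEnergy ε γ (reflectPair f)) '' {f | MemEnergy f} with hS
  have hne : S.Nonempty := ⟨_, _, memEnergy_oddTrial, rfl⟩
  have hlow : ∀ f, MemEnergy f → -(9 / 2) ≤ gpEnergy ε γ (reflectPair f) := fun f hf => by
    have h1 := gpEnergy_coercive (ε := ε) hγ hf
    have h2 : 0 ≤ ∫ x, deriv f x ^ 2 := integral_nonneg fun x => sq_nonneg _
    have h3 : 0 ≤ ∫ x, (f x ^ 2 + x ^ 2 * f x ^ 2) := integral_nonneg fun x => by positivity
    have h4 := mul_nonneg (sq_nonneg ε) h2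
    linarith
  have hbd : BddBelow S := ⟨-(9 / 2), by
    rintro _ ⟨f, hf, rfl⟩
    exact hlow f hf⟩
  obtain ⟨u, -, hu, huS⟩ := exists_seq_tendsto_sInf hne hbd
  set m := sInf S with hm
  obtain ⟨N, hN⟩ := eventually_atTop.1 (hu.eventually_lt_const (lt_add_one m))
  choose F hF hFu using huS
  set f : ℕ → ℝ → ℝ := fun n => F (n + N) with hfdef
  have hf : ∀ n, MemEnergy (f n) := fun n => hF _
  have hfu : ∀ n, gpEnergy ε γ (reflectPair (f n)) = u (n + N) := fun n => hFu _
  have hlim : Tendsto (fun n => gpEnergy ε γ (reflectPair (f n))) atTop (𝓝 m) := by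
    simp only [hfu]
    exact hu.comp (tendsto_add_atTop_nat N)
  have hle : ∀ n, gpEnergy ε γ (reflectPair (f n)) ≤ m + 1 := fun n => by
    rw [hfu]
    exact (hN _ (Nat.le_add_left _ _)).le
  set A := m + 1 + 9 / 2 with hA
  have hb1 : ∀ n, ε ^ 2 * (∫ x, deriv (f n) x ^ 2) ≤ A ∧
      ∫ x, (f n x ^ 2 + x ^ 2 * f n x ^ 2) ≤ 2 * A := fun n => by
    have h1 := gpEnergy_coercive (ε := ε) hγ (hf n)
    have h2 : 0 ≤ ∫ x, deriv (f n) x ^ 2 := integral_nonneg fun x => sq_nonneg _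
    have h3 : 0 ≤ ∫ x, (f n x ^ 2 + x ^ 2 * f n x ^ 2) := integral_nonneg fun x => by positivity
    have h4 := mul_nonneg (sq_nonneg ε) h2
    have h5 := hle n
    constructor <;> linarith
  obtain ⟨g, φ, hφ, hg, hpt, hweak⟩ := exists_subseq_tendsto_of_bounded hf
    (A := max (A / ε ^ 2) (2 * A))
    (fun n => le_max_of_le_left (by
      rw [le_div_iff₀ (by positivity), mul_comm]
      exact (hb1 n).1))
    (fun n => le_max_of_le_right (hb1 n).2)
  have hgm : gpEnergy ε γ (reflectPair g) ≤ m := by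
    refine le_of_forall_pos_le_add fun s hs => ?_
    obtain ⟨hi, hi'⟩ := integral_indicator_Icc_one (a := -1) (b := 1) (by norm_num)
    set D := ∫ x, deriv g x ^ 2 with hD
    -- The error budget: `s'` is lost in the energy limit and `2 ε² s'` in the derivative term.
    set s' := s / (1 + 2 * ε ^ 2) with hs'
    have hs0 : 0 < s' := by positivity
    have hev : ∀ᶠ n in atTop, ∫ x, (potentialDensity γ (f (φ n)) x +
        (1 / 2) * (Icc (-1 : ℝ) 1).indicator (fun _ => (1 : ℝ)) x) ≤
        m + s + 1 - ε ^ 2 * D := by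
      have e1 := (hlim.comp hφ.tendsto_atTop).eventually_lt_const (lt_add_of_pos_right m hs0)
      have e2 := hweak.eventually_const_lt (sub_lt_self D hs0)
      filter_upwards [e1, e2] with n h1 h2
      simp only [Function.comp_apply] at h1
      rw [gpEnergy_reflectPair (hf _)] at h1
      rw [integral_add ((hf _).integrable_potentialDensity γ) (hi.const_mul _), integral_const_mul,
        hi']
      -- Weak lower semicontinuity of the derivative term, from `(f' - g')² ≥ 0`.
      have h3 : 2 * (∫ x, deriv (f (φ n)) x * deriv g x) - D ≤ ∫ x, deriv (f (φ n)) x ^ 2 := by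
        rw [hD, ← integral_const_mul, ← integral_sub
          (((hf _).integrable_deriv_mul_deriv hg).const_mul 2) hg.integrable_deriv_sq]
        refine integral_mono ((((hf _).integrable_deriv_mul_deriv hg).const_mul 2).sub
          hg.integrable_deriv_sq) (hf _).integrable_deriv_sq fun x => ?_
        simp only
        nlinarith [sq_nonneg (deriv (f (φ n)) x - deriv g x)]
      have h4 : ε ^ 2 * (D - 2 * s') ≤ ε ^ 2 * ∫ x, deriv (f (φ n)) x ^ 2 :=
        mul_le_mul_of_nonneg_left (by linarith) (sq_nonneg ε)
      have h5 : s = s' + 2 * ε ^ 2 * s' := by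
        rw [hs']
        field_simp
      nlinarith
    have hcont : AEStronglyMeasurable (fun x => potentialDensity γ g x +
        (1 / 2) * (Icc (-1 : ℝ) 1).indicator (fun _ => (1 : ℝ)) x) volume :=
      (hg.integrable_potentialDensity γ).1.add (hi.const_mul _).1
    obtain ⟨-, h1⟩ := integrable_of_tendsto_of_integral_le
      (fun n => ((hf (φ n)).integrable_potentialDensity γ).add (hi.const_mul (1 / 2)))
      (fun n x => potentialDensity_add_nonneg hγ _ x) hcont
      (fun x => by
        refine Tendsto.add_const _ ?_
        exact ((((hpt x).pow 2).const_mul _).add (((hpt x).pow 4).const_mul _)).add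
          ((((hpt x).pow 2).mul ((hpt (-x)).pow 2)).const_mul _)) hev
    rw [integral_add (hg.integrable_potentialDensity γ) (hi.const_mul _), integral_const_mul,
      hi'] at h1
    rw [gpEnergy_reflectPair hg]
    linarith
  refine ⟨g, hg, hg.reflectPair_mem, fun Ψ' hΨ' => hgm.trans ?_⟩
  rw [eq_reflectPair hΨ']
  exact csInf_le hbd ⟨Ψ'.1, hΨ'.1.1, rfl⟩

/-! ### Regularity and the Euler–Lagrange equation. -/

/-- A test function with vanishing integral is the derivative of a test function. -/
lemma exists_deriv_eq_of_integral_eq_zero {ψ : ℝ → ℝ} (hψ : ContDiff ℝ ∞ ψ)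
    (hψc : HasCompactSupport ψ) (hψ0 : ∫ x, ψ x = 0) :
    ∃ χ : ℝ → ℝ, ContDiff ℝ ∞ χ ∧ HasCompactSupport χ ∧ deriv χ = ψ := by
  have hint : Integrable ψ := hψ.continuous.integrable_of_hasCompactSupport hψc
  have hder : ∀ x, HasDerivAt (fun x => ∫ t in Iic x, ψ t) (ψ x) x := by
    intro x
    have h1 : (fun x => ∫ t in Iic x, ψ t) = fun x => (∫ t in Iic 0, ψ t) + ∫ t in (0)..x, ψ t := by
      funext y
      rw [← intervalIntegral.integral_Iic_sub_Iic hint.integrableOn hint.integrableOn]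
      ring
    rw [h1]
    exact (hψ.continuous.integral_hasStrictDerivAt 0 x).hasDerivAt.const_add _
  have hd : deriv (fun x => ∫ t in Iic x, ψ t) = ψ := funext fun x => (hder x).deriv
  refine ⟨fun x => ∫ t in Iic x, ψ t, ?_, ?_, hd⟩
  · rw [contDiff_infty_iff_deriv, hd]
    exact ⟨fun x => (hder x).differentiableAt, hψ⟩
  · obtain ⟨R, hR⟩ := hψc.isCompact.isBounded.subset_closedBall 0
    have hz : ∀ x, R < |x| → ψ x = 0 := by
      intro x hx
      by_contra hne
      have := hR (subset_tsupport _ hne)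
      rw [mem_closedBall_zero_iff, Real.norm_eq_abs] at this
      linarith
    refine HasCompactSupport.intro (isCompact_closedBall (0 : ℝ) |R|) fun x hx => ?_
    rw [mem_closedBall_zero_iff, Real.norm_eq_abs, not_le] at hx
    have hRR := le_abs_self R
    rcases lt_abs.1 hx with h | h
    · rw [setIntegral_eq_integral_of_forall_compl_eq_zero, hψ0]
      intro t ht
      have : x < t := not_le.1 ht
      exact hz t (by linarith [le_abs_self t])
    · refine setIntegral_eq_zero_of_forall_eq_zero fun t ht => ?_
      have ht' : t ≤ x := ht
      exact hz t (by linarith [neg_le_abs t])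

/-- The du Bois-Reymond lemma: a locally integrable function with zero weak derivative is almost
everywhere constant. -/
lemma ae_eq_const_of_integral_mul_deriv_eq_zero {h : ℝ → ℝ} (hl : LocallyIntegrable h)
    (hh : ∀ φ : ℝ → ℝ, ContDiff ℝ ∞ φ → HasCompactSupport φ → ∫ x, h x * deriv φ x = 0) :
    ∃ c : ℝ, ∀ᵐ x, h x = c := by
  let b : ContDiffBump (0 : ℝ) := default
  set ρ : ℝ → ℝ := b.normed volume with hρ
  have hρs : ContDiff ℝ ∞ ρ := b.contDiff_normed
  have hρc : HasCompactSupport ρ := b.hasCompactSupport_normed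
  have hρi : ∫ x, ρ x = 1 := b.integral_normed
  have hρint : Integrable ρ := hρs.continuous.integrable_of_hasCompactSupport hρc
  have hint : ∀ {g : ℝ → ℝ}, Continuous g → HasCompactSupport g →
      Integrable fun x => h x * g x := fun hg hgc => by
    simpa [mul_comm] using hl.integrable_smul_left_of_hasCompactSupport hg hgc
  refine ⟨∫ x, h x * ρ x, ?_⟩
  refine ae_eq_of_integral_contDiff_smul_eq hl (locallyIntegrable_const _) fun g hg hgc => ?_
  have hgi : Integrable g := hg.continuous.integrable_of_hasCompactSupport hgc
  have i1 := hint hg.continuous hgc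
  have i2 := hint hρs.continuous hρc
  obtain ⟨χ, hχ, hχc, hχd⟩ := exists_deriv_eq_of_integral_eq_zero
    (ψ := fun x => g x - (∫ y, g y) * ρ x) (hg.sub (contDiff_const.mul hρs))
    (hgc.sub hρc.mul_left)
    (by rw [integral_sub hgi (hρint.const_mul _), integral_const_mul, hρi]; ring)
  have h0 := hh χ hχ hχc
  have h1 : ∫ x, h x * (g x - (∫ y, g y) * ρ x) =
      (∫ x, h x * g x) - (∫ y, g y) * ∫ x, h x * ρ x := by
    rw [← integral_const_mul, ← integral_sub i1 (i2.const_mul _)]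
    congr 1
    funext x
    ring
  rw [hχd, h1] at h0
  simp only [smul_eq_mul]
  rw [integral_mul_const]
  simp only [mul_comm (g _)]
  linarith

lemma memEnergy_of_hasCompactSupport {φ : ℝ → ℝ} (hφ : ContDiff ℝ ∞ φ)
    (hφc : HasCompactSupport φ) : MemEnergy φ := by
  have h1 : ContDiff ℝ 1 φ := hφ.of_le (by exact_mod_cast le_top)
  refine MemEnergy.of_contDiff h1 (h1.continuous.memLp_of_hasCompactSupport hφc)
    ((h1.continuous_deriv le_rfl).memLp_of_hasCompactSupport hφc.deriv)
    ((continuous_abs.mul h1.continuous).memLp_of_hasCompactSupport hφc.mul_left)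

/-- Regularity of weak solutions of `ε² f'' = h`. -/
lemma MemEnergy.hasDerivAt_of_weak {f h : ℝ → ℝ} {ε : ℝ} (hε : 0 < ε) (hf : MemEnergy f)
    (hh : Continuous h) (hw : ∀ φ : ℝ → ℝ, ContDiff ℝ ∞ φ → HasCompactSupport φ →
      ∫ x, (ε ^ 2 * (deriv f x * deriv φ x) + h x * φ x) = 0) :
    ContDiff ℝ 2 f ∧ ∀ x, ε ^ 2 * deriv (deriv f) x = h x := by
  set H : ℝ → ℝ := fun x => ∫ t in (0)..x, h t / ε ^ 2 with hH
  have hhc : Continuous fun t => h t / ε ^ 2 := hh.div_const _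
  have hHd : ∀ x, HasDerivAt H (h x / ε ^ 2) x := fun x =>
    (hhc.integral_hasStrictDerivAt 0 x).hasDerivAt
  have hHderiv : deriv H = fun x => h x / ε ^ 2 := funext fun x => (hHd x).deriv
  have hH1 : ContDiff ℝ 1 H := by
    rw [contDiff_one_iff_deriv, hHderiv]
    exact ⟨fun x => (hHd x).differentiableAt, hhc⟩
  have hfl : LocallyIntegrable (deriv f) := hf.memLp_deriv.locallyIntegrable (by norm_num)
  -- The weak equation says that `f'` minus a primitive of `h/ε²` has zero weak derivative.
  obtain ⟨c, hc⟩ := ae_eq_const_of_integral_mul_deriv_eq_zero (h := fun x => deriv f x - H x)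
    (hfl.sub hH1.continuous.locallyIntegrable) (by
      intro φ hφ hφc
      have hφE := memEnergy_of_hasCompactSupport hφ hφc
      have i1 := hf.integrable_deriv_mul_deriv hφE
      have i2 : Integrable fun x => H x * deriv φ x :=
        (hH1.continuous.mul (hφ.continuous_deriv (by simp))).integrable_of_hasCompactSupport
          hφc.deriv.mul_left
      have i3 : Integrable fun x => h x * φ x :=
        (hh.mul hφ.continuous).integrable_of_hasCompactSupport hφc.mul_left
      have h1 := hw φ hφ hφc
      rw [integral_add (i1.const_mul _) i3, integral_const_mul] at h1
      have h2 := IsWeakDeriv.of_absolutelyContinuous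
        (fun a b => hH1.contDiffOn.absolutelyContinuousOnInterval) φ hφ hφc
      have h3 : ∫ x, deriv H x * φ x = (∫ x, h x * φ x) / ε ^ 2 := by
        rw [hHderiv, ← integral_div]
        congr 1
        funext x
        ring
      simp only [sub_mul]
      rw [integral_sub i1 i2, h2, h3]
      field_simp
      linarith)
  have hfd : ∀ x, HasDerivAt f (H x + c) x := by
    have hHc : Continuous fun t => H t + c := hH1.continuous.add continuous_const
    have h1 : f = fun x => f 0 + ∫ t in (0)..x, (H t + c) := by
      funext x
      have h2 := hf.sub_eq_integral 0 x
      have h3 : ∫ t in (0)..x, deriv f t = ∫ t in (0)..x, (H t + c) := by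
        refine intervalIntegral.integral_congr_ae ?_
        filter_upwards [hc] with t ht _
        linarith
      rw [← h3, ← h2]
      ring
    intro x
    rw [h1]
    exact (hHc.integral_hasStrictDerivAt 0 x).hasDerivAt.const_add _
  have hfderiv : deriv f = fun x => H x + c := funext fun x => (hfd x).deriv
  constructor
  · refine (contDiff_succ_iff_deriv (n := 1)).2 ⟨fun x => (hfd x).differentiableAt, by simp, ?_⟩
    rw [hfderiv]
    exact hH1.add contDiff_const
  · intro x
    rw [hfderiv, deriv_add_const, hHderiv]
    field_simp

/-- The Euler-Lagrange equation of symmetric minimizers. -/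
lemma IsGlobalMinimizer.eulerLagrange {ε γ : ℝ} (hε : 0 < ε) {f : ℝ → ℝ} (hf : MemEnergy f)
    (hmin : IsGlobalMinimizer ε γ symEnergySpace (reflectPair f)) :
    ContDiff ℝ 2 f ∧
      ∀ x, ε ^ 2 * deriv (deriv f) x = (x ^ 2 - 1 + f x ^ 2 + γ * f (-x) ^ 2) * f x := by
  have hfc := hf.continuous
  refine hf.hasDerivAt_of_weak hε (by fun_prop) fun φ hφ hφc => ?_
  have hφE := memEnergy_of_hasCompactSupport hφ hφc
  have h1 := hmin.firstVariation_eq_zero hφE.reflectPair_mem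
  set A : ℝ → ℝ := fun x => ε ^ 2 * (deriv f x * deriv φ x) +
    (x ^ 2 - 1 + f x ^ 2 + γ * f (-x) ^ 2) * f x * φ x with hA
  have hAI : Integrable A := by
    refine (((hf.integrable_deriv_mul_deriv hφE).const_mul (ε ^ 2)).add
      (((hf.integrable_sq_mul_mul hφE).sub (hf.integrable_mul hφE)).add
      ((hf.integrable_mul_mul_mul hf hf hφE).add
      ((hf.comp_neg.integrable_mul_mul_mul hf.comp_neg hf hφE).const_mul γ)))).congr
      (ae_of_all _ fun x => ?_)
    simp only [Pi.add_apply, Pi.sub_apply, hA]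
    ring
  -- Symmetric variations suffice: the variation along a reflected test function is twice the scalar
  -- weak form, and the scalar test function is arbitrary.
  have h2 : firstVariation ε γ (reflectPair f) (reflectPair φ) = ∫ x, (A x + A (-x)) := by
    rw [firstVariation]
    congr 1
    funext x
    have e1 : deriv (fun x => f (-x)) x = - deriv f (-x) := deriv_comp_neg f x
    have e2 : deriv (fun x => φ (-x)) x = - deriv φ (-x) := deriv_comp_neg φ x
    simp only [reflectPair, e1, e2, hA, neg_neg]
    ring
  rw [h2, integral_add hAI hAI.comp_neg, integral_neg_eq_self A] at h1
  linarith

/-! ### Rearrangement, ordering and positivity of minimizers. -/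

/-- In these variables the cross terms cancel and only squares of `u`, `w` and their derivatives
remain. Both the rearrangement of `w` and the minimality of the symmetric state rest on this. -/
lemma gpEnergy_add_sub {u w : ℝ → ℝ} (ε γ : ℝ) (hu : MemEnergy u) (hw : MemEnergy w) :
    gpEnergy ε γ (fun x => u x + w x, fun x => u x - w x) =
      ∫ x, (ε ^ 2 * deriv u x ^ 2 + ε ^ 2 * deriv w x ^ 2 + (x ^ 2 - 1) * (u x ^ 2 + w x ^ 2)
        + (u x ^ 2 + w x ^ 2) ^ 2 + (γ - 1) / 2 * (u x ^ 2 - w x ^ 2) ^ 2) := by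
  rw [gpEnergy, ← integral_const_mul]
  refine integral_congr_ae ?_
  filter_upwards [hu.ae_differentiableAt, hw.ae_differentiableAt] with x h1 h2
  rw [deriv_fun_add h1 h2, deriv_fun_sub h1 h2]
  ring

lemma integrable_gpEnergy_add_sub {u w : ℝ → ℝ} (ε γ : ℝ) (hu : MemEnergy u)
    (hw : MemEnergy w) :
    Integrable fun x => ε ^ 2 * deriv u x ^ 2 + ε ^ 2 * deriv w x ^ 2
      + (x ^ 2 - 1) * (u x ^ 2 + w x ^ 2)
      + (u x ^ 2 + w x ^ 2) ^ 2 + (γ - 1) / 2 * (u x ^ 2 - w x ^ 2) ^ 2 := by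
  refine ((((hu.integrable_deriv_sq.const_mul (ε ^ 2)).add
    (hw.integrable_deriv_sq.const_mul (ε ^ 2))).add
    ((hu.integrable_sq_mul_sq.add hw.integrable_sq_mul_sq).sub
      (hu.integrable_sq.add hw.integrable_sq))).add
    (((hu.integrable_pow_four.add hw.integrable_pow_four).const_mul ((γ + 1) / 2)).add
      ((hu.integrable_sq_mul_sq' hw).const_mul (3 - γ)))).congr (ae_of_all _ fun x => ?_)
  simp only [Pi.add_apply, Pi.sub_apply]
  ring

lemma MemEnergy.abs {f : ℝ → ℝ} (hf : MemEnergy f) : MemEnergy fun x => |f x| :=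
  hf.comp_lipschitz (fun x y => abs_abs_sub_abs_le_abs_sub x y) abs_zero

lemma MemEnergy.deriv_abs_sq_le {f : ℝ → ℝ} (hf : MemEnergy f) :
    ∀ᵐ x, deriv (fun x => |f x|) x ^ 2 ≤ deriv f x ^ 2 := by
  filter_upwards [hf.ae_differentiableAt] with x hx
  exact sq_le_sq.2
    (abs_deriv_comp_le_of_lipschitz (fun x y => abs_abs_sub_abs_le_abs_sub x y) hx)

lemma gpEnergy_abs_le {f : ℝ → ℝ} (ε γ : ℝ) (hf : MemEnergy f) :
    gpEnergy ε γ (reflectPair fun x => |f x|) ≤ gpEnergy ε γ (reflectPair f) := by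
  rw [gpEnergy_reflectPair hf.abs, gpEnergy_reflectPair hf]
  have h1 : ∫ x, deriv (fun x => |f x|) x ^ 2 ≤ ∫ x, deriv f x ^ 2 :=
    integral_mono_ae hf.abs.integrable_deriv_sq hf.integrable_deriv_sq hf.deriv_abs_sq_le
  have h2 : potentialDensity γ (fun x => |f x|) = potentialDensity γ f := by
    funext x
    have : |f x| ^ 4 = f x ^ 4 := by
      rw [← abs_pow]
      exact abs_of_nonneg (by positivity)
    simp only [potentialDensity, sq_abs, this]
  rw [h2]
  have := mul_le_mul_of_nonneg_left h1 (sq_nonneg ε)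
  linarith

/-- The odd function that agrees with `|w|` on the positive half line. -/
noncomputable def oddAbs (w : ℝ → ℝ) (x : ℝ) : ℝ := if 0 ≤ x then |w x| else -|w x|

lemma oddAbs_sq (w : ℝ → ℝ) (x : ℝ) : oddAbs w x ^ 2 = w x ^ 2 := by
  unfold oddAbs
  split_ifs <;> simp

lemma abs_oddAbs (w : ℝ → ℝ) (x : ℝ) : |oddAbs w x| = |w x| := by
  rw [← sq_eq_sq_iff_abs_eq_abs, oddAbs_sq]

lemma oddAbs_neg {w : ℝ → ℝ} (hw : ∀ x, w (-x) = - w x) (x : ℝ) :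
    oddAbs w (-x) = - oddAbs w x := by
  have h0 : w 0 = 0 := by
    have := hw 0
    rw [neg_zero] at this
    linarith
  unfold oddAbs
  rw [hw, abs_neg]
  rcases lt_trichotomy x 0 with h | h | h
  · rw [if_pos (by linarith), if_neg (by linarith), neg_neg]
  · simp [h, h0]
  · rw [if_neg (by linarith), if_pos h.le]

/-- The derivative is that of `|w|` with its sign reversed on the left half line; `w 0 = 0` lets the
two halves join continuously. -/
lemma MemEnergy.oddAbs {w : ℝ → ℝ} (hw : MemEnergy w) (h0 : w 0 = 0) :
    MemEnergy (oddAbs w) ∧ ∀ᵐ x, deriv (_root_.oddAbs w) x ^ 2 ≤ deriv w x ^ 2 := by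
  have ha := hw.abs
  set d : ℝ → ℝ := deriv fun x => |w x| with hd
  set g : ℝ → ℝ := (Ici (0 : ℝ)).indicator d - (Iio (0 : ℝ)).indicator d with hg
  have hgm : MemLp g 2 volume :=
    (ha.memLp_deriv.indicator measurableSet_Ici).sub (ha.memLp_deriv.indicator measurableSet_Iio)
  have hgsq : ∀ x, g x ^ 2 = d x ^ 2 := by
    intro x
    simp only [hg, Pi.sub_apply]
    rcases le_or_gt 0 x with h | h
    · rw [indicator_of_mem (mem_Ici.2 h), indicator_of_notMem (by simpa using h)]
      ring
    · rw [indicator_of_notMem (by simpa using h), indicator_of_mem (mem_Iio.2 h)]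
      ring
  have hprim : ∀ x, _root_.oddAbs w x = _root_.oddAbs w 0 + ∫ t in (0)..x, g t := by
    intro x
    have h1 := ha.sub_eq_integral 0 x
    have h2 : _root_.oddAbs w 0 = 0 := by simp [_root_.oddAbs, h0]
    rw [h2, zero_add]
    simp only [h0, abs_zero, sub_zero] at h1
    rcases le_or_gt 0 x with h | h
    · rw [_root_.oddAbs, if_pos h, h1]
      refine intervalIntegral.integral_congr fun t ht => ?_
      rw [uIcc_of_le h] at ht
      simp only [hg, Pi.sub_apply]
      rw [indicator_of_mem (mem_Ici.2 ht.1), indicator_of_notMem (by simpa using ht.1), sub_zero]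
    · rw [_root_.oddAbs, if_neg (not_le.2 h), h1, ← intervalIntegral.integral_neg]
      refine intervalIntegral.integral_congr_ae ?_
      filter_upwards [compl_mem_ae_iff.2 (measure_singleton (0 : ℝ))] with t ht0 ht
      rw [uIoc_of_ge h.le] at ht
      have ht1 : t < 0 := lt_of_le_of_ne ht.2 ht0
      simp only [hg, Pi.sub_apply]
      rw [indicator_of_notMem (by simpa using ht1), indicator_of_mem (mem_Iio.2 ht1), zero_sub]
  obtain ⟨hac, hder⟩ := absolutelyContinuous_primitive hgm hprim
  have hcont : Continuous (_root_.oddAbs w) := by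
    rw [continuous_iff_continuousAt]
    intro x
    have := (hac (x - 1) (x + 1)).continuousOn
    rw [uIcc_of_le (by linarith)] at this
    exact this.continuousAt (Icc_mem_nhds (by linarith) (by linarith))
  refine ⟨memEnergy_iff.2 ⟨hac, ?_, (memLp_congr_ae hder).2 hgm, ?_⟩, ?_⟩
  · exact hw.memLp.mono hcont.aestronglyMeasurable (ae_of_all _ fun x => (abs_oddAbs w x).le)
  · refine hw.memLp_abs_mul.mono (continuous_abs.mul hcont).aestronglyMeasurable
      (ae_of_all _ fun x => ?_)
    rw [norm_mul, norm_mul]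
    exact mul_le_mul_of_nonneg_left (abs_oddAbs w x).le (norm_nonneg _)
  · filter_upwards [hder, hw.deriv_abs_sq_le] with x h1 h2
    rw [h1, hgsq]
    exact h2

/-- Among the minimizers there is a nonnegative one that is ordered on the half line. -/
lemma exists_ordered_minimizer {ε γ : ℝ} (hε : 0 < ε) (hγ : 0 ≤ γ) :
    ∃ g, MemEnergy g ∧ IsGlobalMinimizer ε γ symEnergySpace (reflectPair g) ∧
      (∀ x, 0 ≤ g x) ∧ ∀ x, 0 ≤ x → g (-x) ≤ g x := by
  obtain ⟨f₀, hf₀, hmin₀⟩ := exists_minimizer hε hγ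
  set f : ℝ → ℝ := fun x => |f₀ x| with hfdef
  have hf : MemEnergy f := hf₀.abs
  set u : ℝ → ℝ := fun x => (1 / 2) * (f x + f (-x)) with hu
  set w : ℝ → ℝ := fun x => (1 / 2) * (f x - f (-x)) with hw
  have huE : MemEnergy u := (hf.add hf.comp_neg).const_mul _
  have hwE : MemEnergy w := (hf.sub hf.comp_neg).const_mul _
  have hwodd : ∀ x, w (-x) = - w x := fun x => by simp only [hw, neg_neg]; ring
  have hueven : ∀ x, u (-x) = u x := fun x => by simp only [hu, neg_neg]; ring
  -- The energy sees `w` only through squares, so this replacement does not raise it. Since `f ≥ 0`,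
  -- `|w| ≤ u`, so `u + s` stays nonnegative.
  obtain ⟨hsE, hsd⟩ := hwE.oddAbs (by simp [hw])
  set s := oddAbs w with hs
  have hsodd : ∀ x, s (-x) = - s x := oddAbs_neg hwodd
  have hf0 : ∀ x, 0 ≤ f x := fun x => abs_nonneg _
  have hgpair : reflectPair (fun x => u x + s x) = (fun x => u x + s x, fun x => u x - s x) := by
    refine Prod.ext rfl (funext fun x => ?_)
    simp only [reflectPair, hueven, hsodd]
    ring
  have hfpair : reflectPair f = (fun x => u x + w x, fun x => u x - w x) := by
    refine Prod.ext (funext fun x => ?_) (funext fun x => ?_) <;>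
    · simp only [reflectPair, hu, hw]
      ring
  have hle : gpEnergy ε γ (reflectPair fun x => u x + s x) ≤ gpEnergy ε γ (reflectPair f) := by
    rw [hgpair, hfpair, gpEnergy_add_sub ε γ huE hsE, gpEnergy_add_sub ε γ huE hwE]
    refine integral_mono_ae (integrable_gpEnergy_add_sub ε γ huE hsE)
      (integrable_gpEnergy_add_sub ε γ huE hwE) ?_
    filter_upwards [hsd] with x hx
    have h1 : s x ^ 2 = w x ^ 2 := oddAbs_sq w x
    rw [h1]
    have := mul_le_mul_of_nonneg_left hx (sq_nonneg ε)
    linarith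
  refine ⟨fun x => u x + s x, huE.add hsE, ⟨(huE.add hsE).reflectPair_mem, fun Ψ hΨ =>
    hle.trans ((gpEnergy_abs_le ε γ hf₀).trans (hmin₀.2 Ψ hΨ))⟩, fun x => ?_, fun x hx => ?_⟩
  · have h1 : |s x| ≤ u x := by
      rw [hs, abs_oddAbs, abs_le]
      simp only [hu, hw]
      constructor <;> linarith [hf0 x, hf0 (-x)]
    linarith [neg_le_of_abs_le h1]
  · have h1 : 0 ≤ s x := by
      simp only [hs, oddAbs, if_pos hx]
      exact abs_nonneg _
    simp only [hueven, hsodd]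
    linarith

/-- Uniqueness for linear second order equations with vanishing Cauchy data. -/
lemma eq_zero_of_linear_ode {y q : ℝ → ℝ} (hy : ContDiff ℝ 2 y) (hq : Continuous q)
    (hode : ∀ x, deriv (deriv y) x = q x * y x) {x₀ : ℝ} (h0 : y x₀ = 0)
    (h1 : deriv y x₀ = 0) (x : ℝ) : y x = 0 := by
  have hy1 : ContDiff ℝ 1 (deriv y) := ((contDiff_succ_iff_deriv (n := 1)).1 hy).2.2
  set R := |x - x₀| + 1 with hR
  obtain ⟨C, hC⟩ := (isCompact_Icc (a := x₀ - R) (b := x₀ + R)).exists_bound_of_continuousOn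
    hq.continuousOn
  set v : ℝ → ℝ × ℝ → ℝ × ℝ := fun t p => (p.2, q t * p.1) with hv
  have hLip : ∀ t ∈ Ioo (x₀ - R) (x₀ + R), LipschitzOnWith (max 1 C.toNNReal) (v t) univ := by
    intro t ht
    rw [lipschitzOnWith_univ]
    have hqt : ‖q t‖ ≤ C := hC t (Ioo_subset_Icc_self ht)
    refine LipschitzWith.of_dist_le_mul fun p p' => ?_
    rw [Prod.dist_eq (x := v t p)]
    have hm : (1 : ℝ) ≤ (max 1 C.toNNReal : NNReal) := by
      exact_mod_cast le_max_left _ _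
    have hm' : C ≤ (max 1 C.toNNReal : NNReal) :=
      (Real.le_coe_toNNReal C).trans (by exact_mod_cast le_max_right _ _)
    refine max_le ?_ ?_
    · have : dist p.2 p'.2 ≤ dist p p' := le_max_right _ _
      simp only [hv]
      nlinarith [dist_nonneg (x := p) (y := p')]
    · have h2 : dist p.1 p'.1 ≤ dist p p' := le_max_left _ _
      simp only [hv]
      rw [Real.dist_eq, ← mul_sub, abs_mul, ← Real.dist_eq]
      exact mul_le_mul (hqt.trans hm') h2 dist_nonneg (by positivity)
  have hRpos : 0 < R := by positivity
  have hmem : x ∈ Ioo (x₀ - R) (x₀ + R) := by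
    have h3 := neg_abs_le (x - x₀)
    have h4 := le_abs_self (x - x₀)
    constructor <;> linarith
  have huniq := ODE_solution_unique_of_mem_Ioo (f := fun t => (y t, deriv y t))
    (g := fun _ => (0 : ℝ × ℝ)) (v := v) (s := fun _ => univ) (t₀ := x₀) hLip
    ⟨by linarith, by linarith⟩
    (fun t _ => ⟨by
      have e1 := (hy.differentiable two_ne_zero t).hasDerivAt
      have e2 := (hy1.differentiable one_ne_zero t).hasDerivAt
      rw [hode] at e2
      exact e1.prodMk e2, mem_univ _⟩)
    (fun t _ => ⟨by
      have : v t 0 = 0 := by simp [hv]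
      rw [this]
      exact hasDerivAt_const t 0, mem_univ _⟩)
    (by simp [h0, h1])
  exact congrArg Prod.fst (huniq hmem)

lemma memEnergy_zero : MemEnergy fun _ => 0 := by
  simpa using memEnergy_oddTrial.const_mul 0

lemma mem_symEnergySpace_of_odd {W : ℝ → ℝ} (hW : MemEnergy W) (hodd : ∀ x, W (-x) = - W x) :
    ((W, fun x => - W x) : (ℝ → ℝ) × (ℝ → ℝ)) ∈ symEnergySpace :=
  ⟨⟨hW, hW.neg⟩, fun x => by simp [hodd]⟩

/-- Below the first eigenvalue the trivial state is not a minimizer. -/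
lemma not_isGlobalMinimizer_zero {ε γ : ℝ}
    (hneg : ∫ x, (ε ^ 2 * deriv oddTrial x ^ 2 + (x ^ 2 - 1) * oddTrial x ^ 2) < 0) :
    ¬ IsGlobalMinimizer ε γ symEnergySpace (reflectPair fun _ => 0) := by
  intro hmin
  have hΦ := mem_symEnergySpace_of_odd memEnergy_oddTrial oddTrial_neg
  have h1 := hmin.firstVariation_eq_zero hΦ
  have h2 : halfSecondVariation ε γ (reflectPair fun _ => 0) (oddTrial, fun x => - oddTrial x) =
      ∫ x, (ε ^ 2 * deriv oddTrial x ^ 2 + (x ^ 2 - 1) * oddTrial x ^ 2) := by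
    rw [halfSecondVariation, ← integral_const_mul]
    congr 1
    funext x
    have e : deriv (fun x => - oddTrial x) x = - deriv oddTrial x := deriv.fun_neg
    simp only [reflectPair, e]
    ring
  obtain ⟨t, -, ht⟩ := exists_lower_energy hmin.1.1 hΦ.1 h1 (h2.trans_lt hneg) one_pos
  exact absurd (hmin.2 _ (add_smul_mem_symEnergySpace hmin.1 hΦ t)) (not_le.2 ht)

/-- Existence of a positive symmetric minimizer that is ordered on the half line. -/
lemma exists_positive_ordered_minimizer {ε γ : ℝ} (hε : 0 < ε) (hγ : 0 ≤ γ)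
    (hneg : ∫ x, (ε ^ 2 * deriv oddTrial x ^ 2 + (x ^ 2 - 1) * oddTrial x ^ 2) < 0) :
    ∃ g, MemEnergy g ∧ IsGlobalMinimizer ε γ symEnergySpace (reflectPair g) ∧ ContDiff ℝ 2 g ∧
      (∀ x, ε ^ 2 * deriv (deriv g) x = (x ^ 2 - 1 + g x ^ 2 + γ * g (-x) ^ 2) * g x) ∧
      (∀ x, 0 < g x) ∧ ∀ x, 0 ≤ x → g (-x) ≤ g x := by
  obtain ⟨g, hg, hmin, hg0, hord⟩ := exists_ordered_minimizer hε hγ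
  obtain ⟨hC2, heq⟩ := hmin.eulerLagrange hε hg
  refine ⟨g, hg, hmin, hC2, heq, fun x₀ => (hg0 x₀).lt_of_ne fun h0 => ?_, hord⟩
  have hgc := hg.continuous
  -- A zero of a nonnegative function is a minimum, so both Cauchy data vanish there, `g` is zero,
  -- and the trivial state would be minimal.
  have hloc : deriv g x₀ = 0 := by
    refine IsLocalMin.deriv_eq_zero (Eventually.of_forall fun x => ?_)
    rw [← h0]
    exact hg0 x
  have hz : g = fun _ => 0 := funext fun x => eq_zero_of_linear_ode hC2
    (q := fun x => (x ^ 2 - 1 + g x ^ 2 + γ * g (-x) ^ 2) / ε ^ 2) (by fun_prop)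
    (fun x => by
      have := heq x
      field_simp
      linarith) h0.symm hloc x
  rw [hz] at hmin
  exact not_isGlobalMinimizer_zero hneg hmin

/-- At `γ = 0` the components decouple, and the Euler–Lagrange equation of the positive minimizer is
the scalar equation. -/
lemma exists_isPositiveSolution {ε : ℝ} (hε : 0 < ε)
    (hneg : ∫ x, (ε ^ 2 * deriv oddTrial x ^ 2 + (x ^ 2 - 1) * oddTrial x ^ 2) < 0) :
    ∃ η, IsPositiveSolution ε η := by
  obtain ⟨g, hg, -, hC2, heq, hpos, -⟩ := exists_positive_ordered_minimizer hε le_rfl hneg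
  refine ⟨g, hg.1, hg.2, hC2, hpos, fun x => ?_⟩
  rw [heq]
  ring

/-! ### Minimality and instability of the symmetric state. -/

section SymmetricState

variable {ε γ : ℝ} {η : ℝ → ℝ}

lemma rpow_neg_half_sq (hγ : 0 < γ) : ((1 + γ) ^ (-(1 / 2) : ℝ)) ^ 2 = 1 / (1 + γ) := by
  rw [← Real.rpow_natCast, ← Real.rpow_mul (by linarith),
    show (-(1 / 2) : ℝ) * ((2 : ℕ) : ℝ) = -1 by norm_num, Real.rpow_neg_one, one_div]

lemma symmetricState_mem (h : IsPositiveSolution ε η) : symmetricState γ η ∈ symEnergySpace :=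
  ⟨⟨h.memEnergy.const_mul _, h.memEnergy.const_mul _⟩, fun x => by
    simp [symmetricState, h.even]⟩

/-- Here `w = 0`; subtracting a multiple of the form at `η`, which is zero, leaves only the quartic
term. -/
lemma gpEnergy_symmetricState (h : IsPositiveSolution ε η) (hγ : 0 < γ) :
    gpEnergy ε γ (symmetricState γ η) = ∫ x, -(1 / (2 * (1 + γ))) * η x ^ 4 := by
  have hE := h.memEnergy
  set c := (1 + γ) ^ (-(1 / 2) : ℝ) with hc
  have hc2 : c ^ 2 = 1 / (1 + γ) := rpow_neg_half_sq hγ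
  have h1γ : 1 + γ ≠ 0 := by linarith
  have h1 : symmetricState γ η = (fun x => c * η x + 0, fun x => c * η x - 0) := by
    simp [symmetricState, hc]
  have i1 := hE.integrable_groundForm ε hE
  have h0 : ∫ x, (1 / (1 + γ)) * (ε ^ 2 * deriv η x ^ 2 +
      (x ^ 2 - 1 + η x ^ 2) * η x ^ 2) = 0 := by
    rw [integral_const_mul]
    have := h.groundForm_self
    rw [groundForm] at this
    rw [this, mul_zero]
  rw [h1, gpEnergy_add_sub ε γ (hE.const_mul c) memEnergy_zero]
  refine ((integral_sub (integrable_gpEnergy_add_sub ε γ (hE.const_mul c) memEnergy_zero)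
    (i1.const_mul (1 / (1 + γ)))).trans (by rw [h0, sub_zero])).symm.trans ?_
  congr 1
  funext x
  have hc4 : c ^ 4 = (1 / (1 + γ)) ^ 2 := by rw [← hc2]; ring
  have e1 : deriv (fun x => c * η x) x = c * deriv η x := deriv_const_mul_field c
  simp only [e1, deriv_const', mul_pow]
  rw [show (c ^ 2 * η x ^ 2 + 0 ^ 2) ^ 2 = c ^ 4 * η x ^ 4 by ring,
    show (c ^ 2 * η x ^ 2 - 0 ^ 2) ^ 2 = c ^ 4 * η x ^ 4 by ring, hc4, hc2]
  field_simp
  ring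

/-- To be read with `e = η²`, `a = u²`, `b = w²`; the symmetric state, `a = e/(1+γ)` and `b = 0`,
gives equality. For `γ ≥ 1` the difference is a sum of two squares about that point, and `κ` is what
the coefficient of `e b` dictates. For `γ ≤ 1` one square in `a + b` suffices, the remainder `2(1-γ)
a b` being nonnegative. -/
lemma quartic_lower_bound (hγ : 0 < γ) {κ e a b : ℝ} (ha : 0 ≤ a) (hb : 0 ≤ b)
    (hκ : (γ ≤ 1 ∧ κ = 0) ∨ (1 ≤ γ ∧ κ = 2 * (γ - 1) / (γ + 1))) :
    -(1 / (2 * (1 + γ))) * e ^ 2 ≤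
      κ * (e * b) - e * (a + b) + (a + b) ^ 2 + (γ - 1) / 2 * (a - b) ^ 2 := by
  have h1γ : 0 < 1 + γ := by linarith
  rcases hκ with ⟨h1, rfl⟩ | ⟨h1, rfl⟩
  · have h2 : 0 ≤ (1 - γ) / 2 * (4 * (a * b)) :=
      mul_nonneg (by linarith) (by positivity)
    have h3 : 0 ≤ (γ + 1) / 2 * ((a + b) - e / (1 + γ)) ^ 2 := by positivity
    have h4 : (γ + 1) / 2 * ((a + b) - e / (1 + γ)) ^ 2 =
        (γ + 1) / 2 * (a + b) ^ 2 - e * (a + b) + 1 / (2 * (1 + γ)) * e ^ 2 := by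
      field_simp
      ring
    linarith [show (γ - 1) / 2 * (a - b) ^ 2 =
      (γ - 1) / 2 * (a + b) ^ 2 + (1 - γ) / 2 * (4 * (a * b)) by ring,
      show (γ + 1) / 2 * (a + b) ^ 2 = (a + b) ^ 2 + (γ - 1) / 2 * (a + b) ^ 2 by ring]
  · have h2 : 0 ≤ (a - e / (1 + γ) + b) ^ 2 + (γ - 1) / 2 * (a - e / (1 + γ) - b) ^ 2 :=
      add_nonneg (sq_nonneg _) (mul_nonneg (by linarith) (sq_nonneg _))
    have h3 : (a - e / (1 + γ) + b) ^ 2 + (γ - 1) / 2 * (a - e / (1 + γ) - b) ^ 2 =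
        2 * (γ - 1) / (γ + 1) * (e * b) - e * (a + b) + (a + b) ^ 2 + (γ - 1) / 2 * (a - b) ^ 2
          + 1 / (2 * (1 + γ)) * e ^ 2 := by
      rw [add_comm γ 1]
      field_simp
      ring
    linarith

/-- Linear stability of the symmetric state on odd perturbations implies global minimality. -/
lemma isGlobalMinimizer_symmetricState (h : IsPositiveSolution ε η) (hγ : 0 < γ)
    (hstab : 1 ≤ γ → ∀ W, MemEnergy W → (∀ x, W (-x) = - W x) →
      2 * (γ - 1) / (γ + 1) * ∫ x, η x ^ 2 * W x ^ 2 ≤ groundForm ε η W) :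
    IsGlobalMinimizer ε γ symEnergySpace (symmetricState γ η) := by
  have hE := h.memEnergy
  refine ⟨symmetricState_mem h, fun Ψ hΨ => ?_⟩
  set u : ℝ → ℝ := fun x => (1 / 2) * (Ψ.1 x + Ψ.2 x) with hu
  set w : ℝ → ℝ := fun x => (1 / 2) * (Ψ.1 x - Ψ.2 x) with hw
  have h1 : MemEnergy Ψ.1 := hΨ.1.1
  have h2 : MemEnergy Ψ.2 := hΨ.1.2
  have huE : MemEnergy u := (h1.add h2).const_mul _
  have hwE : MemEnergy w := (h1.sub h2).const_mul _
  have hwodd : ∀ x, w (-x) = - w x := fun x => by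
    have e1 := hΨ.2 x
    have e2 := hΨ.2 (-x)
    rw [neg_neg] at e2
    simp only [hw, e1, e2]
    ring
  obtain ⟨κ, hκ, hκw⟩ : ∃ κ : ℝ, ((γ ≤ 1 ∧ κ = 0) ∨ (1 ≤ γ ∧ κ = 2 * (γ - 1) / (γ + 1))) ∧
      κ * ∫ x, η x ^ 2 * w x ^ 2 ≤ groundForm ε η w := by
    rcases le_total γ 1 with hle | hle
    · exact ⟨0, Or.inl ⟨hle, rfl⟩, by rw [zero_mul]; exact h.groundForm_nonneg hwE⟩
    · exact ⟨_, Or.inr ⟨hle, rfl⟩, hstab hle w hwE hwodd⟩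
  have hΨeq : Ψ = (fun x => u x + w x, fun x => u x - w x) := by
    refine Prod.ext (funext fun x => ?_) (funext fun x => ?_) <;>
    · simp only [hu, hw]
      ring
  have i1 := hE.integrable_groundForm ε huE
  have i2 := hE.integrable_groundForm ε hwE
  have i3 := (hE.integrable_sq_mul_sq' hwE).const_mul κ
  have i4 := integrable_gpEnergy_add_sub ε γ huE hwE
  -- `quartic_lower_bound` integrated: the excess over the symmetric state is at least the form at
  -- `u` plus the form at `w` minus `κ ∫ η² w²`.
  have hfinal : ∫ x, (-(1 / (2 * (1 + γ))) * η x ^ 4 + (ε ^ 2 * deriv u x ^ 2 +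
      (x ^ 2 - 1 + η x ^ 2) * u x ^ 2) + (ε ^ 2 * deriv w x ^ 2 +
      (x ^ 2 - 1 + η x ^ 2) * w x ^ 2)) ≤
      ∫ x, ((ε ^ 2 * deriv u x ^ 2 + ε ^ 2 * deriv w x ^ 2 + (x ^ 2 - 1) * (u x ^ 2 + w x ^ 2)
        + (u x ^ 2 + w x ^ 2) ^ 2 + (γ - 1) / 2 * (u x ^ 2 - w x ^ 2) ^ 2)
        + κ * (η x ^ 2 * w x ^ 2)) := by
    refine integral_mono (((hE.integrable_pow_four.const_mul _).add i1).add i2) (i4.add i3)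
      fun x => ?_
    have := quartic_lower_bound hγ (e := η x ^ 2) (sq_nonneg (u x)) (sq_nonneg (w x)) hκ
    simp only
    linarith [show (η x ^ 2) ^ 2 = η x ^ 4 by ring]
  rw [integral_add (i4) (i3), integral_const_mul,
    integral_add (f := fun x => -(1 / (2 * (1 + γ))) * η x ^ 4 + (ε ^ 2 * deriv u x ^ 2 +
      (x ^ 2 - 1 + η x ^ 2) * u x ^ 2)) ((hE.integrable_pow_four.const_mul _).add i1) i2,
    integral_add (hE.integrable_pow_four.const_mul _) i1] at hfinal
  rw [gpEnergy_symmetricState h hγ, hΨeq, gpEnergy_add_sub ε γ huE hwE]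
  have h3 := h.groundForm_nonneg huE
  rw [groundForm] at h3 hκw
  linarith

/-- Since `c² (1 + γ) = 1`, this is `c` times the weak scalar equation tested with the sum of the
components of `Φ`. -/
lemma firstVariation_symmetricState (h : IsPositiveSolution ε η) (hγ : 0 < γ)
    {Φ : (ℝ → ℝ) × (ℝ → ℝ)} (hΦ : Φ ∈ energySpace) :
    firstVariation ε γ (symmetricState γ η) Φ = 0 := by
  have hp : MemEnergy Φ.1 := hΦ.1
  have hq : MemEnergy Φ.2 := hΦ.2
  have hw := h.weak (hp.add hq)
  set c := (1 + γ) ^ (-(1 / 2) : ℝ) with hc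
  have hc2 : c ^ 2 * (1 + γ) = 1 := by
    rw [rpow_neg_half_sq hγ]
    field_simp
  have : firstVariation ε γ (symmetricState γ η) Φ =
      c * ∫ x, (ε ^ 2 * (deriv η x * deriv (fun x => Φ.1 x + Φ.2 x) x) +
        (x ^ 2 - 1 + η x ^ 2) * (η x * (Φ.1 x + Φ.2 x))) := by
    rw [firstVariation, ← integral_const_mul]
    refine integral_congr_ae ?_
    filter_upwards [hp.ae_differentiableAt, hq.ae_differentiableAt] with x h1 h2
    have e1 : deriv (fun x => c * η x) x = c * deriv η x := deriv_const_mul_field c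
    rw [deriv_fun_add h1 h2]
    simp only [symmetricState, ← hc, e1]
    linear_combination (c * η x ^ 3 * (Φ.1 x + Φ.2 x)) * hc2
  rw [this, hw, mul_zero]

/-- The coefficient is the `κ` of `quartic_lower_bound`; this coincidence makes the stability
threshold sharp for global minimality. -/
lemma halfSecondVariation_symmetricState_odd (h : IsPositiveSolution ε η) (hγ : 0 < γ)
    {W : ℝ → ℝ} (hW : MemEnergy W) :
    halfSecondVariation ε γ (symmetricState γ η) (W, fun x => - W x) =
      groundForm ε η W - 2 * (γ - 1) / (γ + 1) * ∫ x, η x ^ 2 * W x ^ 2 := by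
  have hE := h.memEnergy
  set c := (1 + γ) ^ (-(1 / 2) : ℝ) with hc
  have hc2 : c ^ 2 = 1 / (1 + γ) := rpow_neg_half_sq hγ
  have h1γ : 1 + γ ≠ 0 := by linarith
  rw [halfSecondVariation, groundForm, ← integral_const_mul, ← integral_const_mul,
    ← integral_sub (hE.integrable_groundForm ε hW) ((hE.integrable_sq_mul_sq' hW).const_mul _)]
  congr 1
  funext x
  have e : deriv (fun x => - W x) x = - deriv W x := deriv.fun_neg
  have e2 : 2 * (γ - 1) / (γ + 1) = 1 - (3 - γ) * c ^ 2 := by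
    rw [hc2, add_comm γ 1]
    field_simp
    ring
  simp only [symmetricState, ← hc, e, e2]
  ring

/-- The form vanishes at `η`, leaving `2 ∫ η⁴`. This direction supplies the points of higher energy
near the saddle. -/
lemma halfSecondVariation_symmetricState_self (h : IsPositiveSolution ε η) (hγ : 0 < γ) :
    0 < halfSecondVariation ε γ (symmetricState γ η) (η, η) := by
  have hE := h.memEnergy
  set c := (1 + γ) ^ (-(1 / 2) : ℝ) with hc
  have hc2 : c ^ 2 * (1 + γ) = 1 := by
    rw [rpow_neg_half_sq hγ]
    field_simp
  have h1 : halfSecondVariation ε γ (symmetricState γ η) (η, η) =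
      groundForm ε η η + 2 * ∫ x, η x ^ 4 := by
    rw [halfSecondVariation, groundForm, ← integral_const_mul, ← integral_const_mul,
      ← integral_add (hE.integrable_groundForm ε hE) (hE.integrable_pow_four.const_mul _)]
    congr 1
    funext x
    simp only [symmetricState, ← hc]
    linear_combination (3 * η x ^ 4) * hc2
  rw [h1, h.groundForm_self, zero_add]
  refine mul_pos two_pos ?_
  rw [integral_pos_iff_support_of_nonneg (fun x => by positivity) hE.integrable_pow_four]
  have : (Function.support fun x => η x ^ 4) = univ :=
    eq_univ_of_forall fun x => (pow_pos (h.pos x) 4).ne'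
  rw [this]
  simp

/-- An odd direction of instability makes the symmetric state a saddle point. -/
lemma isSaddlePoint_symmetricState (h : IsPositiveSolution ε η) (hγ : 0 < γ) {W : ℝ → ℝ}
    (hW : MemEnergy W) (hodd : ∀ x, W (-x) = - W x)
    (hneg : groundForm ε η W < 2 * (γ - 1) / (γ + 1) * ∫ x, η x ^ 2 * W x ^ 2) :
    IsSaddlePoint ε γ symEnergySpace (symmetricState γ η) := by
  have hS := symmetricState_mem (γ := γ) h
  have hWS := mem_symEnergySpace_of_odd hW hodd
  have hηS : ((η, η) : (ℝ → ℝ) × (ℝ → ℝ)) ∈ symEnergySpace :=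
    ⟨⟨h.memEnergy, h.memEnergy⟩, fun x => (h.even x).symm⟩
  refine ⟨hS, fun Φ hΦ => ?_, fun δ hδ => ?_, fun δ hδ => ?_⟩
  · have := hasDerivAt_gpEnergy (ε := ε) (γ := γ) hS.1 hΦ.1
    rwa [firstVariation_symmetricState h hγ hΦ.1] at this
  · obtain ⟨t, h1, h2⟩ := exists_lower_energy hS.1 hWS.1
      (firstVariation_symmetricState h hγ hWS.1)
      (by rw [halfSecondVariation_symmetricState_odd h hγ hW]; linarith) hδ
    exact ⟨_, add_smul_mem_symEnergySpace hS hWS t, h1, h2⟩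
  · obtain ⟨t, h1, h2⟩ := exists_higher_energy hS.1 hηS.1
      (firstVariation_symmetricState h hγ hηS.1)
      (halfSecondVariation_symmetricState_self h hγ) hδ
    exact ⟨_, add_smul_mem_symEnergySpace hS hηS t, h1, h2⟩

end SymmetricState

/-! ### Domain walls. -/

lemma gpEnergy_swap (ε γ : ℝ) (Ψ : (ℝ → ℝ) × (ℝ → ℝ)) :
    gpEnergy ε γ Ψ.swap = gpEnergy ε γ Ψ := by
  rw [gpEnergy, gpEnergy]
  congr 2
  funext x
  simp only [Prod.fst_swap, Prod.snd_swap]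
  ring

lemma swap_mem_symEnergySpace {Ψ : (ℝ → ℝ) × (ℝ → ℝ)} (h : Ψ ∈ symEnergySpace) :
    Ψ.swap ∈ symEnergySpace :=
  ⟨⟨h.1.2, h.1.1⟩, fun x => by simp [h.2 (-x)]⟩

lemma IsGlobalMinimizer.swap {ε γ : ℝ} {Ψ : (ℝ → ℝ) × (ℝ → ℝ)}
    (h : IsGlobalMinimizer ε γ symEnergySpace Ψ) :
    IsGlobalMinimizer ε γ symEnergySpace Ψ.swap :=
  ⟨swap_mem_symEnergySpace h.1, fun Ψ' hΨ' => by
    rw [gpEnergy_swap]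
    exact h.2 Ψ' hΨ'⟩

lemma IsDomainWall.swap {ε γ : ℝ} {Ψ : (ℝ → ℝ) × (ℝ → ℝ)} (h : IsDomainWall ε γ Ψ) :
    IsDomainWall ε γ Ψ.swap := by
  obtain ⟨h1, ⟨h2, h3, h4⟩, h5⟩ := h
  refine ⟨swap_mem_symEnergySpace h1, ⟨h3, h2, fun x => ?_⟩, h5.symm⟩
  obtain ⟨e1, e2⟩ := h4 x
  simp only [Prod.fst_swap, Prod.snd_swap]
  constructor <;> linarith

lemma isSolution_reflectPair {ε γ : ℝ} {g : ℝ → ℝ} (hC2 : ContDiff ℝ 2 g)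
    (heq : ∀ x, ε ^ 2 * deriv (deriv g) x = (x ^ 2 - 1 + g x ^ 2 + γ * g (-x) ^ 2) * g x) :
    IsSolution ε γ (reflectPair g) := by
  refine ⟨hC2, hC2.comp contDiff_neg, fun x => ?_⟩
  have h1 : deriv (fun x => g (-x)) = fun x => - deriv g (-x) :=
    funext fun x => deriv_comp_neg g x
  have h2 : deriv (fun x => - deriv g (-x)) x = deriv (deriv g) (-x) := by
    rw [deriv.fun_neg, deriv_comp_neg, neg_neg]
  have e1 := heq x
  have e2 := heq (-x)
  rw [neg_neg] at e2
  simp only [reflectPair, h1, h2]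
  constructor
  · linarith
  · linarith

/-- If the symmetric state is not a minimizer, then there are ordered domain walls that are. -/
lemma exists_domainWall {ε γ : ℝ} {η : ℝ → ℝ} (hε : 0 < ε) (hγ : 0 < γ)
    (hneg : ∫ x, (ε ^ 2 * deriv oddTrial x ^ 2 + (x ^ 2 - 1) * oddTrial x ^ 2) < 0)
    (h : IsPositiveSolution ε η)
    (hnot : ¬ IsGlobalMinimizer ε γ symEnergySpace (symmetricState γ η)) :
    ∃ Ψ : (ℝ → ℝ) × (ℝ → ℝ), (∀ x > 0, Ψ.1 x > Ψ.2 x ∧ Ψ.2 x > 0) ∧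
      IsDomainWall ε γ Ψ ∧ IsGlobalMinimizer ε γ symEnergySpace Ψ := by
  obtain ⟨g, hg, hmin, hC2, heq, hpos, hord⟩ := exists_positive_ordered_minimizer hε hγ.le hneg
  have hgc := hg.continuous
  have hsol := isSolution_reflectPair hC2 heq
  -- If `g` is even, then `√(1+γ) g` is a positive solution of the scalar equation, hence `η`, and
  -- the symmetric state would be minimal.
  have hne : ¬ ∀ x, g x - g (-x) = 0 := by
    intro heven
    apply hnot
    set k := √(1 + γ) with hk
    have h1γ : 0 < 1 + γ := by linarith
    have hk2 : k ^ 2 = 1 + γ := Real.sq_sqrt h1γ.le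
    have hk0 : 0 < k := Real.sqrt_pos.2 h1γ
    have hζE := hg.const_mul k
    have hζ : IsPositiveSolution ε fun x => k * g x := by
      refine ⟨hζE.1, hζE.2, contDiff_const.mul hC2, fun x => mul_pos hk0 (hpos x), fun x => ?_⟩
      have e1 : deriv (fun x => k * g x) = fun x => k * deriv g x :=
        funext fun x => deriv_const_mul_field k
      have e2 : deriv (fun x => k * deriv g x) x = k * deriv (deriv g) x := deriv_const_mul_field k
      have e3 := heq x
      have e4 : g (-x) = g x := by linarith [heven x]
      rw [e4] at e3
      simp only [e1, e2]
      linear_combination k * e3 - k * g x ^ 3 * hk2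
    have hηg := h.unique hζ
    have hstate : symmetricState γ η = reflectPair g := by
      have hck : (1 + γ) ^ (-(1 / 2) : ℝ) * k = 1 := by
        rw [hk, Real.sqrt_eq_rpow, ← Real.rpow_add h1γ]
        norm_num
      refine Prod.ext (funext fun x => ?_) (funext fun x => ?_)
      · simp only [symmetricState, reflectPair, ← hηg]
        linear_combination g x * hck
      · simp only [symmetricState, reflectPair, ← hηg]
        have e4 : g (-x) = g x := by linarith [heven x]
        rw [e4]
        linear_combination g x * hck
    rwa [hstate]
  have hstrict : ∀ x > 0, g (-x) < g x := by
    intro x₀ hx₀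
    refine (hord x₀ hx₀.le).lt_of_ne fun h0 => hne ?_
    have hdC2 : ContDiff ℝ 2 fun x => g x - g (-x) := hC2.sub (hC2.comp contDiff_neg)
    -- The difference `g(x) - g(-x)` solves a linear equation. Near `x₀ > 0` it is nonnegative, so a
    -- zero at `x₀` has zero derivative and forces `g` to be even.
    refine eq_zero_of_linear_ode hdC2 (q := fun x => (x ^ 2 - 1 + g x ^ 2 + g x * g (-x) +
      g (-x) ^ 2 - γ * (g x * g (-x))) / ε ^ 2) (by fun_prop) (fun x => ?_) (x₀ := x₀)
      (by linarith) ?_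
    · have hd1 : ContDiff ℝ 1 (deriv g) := ((contDiff_succ_iff_deriv (n := 1)).1 hC2).2.2
      have e1 : ∀ x, HasDerivAt (fun x => g x - g (-x)) (deriv g x + deriv g (-x)) x := fun x => by
        have a1 := (hC2.differentiable two_ne_zero x).hasDerivAt
        have a2 := (hC2.differentiable two_ne_zero (-x)).hasDerivAt.comp x (hasDerivAt_neg x)
        refine (a1.sub a2).congr_deriv ?_
        ring
      have e2 : HasDerivAt (fun x => deriv g x + deriv g (-x))
          (deriv (deriv g) x - deriv (deriv g) (-x)) x := by
        have a1 := (hd1.differentiable one_ne_zero x).hasDerivAt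
        have a2 := (hd1.differentiable one_ne_zero (-x)).hasDerivAt.comp x (hasDerivAt_neg x)
        refine (a1.add a2).congr_deriv ?_
        ring
      rw [show deriv (fun x => g x - g (-x)) = fun x => deriv g x + deriv g (-x) from
        funext fun x => (e1 x).deriv, e2.deriv]
      have b1 := heq x
      have b2 := heq (-x)
      rw [neg_neg] at b2
      field_simp
      linear_combination b1 - b2
    · refine IsLocalMin.deriv_eq_zero ?_
      filter_upwards [eventually_gt_nhds hx₀] with x hx
      have := hord x hx.le
      linarith
  refine ⟨reflectPair g, fun x hx => ⟨hstrict x hx, hpos _⟩, ⟨hmin.1, hsol, fun heq' => ?_⟩, hmin⟩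
  exact (hstrict 1 one_pos).ne (congrFun heq' 1).symm

/-! ### The threshold and the theorem. -/

/-- The threshold for stability on odd functions. -/
lemma IsPositiveSolution.exists_threshold {ε B : ℝ} {η : ℝ → ℝ} (hε : 0 < ε)
    (h : IsPositiveSolution ε η) (hB0 : 0 ≤ B)
    (hB : ∀ κ, 0 ≤ κ → (∀ W, MemEnergy W → (∀ x, W (-x) = - W x) →
      κ * ∫ x, η x ^ 2 * W x ^ 2 ≤ groundForm ε η W) → κ ≤ B) :
    ∃ κ₀, 0 < κ₀ ∧ κ₀ ≤ B ∧
      (∀ κ ≤ κ₀, ∀ W, MemEnergy W → (∀ x, W (-x) = - W x) →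
        κ * ∫ x, η x ^ 2 * W x ^ 2 ≤ groundForm ε η W) ∧
      ∀ κ > κ₀, ∃ W, MemEnergy W ∧ (∀ x, W (-x) = - W x) ∧
        groundForm ε η W < κ * ∫ x, η x ^ 2 * W x ^ 2 := by
  set K : Set ℝ := {κ | ∀ W, MemEnergy W → (∀ x, W (-x) = - W x) →
    κ * ∫ x, η x ^ 2 * W x ^ 2 ≤ groundForm ε η W} with hK
  obtain ⟨κ₁, hκ₁, hκ₁K⟩ := h.exists_spectral_gap hε
  have hmem : κ₁ ∈ K := fun W hW hodd => hκ₁K W hW (by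
    have := hodd 0
    rw [neg_zero] at this
    linarith)
  have hbdd : ∀ κ ∈ K, κ ≤ B := fun κ hκ => by
    rcases le_total 0 κ with h0 | h0
    · exact hB κ h0 hκ
    · exact h0.trans hB0
  have hbd : BddAbove K := ⟨B, hbdd⟩
  -- The supremum belongs to `K`, since for each `W` the condition is a closed upper bound on `κ`;
  -- `∫ η² W² ≥ 0` makes `K` downward closed.
  refine ⟨sSup K, hκ₁.trans_le (le_csSup hbd hmem), csSup_le ⟨_, hmem⟩ hbdd, ?_, ?_⟩
  · intro κ hκ W hW hodd
    have hI : 0 ≤ ∫ x, η x ^ 2 * W x ^ 2 := integral_nonneg fun x => by positivity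
    refine (mul_le_mul_of_nonneg_right hκ hI).trans ?_
    rcases hI.eq_or_lt with h0 | h0
    · have := hmem W hW hodd
      rw [← h0, mul_zero] at this ⊢
      exact this
    · rw [← le_div_iff₀ h0]
      exact csSup_le ⟨_, hmem⟩ fun κ' hκ' => (le_div_iff₀ h0).2 (hκ' W hW hodd)
  · intro κ hκ
    by_contra hcon
    push Not at hcon
    exact absurd (le_csSup hbd (show κ ∈ K from hcon)) (not_le.2 hκ)

theorem theorem1p3 :
    ∃ (ε₀ : ℝ) (γ₀ : ℝ → ℝ), 0 < ε₀ ∧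
      (∀ ε ∈ Ioo 0 ε₀, 1 < γ₀ ε ∧
        ∃ η : ℝ → ℝ, IsPositiveSolution ε η ∧ (∀ ζ, IsPositiveSolution ε ζ → ζ = η) ∧
          (∀ γ ∈ Ioc 0 (γ₀ ε),
            IsGlobalMinimizer ε γ symEnergySpace (symmetricState γ η)) ∧
          (∀ γ ∈ Ioi (γ₀ ε),
            IsSaddlePoint ε γ symEnergySpace (symmetricState γ η) ∧
            ∃ Ψ : (ℝ → ℝ) × (ℝ → ℝ),
              (∀ x > 0, Ψ.1 x > Ψ.2 x ∧ Ψ.2 x > 0) ∧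
              IsDomainWall ε γ Ψ ∧ IsGlobalMinimizer ε γ symEnergySpace Ψ ∧
              IsDomainWall ε γ Ψ.swap ∧ IsGlobalMinimizer ε γ symEnergySpace Ψ.swap)) ∧
      Tendsto γ₀ (𝓝[>] 0) (𝓝 1) := by
  obtain ⟨ε₁, hε₁, C, hC, hbounds⟩ := exists_oddTrial_bounds
  -- The second bound gives `C ε² ≤ 1`, hence `κ₀ ≤ 1` and a positive denominator `2 - κ₀`.
  set ε₀ := min ε₁ (1 / (C + 1)) with hε₀
  have hε₀pos : 0 < ε₀ := by positivity
  have key : ∀ ε, ∃ γ₀ : ℝ, ε ∈ Ioo 0 ε₀ → (1 < γ₀ ∧ γ₀ ≤ 1 + 2 * (C * ε ^ 2)) ∧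
      ∃ η : ℝ → ℝ, IsPositiveSolution ε η ∧ (∀ ζ, IsPositiveSolution ε ζ → ζ = η) ∧
        (∀ γ ∈ Ioc 0 γ₀, IsGlobalMinimizer ε γ symEnergySpace (symmetricState γ η)) ∧
        (∀ γ ∈ Ioi γ₀, IsSaddlePoint ε γ symEnergySpace (symmetricState γ η) ∧
          ∃ Ψ : (ℝ → ℝ) × (ℝ → ℝ), (∀ x > 0, Ψ.1 x > Ψ.2 x ∧ Ψ.2 x > 0) ∧
            IsDomainWall ε γ Ψ ∧ IsGlobalMinimizer ε γ symEnergySpace Ψ ∧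
            IsDomainWall ε γ Ψ.swap ∧ IsGlobalMinimizer ε γ symEnergySpace Ψ.swap) := by
    intro ε
    by_cases hmem : ε ∈ Ioo 0 ε₀
    swap
    · exact ⟨0, fun h => absurd h hmem⟩
    have hε : 0 < ε := hmem.1
    obtain ⟨hneg, hκB⟩ := hbounds ε hε (hmem.2.trans_le (min_le_left _ _))
    obtain ⟨η, hη⟩ := exists_isPositiveSolution hε hneg
    have hB1 : C * ε ^ 2 ≤ 1 := by
      have h1 : ε * (C + 1) < 1 :=
        (lt_div_iff₀ (by positivity)).1 (hmem.2.trans_le (min_le_right _ _))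
      have h2 : ε < 1 := by nlinarith
      nlinarith
    obtain ⟨κ₀, hκ₀, hκ₀B, hstab, hunstab⟩ := hη.exists_threshold hε (by positivity) (hκB η hη)
    have hκ₀1 : κ₀ ≤ 1 := hκ₀B.trans hB1
    have h2κ : 0 < 2 - κ₀ := by linarith
    -- The solution of `2(γ - 1)/(γ + 1) = κ₀`; it equals `1 + 2κ₀/(2 - κ₀)`, which is at most `1 +
    -- 2κ₀`.
    refine ⟨(2 + κ₀) / (2 - κ₀), fun _ => ⟨⟨?_, ?_⟩, η, hη, fun ζ hζ => hη.unique hζ,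
      fun γ hγ => ?_, fun γ hγ => ?_⟩⟩
    · rw [lt_div_iff₀ h2κ]
      linarith
    · rw [div_le_iff₀ h2κ]
      nlinarith
    · refine isGlobalMinimizer_symmetricState hη hγ.1 fun hγ1 => hstab _ ?_
      have := (le_div_iff₀ h2κ).1 hγ.2
      rw [div_le_iff₀ (by linarith)]
      linarith
    · have hlt : 2 + κ₀ < γ * (2 - κ₀) := (div_lt_iff₀ h2κ).1 hγ
      have hγ0 : 0 < γ := by nlinarith
      obtain ⟨W, hW, hodd, hWneg⟩ := hunstab (2 * (γ - 1) / (γ + 1)) (by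
        rw [gt_iff_lt, lt_div_iff₀ (by linarith)]
        linarith)
      have hsaddle := isSaddlePoint_symmetricState hη hγ0 hW hodd hWneg
      obtain ⟨Ψ, h1, h2, h3⟩ := exists_domainWall hε hγ0 hneg hη fun hmin => by
        obtain ⟨Ψ', hΨ', -, hlow⟩ := hsaddle.2.2.1 1 one_pos
        exact absurd (hmin.2 Ψ' hΨ') (not_le.2 hlow)
      exact ⟨hsaddle, Ψ, h1, h2, h3, h2.swap, h3.swap⟩
  choose γ₀ hγ₀ using key
  refine ⟨ε₀, γ₀, hε₀pos, fun ε hε => ⟨(hγ₀ ε hε).1.1, (hγ₀ ε hε).2⟩, ?_⟩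
  have hlim : Tendsto (fun ε : ℝ => 1 + 2 * (C * ε ^ 2)) (𝓝[>] 0) (𝓝 1) := by
    have : Continuous fun ε : ℝ => 1 + 2 * (C * ε ^ 2) := by fun_prop
    simpa using (this.tendsto 0).mono_left nhdsWithin_le_nhds
  refine tendsto_of_tendsto_of_tendsto_of_le_of_le' tendsto_const_nhds hlim ?_ ?_
  · filter_upwards [Ioo_mem_nhdsGT hε₀pos] with ε hε using (hγ₀ ε hε).1.1.le
  · filter_upwards [Ioo_mem_nhdsGT hε₀pos] with ε hε using (hγ₀ ε hε).1.2
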